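/- Let $(X_i)_{i\ge 1}$ be i.i.d. real random variables with distribution function $F$. For $\gamma\in\mathbb R$ let $F_\gamma(x)=\exp(-(1+\gamma x)^{-1/\gamma})$ if $1+\gamma x>0$, read as $\exp(-e^{-x})$ for $\gamma=0$; where $1+\gamma x\le 0$, put $F_\gamma(x)=0$ if $\gamma>0$ and $F_\gamma(x)=1$ if $\gamma<0$. Suppose that $F$ is in the domain of attraction of $F_{\gamma_0}$ with $\gamma_0>-1$, that is, there are $a_m>0$ and $b_m\in\mathbb R$ with $$\lim_{m\to\infty}F^m(a_mx+b_m)=F_{\gamma_0}(x)\quad\text{for all }x\in\mathbb R. \qquad (1)$$ Let $(a_m),(b_m)$ be either any sequences that satisfy (1) with $a_m>0$ for all large $m$, or the standard choice $b_m=U(m)$, $a_m=a(m)$ for $m\ge 2$, where $U(t)=\inf\{x: 1/(1-F(x))\ge t\}$ for $t>1$ (with $1/0=\infty$) and $$a(t)=\gamma_0U(t)\ (\gamma_0>0),\qquad a(t)=-\gamma_0\Big(\lim_{s\to\infty}U(s)-U(t)\Big)\ (\gamma_0<0),\qquad a(t)=U(t)-\frac1t\int_c^tU(s)\,ds\ (\gamma_0=0),$$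 with any fixed $c\ge 1$ such that $U$ is integrable on $(c,2]$ (a void condition if $c>1$). Let $\ell_\gamma(x)=-(1+1/\gamma)\log(1+\gamma x)-(1+\gamma x)^{-1/\gamma}$ if $1+\gamma x>0$ and $\ell_\gamma(x)=-\infty$ otherwise, with $\ell_0(x)=-x-e^{-x}$, and for $\theta=(\gamma,\mu,\sigma)\in\Theta=(-1,\infty)\times\mathbb R\times(0,\infty)$ let $\ell_\theta(x)=\ell_\gamma((x-\mu)/\sigma)-\log\sigma$. Let $m(n)$ be positive integers with $m(n)/\log n\to\infty$ as $n\to\infty$, let $M_{k,m}=\max(X_{(k-1)m+1},\dots,X_{km})$, and put $$\widetilde L_n(\theta)=\frac1n\sum_{k=1}^n\ell_\theta\Big(\frac{M_{k,m(n)}-b_{m(n)}}{a_{m(n)}}\Big),\qquad \theta\in\Theta .$$ Let $K\subset\Theta$ be a compact neighborhood of $\theta_0=(\gamma_0,0,1)$. Then $\widetilde L_n$ attains its maximum over $K$ for every $n$, and for every choice of maximizers $\widetilde\theta_n^K\in\operatorname{argmax}_{\theta\in K}\widetilde L_n(\theta)$, $n\ge 1$, $$\lim_{n\to\infty}\widetilde\theta_n^K=\theta_0\quad\text{almost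 surely.}$$ -/

import Mathlib

open Filter Topology MeasureTheory ProbabilityTheory

noncomputable section

/-- The extreme value distribution function `F_γ`, extended to all of `ℝ`:
`exp (-(1 + γ x)^(-1/γ))` where `1 + γ x > 0` (`exp (-exp (-x))` if `γ = 0`); off this domain it is
`0` if `γ > 0` (left of the support) and `1` if `γ < 0` (right of the support). -/
def gevCDF (γ x : ℝ) : ℝ :=
  if γ = 0 then Real.exp (-Real.exp (-x))
  else if 0 < 1 + γ * x then Real.exp (-(1 + γ * x) ^ (-1 / γ))
  else if 0 < γ then 0 else 1

/-- `(a_m)`, `(b_m)` normalize `F` to `G_γ`: `a_m > 0` (finitely many `m` play no role) and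
`F^m(a_m x + b_m) → F_γ(x)` for every real `x`. -/
def IsNorming (F : ℝ → ℝ) (γ : ℝ) (a b : ℕ → ℝ) : Prop :=
  (∀ᶠ m in atTop, 0 < a m) ∧
    ∀ x : ℝ, Tendsto (fun m : ℕ => F (a m * x + b m) ^ m) atTop (𝓝 (gevCDF γ x))

/-- `F ∈ D(G_γ)`: `F` is in the domain of attraction of `G_γ`. -/
def InDomainOfAttraction (F : ℝ → ℝ) (γ : ℝ) : Prop :=
  ∃ a b : ℕ → ℝ, IsNorming F γ a b

/-- The left-continuous inverse `U(t) = inf {x | 1 / (1 - F x) ≥ t}` of `1 / (1 - F)`, where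
`1 / 0 = ∞`; the inequality is written without the division. Meaningful for `t > 1`. -/
def tailQuantile (F : ℝ → ℝ) (t : ℝ) : ℝ :=
  sInf {x : ℝ | t * (1 - F x) ≤ 1}

/-- The standard auxiliary function `a(t)`: `γ U(t)` for `γ > 0`, `-γ (U(∞) - U(t))` for `γ < 0`,
and `U(t)` minus `1/t` times the integral of `U` from `c` to `t` for `γ = 0`. Since `U` is monotone
on `(1, ∞)`, its limit `U(∞)` is its supremum there. -/
def auxScale (F : ℝ → ℝ) (γ c t : ℝ) : ℝ :=
  if 0 < γ then γ * tailQuantile F t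
  else if γ < 0 then -γ * (sSup (tailQuantile F '' Set.Ioi 1) - tailQuantile F t)
  else tailQuantile F t - t⁻¹ * ∫ s in c..t, tailQuantile F s

/-- The standard choice `a_m = a(m)`, `b_m = U(m)`. The lower limit `c ≥ 1` of the integral in the
case `γ = 0` is any number such that `U` is integrable near `c` (every `c > 1` is one); for
`γ ≠ 0` it plays no role. The value `m = 1` is left out because `U(1) = -∞`. -/
def IsStandardNorming (F : ℝ → ℝ) (γ : ℝ) (a b : ℕ → ℝ) : Prop :=
  ∃ c : ℝ, 1 ≤ c ∧ IntegrableOn (tailQuantile F) (Set.Ioc c 2) ∧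
    ∀ m : ℕ, 2 ≤ m → a m = auxScale F γ c m ∧ b m = tailQuantile F m

/-- The log-likelihood `ℓ_γ(x)` of `G_γ`, with value `-∞` where `1 + γ x ≤ 0`. -/
def gevLogLik₁ (γ x : ℝ) : EReal :=
  if 0 < 1 + γ * x then
    ((if γ = 0 then -x - Real.exp (-x)
      else -(1 + 1 / γ) * Real.log (1 + γ * x) - (1 + γ * x) ^ (-1 / γ) : ℝ) : EReal)
  else ⊥

/-- The log-likelihood `ℓ_{(γ, μ, σ)}(x) = ℓ_γ((x - μ) / σ) - log σ`, `θ = (γ, μ, σ)`. -/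
def gevLogLik (θ : ℝ × ℝ × ℝ) (x : ℝ) : EReal :=
  gevLogLik₁ θ.1 ((x - θ.2.1) / θ.2.2) - ((Real.log θ.2.2 : ℝ) : EReal)

/-- The parameter space `Θ = (-1, ∞) × ℝ × (0, ∞)`. -/
def gevParamSpace : Set (ℝ × ℝ × ℝ) :=
  {θ | -1 < θ.1 ∧ 0 < θ.2.2}

variable {Ω : Type*}

/-- The maximum of the `k`-th block of length `m`; observations and blocks are numbered from `0`,
so the block consists of `X (k * m), …, X (k * m + m - 1)`. -/
def blockMax (X : ℕ → Ω → ℝ) (m k : ℕ) (ω : Ω) : ℝ :=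
  ⨆ j : Fin m, X (k * m + j) ω

/-- The normalized block maximum `(M_{k,m} - b_m) / a_m`. -/
def normBlockMax (X : ℕ → Ω → ℝ) (a b : ℕ → ℝ) (m k : ℕ) (ω : Ω) : ℝ :=
  (blockMax X m k ω - b m) / a m

/-- The normalized log-likelihood: the mean of `ℓ_θ` over the first `n` normalized maxima of blocks
of length `m`, with values in `[-∞, ∞)`. -/
def normLogLik (X : ℕ → Ω → ℝ) (a b : ℕ → ℝ) (m n : ℕ) (ω : Ω) (θ : ℝ × ℝ × ℝ) : EReal :=
  (((n : ℝ)⁻¹ : ℝ) : EReal) * ∑ k ∈ Finset.range n, gevLogLik θ (normBlockMax X a b m k ω)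

end

/-! This is Wald's consistency argument, adapted to a triangular array and to a log-likelihood that
takes the value `⊥`. Let `θ'` be a limit point of maximizers, which exists because `K` is compact.
It is shown that the expectation of `ℓ_θ'` under the limit law is at least that of the true
log-likelihood; Gibbs' inequality with its case of equality (`eq_of_integral_le`) then forces `θ' =
θ₀`.

Upper bound. Since `γ > -1`, `ℓ_θ(x)` tends to `⊥` at both ends of the support, so it is jointly
continuous into `EReal` (`continuousAt_gevLogLik`) and bounded above on `K`. Clipped from below at
`-M` it is bounded and jointly continuous, so its averages along converging parameters converge once
the empirical laws do (`tendsto_average_gevClip`). The empirical laws converge weakly almost surely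
by a strong law for arrays with independent rows (`ae_tendsto_empiricalLaw`).

Lower bound. The mean log-likelihood at `θ₀` itself is of no use: some normalized maxima may lie
outside the support of `G_θ₀`, and then it is `⊥`. The maximizers are compared instead with
`shiftedParam γ δ`, whose support is larger by `δ` at its finite end. There the log-likelihoods of
the observed maxima are finite, and replacing them by their clipped versions at `-L` changes the
mean by at most `C / L`, with `C` independent of `n` and `L` (`ae_le_meanLogLik_shiftedParam`). This
rests on Potter bounds for the tail quantile function with the sharp constant `1 / |γ|` at the
finite end (`tailQuantile_sub_le_of_pos`, `tailQuantile_sub_le_of_neg`), and on moments of `m (1 -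
F(M))` and of `m` times the tail probability at `M`. The Potter bounds apply once all `n` block
maxima exceed a fixed level, and this is where `m(n) / log n → ∞` is needed.

The limits are taken in the order `n → ∞`, `L → ∞`, `δ → 0`, `M → ∞`; the cost of the shift is
`O(δ)` (`exists_le_gevLogLik_shiftedParam`). The standard norming sequences are reduced to the
general case by convergence of types (`IsStandardNorming.isNorming`). -/

noncomputable section

/-! ### The extreme value distribution functions in the Gumbel coordinate, uniformly in `γ`. -/

/-- The Gumbel coordinate `w` of a point `x` of the support of `G_γ`, so that
`(1 + γ x)^(-1/γ) = exp (-w)`. -/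
def gumbelCoord (γ x : ℝ) : ℝ := if γ = 0 then x else Real.log (1 + γ * x) / γ

/-- The inverse of `gumbelCoord γ`. -/
def gevQuantile (γ w : ℝ) : ℝ := if γ = 0 then w else (Real.exp (γ * w) - 1) / γ

lemma one_add_mul_gevQuantile (γ w : ℝ) : 1 + γ * gevQuantile γ w = Real.exp (γ * w) := by
  unfold gevQuantile
  split_ifs with h
  · simp [h]
  · field_simp
    ring

lemma one_add_mul_gevQuantile_pos (γ w : ℝ) : 0 < 1 + γ * gevQuantile γ w := by
  rw [one_add_mul_gevQuantile]
  positivity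

lemma gumbelCoord_gevQuantile (γ w : ℝ) : gumbelCoord γ (gevQuantile γ w) = w := by
  by_cases h : γ = 0
  · simp [gumbelCoord, gevQuantile, h]
  · rw [gumbelCoord, if_neg h, one_add_mul_gevQuantile, Real.log_exp]
    field_simp

lemma gevQuantile_gumbelCoord {γ x : ℝ} (hx : 0 < 1 + γ * x) :
    gevQuantile γ (gumbelCoord γ x) = x := by
  by_cases h : γ = 0
  · simp [gumbelCoord, gevQuantile, h]
  · have : γ * (Real.log (1 + γ * x) / γ) = Real.log (1 + γ * x) := by field_simp
    rw [gumbelCoord, if_neg h, gevQuantile, if_neg h, this, Real.exp_log hx]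
    field_simp
    ring

lemma hasDerivAt_gevQuantile (γ w : ℝ) :
    HasDerivAt (gevQuantile γ) (Real.exp (γ * w)) w := by
  by_cases h : γ = 0
  · subst h
    have : gevQuantile 0 = fun w => w := by
      ext w
      simp [gevQuantile]
    rw [this]
    simpa using hasDerivAt_id' w
  · have h1 : gevQuantile γ = fun w => (Real.exp (γ * w) - 1) / γ := by
      ext w
      simp [gevQuantile, h]
    rw [h1]
    have h2 : HasDerivAt (fun w : ℝ => γ * w) γ w := by
      simpa using (hasDerivAt_id w).const_mul γ
    have h3 := ((h2.exp).sub_const 1).div_const γ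
    rwa [mul_div_assoc, div_self h, mul_one] at h3

lemma continuous_gevQuantile (γ : ℝ) : Continuous (gevQuantile γ) :=
  continuous_iff_continuousAt.2 fun w => (hasDerivAt_gevQuantile γ w).continuousAt

lemma strictMono_gevQuantile (γ : ℝ) : StrictMono (gevQuantile γ) :=
  strictMono_of_deriv_pos fun w => by
    rw [(hasDerivAt_gevQuantile γ w).deriv]
    positivity

lemma gevQuantile_zero (γ : ℝ) : gevQuantile γ 0 = 0 := by
  simp [gevQuantile]

lemma gevCDF_of_pos {γ x : ℝ} (hx : 0 < 1 + γ * x) :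
    gevCDF γ x = Real.exp (-Real.exp (-gumbelCoord γ x)) := by
  unfold gevCDF gumbelCoord
  by_cases h : γ = 0
  · simp [h]
  · simp only [h, if_false, hx, if_true]
    rw [Real.rpow_def_of_pos hx]
    congr 3
    ring

lemma gevCDF_gevQuantile (γ w : ℝ) :
    gevCDF γ (gevQuantile γ w) = Real.exp (-Real.exp (-w)) := by
  rw [gevCDF_of_pos (one_add_mul_gevQuantile_pos γ w), gumbelCoord_gevQuantile]

lemma gevCDF_of_nonpos {γ x : ℝ} (hx : 1 + γ * x ≤ 0) :
    gevCDF γ x = if 0 < γ then 0 else 1 := by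
  have h : γ ≠ 0 := by
    rintro rfl
    norm_num at hx
  simp [gevCDF, h, not_lt.2 hx]

lemma gevCDF_nonneg (γ x : ℝ) : 0 ≤ gevCDF γ x := by
  by_cases hx : 0 < 1 + γ * x
  · rw [gevCDF_of_pos hx]
    positivity
  · rw [gevCDF_of_nonpos (not_lt.1 hx)]
    split_ifs <;> norm_num

lemma gevCDF_le_one (γ x : ℝ) : gevCDF γ x ≤ 1 := by
  by_cases hx : 0 < 1 + γ * x
  · rw [gevCDF_of_pos hx, Real.exp_le_one_iff]
    have := Real.exp_pos (-gumbelCoord γ x)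
    linarith
  · rw [gevCDF_of_nonpos (not_lt.1 hx)]
    split_ifs <;> norm_num

lemma monotone_gevCDF (γ : ℝ) : Monotone (gevCDF γ) := by
  intro x y hxy
  by_cases hx : 0 < 1 + γ * x
  · by_cases hy : 0 < 1 + γ * y
    · have : gumbelCoord γ x ≤ gumbelCoord γ y := by
        rw [← (strictMono_gevQuantile γ).le_iff_le, gevQuantile_gumbelCoord hx,
          gevQuantile_gumbelCoord hy]
        exact hxy
      rw [gevCDF_of_pos hx, gevCDF_of_pos hy]
      gcongr
    · have hγ : ¬ 0 < γ := fun h => hy (hx.trans_le (by nlinarith))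
      rw [gevCDF_of_nonpos (not_lt.1 hy), if_neg hγ]
      exact gevCDF_le_one _ _
  · by_cases hγ : 0 < γ
    · rw [gevCDF_of_nonpos (not_lt.1 hx), if_pos hγ]
      exact gevCDF_nonneg _ _
    · rw [gevCDF_of_nonpos (γ := γ) (x := y) (by nlinarith [not_lt.1 hx, not_lt.1 hγ]),
        gevCDF_of_nonpos (not_lt.1 hx)]

lemma exists_exp_neg_exp_neg_eq {c : ℝ} (h0 : 0 < c) (h1 : c < 1) :
    ∃ w : ℝ, Real.exp (-Real.exp (-w)) = c := by
  have hl : 0 < -Real.log c := by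
    have := Real.log_neg h0 h1
    linarith
  refine ⟨-Real.log (-Real.log c), ?_⟩
  rw [neg_neg, Real.exp_log hl, neg_neg, Real.exp_log h0]

/-- A quantile at a level strictly between `c` and `F_γ(x)` does it; `0 ≤ c` puts that level in `(0,
1)`. This and its mirror image are the continuity of `F_γ` needed in `IsNorming.of_equiv`. -/
lemma exists_lt_of_lt_gevCDF {γ x c : ℝ} (h : c < gevCDF γ x) :
    0 ≤ c → ∃ y < x, c < gevCDF γ y := by
  intro hc
  obtain ⟨d, hd1, hd2⟩ := exists_between h
  obtain ⟨w, hw⟩ := exists_exp_neg_exp_neg_eq (hc.trans_lt hd1) (hd2.trans_le (gevCDF_le_one _ _))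
  refine ⟨gevQuantile γ w, ?_, by rwa [gevCDF_gevQuantile, hw]⟩
  by_contra! hx
  have := monotone_gevCDF γ hx
  rw [gevCDF_gevQuantile, hw] at this
  linarith

lemma exists_gt_of_gevCDF_lt {γ x c : ℝ} (h : gevCDF γ x < c) :
    c ≤ 1 → ∃ y > x, gevCDF γ y < c := by
  intro hc
  obtain ⟨d, hd1, hd2⟩ := exists_between h
  obtain ⟨w, hw⟩ := exists_exp_neg_exp_neg_eq ((gevCDF_nonneg _ _).trans_lt hd1) (hd2.trans_le hc)
  refine ⟨gevQuantile γ w, ?_, by rwa [gevCDF_gevQuantile, hw]⟩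
  by_contra! hx
  have := monotone_gevCDF γ hx
  rw [gevCDF_gevQuantile, hw] at this
  linarith

/-- Off the support only the values `0` and `1` occur, and on it `F_γ` is injective. -/
lemma eq_gevQuantile_of_gevCDF_eq {γ x w : ℝ}
    (h : gevCDF γ x = Real.exp (-Real.exp (-w))) : x = gevQuantile γ w := by
  by_cases hx : 0 < 1 + γ * x
  · rw [gevCDF_of_pos hx] at h
    have : gumbelCoord γ x = w := by simpa using h
    rw [← this, gevQuantile_gumbelCoord hx]
  · rw [gevCDF_of_nonpos (not_lt.1 hx)] at h
    have h1 := Real.exp_pos (-Real.exp (-w))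
    have h2 : Real.exp (-Real.exp (-w)) < 1 := by
      rw [Real.exp_lt_one_iff]
      have := Real.exp_pos (-w)
      linarith
    split_ifs at h <;> linarith

/-! ### The log-likelihood: upper bound, joint continuity, existence of maximizers. -/

/-- The log-density of the Gumbel law with tail index `γ` in the Gumbel coordinate. -/
def gumbelLogLik (γ w : ℝ) : ℝ := -(1 + γ) * w - Real.exp (-w)

lemma gevLogLik₁_of_pos {γ x : ℝ} (hx : 0 < 1 + γ * x) :
    gevLogLik₁ γ x = ((gumbelLogLik γ (gumbelCoord γ x) : ℝ) : EReal) := by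
  unfold gevLogLik₁ gumbelLogLik gumbelCoord
  simp only [hx, if_true]
  by_cases h : γ = 0
  · simp [h]
  · simp only [h, if_false]
    rw [Real.rpow_def_of_pos hx]
    congr 1
    have : Real.log (1 + γ * x) * (-1 / γ) = -(Real.log (1 + γ * x) / γ) := by ring
    rw [this]
    field_simp
    ring

lemma gevLogLik₁_of_nonpos {γ x : ℝ} (hx : 1 + γ * x ≤ 0) : gevLogLik₁ γ x = ⊥ := by
  simp [gevLogLik₁, not_lt.2 hx]

lemma gevLogLik_of_pos {θ : ℝ × ℝ × ℝ} {x : ℝ} (hx : 0 < 1 + θ.1 * ((x - θ.2.1) / θ.2.2)) :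
    gevLogLik θ x = ((gumbelLogLik θ.1 (gumbelCoord θ.1 ((x - θ.2.1) / θ.2.2))
      - Real.log θ.2.2 : ℝ) : EReal) := by
  rw [gevLogLik, gevLogLik₁_of_pos hx]
  norm_cast

lemma gevLogLik_of_nonpos {θ : ℝ × ℝ × ℝ} {x : ℝ}
    (hx : 1 + θ.1 * ((x - θ.2.1) / θ.2.2) ≤ 0) : gevLogLik θ x = ⊥ := by
  rw [gevLogLik, gevLogLik₁_of_nonpos hx, EReal.bot_sub]

/-- For `w ≤ 0` the exponential beats the linear term: `exp |w| ≥ w² / 2`, and `(κ + L)|w| - w² / 2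
≤ (κ + L)² / 2`. With `κ > 0`, possible because `γ > -1`, the bound forces decay at both ends,
locally uniformly in `γ`; with `κ = 0` it is a plain upper bound. -/
lemma gumbelLogLik_le {γ κ L w : ℝ} (h1 : κ ≤ 1 + γ) (h2 : 1 + γ ≤ L) :
    gumbelLogLik γ w ≤ -κ * |w| + (κ + L) ^ 2 / 2 := by
  unfold gumbelLogLik
  rcases le_total 0 w with hw | hw
  · rw [abs_of_nonneg hw]
    have := Real.exp_pos (-w)
    nlinarith [sq_nonneg (κ + L), mul_le_mul_of_nonneg_right h1 hw]
  · rw [abs_of_nonpos hw]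
    have := Real.quadratic_le_exp_of_nonneg (x := -w) (by linarith)
    nlinarith [sq_nonneg (κ + L + w), mul_le_mul_of_nonneg_right h2 (neg_nonneg.2 hw)]

/-- The singularity at `γ = 0` is removable: `log (1 + γ x) / γ` is `x` times the slope of `y ↦ log
(1 + y)` between `0` and `γ x`. -/
lemma continuousAt_gumbelCoord {γ x : ℝ} (hx : 0 < 1 + γ * x) :
    ContinuousAt (fun p : ℝ × ℝ => gumbelCoord p.1 p.2) (γ, x) := by
  set f : ℝ → ℝ := fun y => Real.log (1 + y) with hf
  have hfd : HasDerivAt f 1 0 := by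
    have h1 : HasDerivAt (fun y : ℝ => 1 + y) 1 0 := (hasDerivAt_id (0 : ℝ)).const_add 1
    simpa using h1.log (by norm_num)
  have heq : (fun p : ℝ × ℝ => gumbelCoord p.1 p.2)
      = fun p : ℝ × ℝ => p.2 * dslope f 0 (p.1 * p.2) := by
    ext ⟨g, y⟩
    simp only [gumbelCoord]
    by_cases hg : g = 0
    · simp [hg, hfd.deriv]
    · by_cases hy : y = 0
      · simp [hy]
      · rw [dslope_of_ne _ (mul_ne_zero hg hy), slope_def_field]
        simp only [hg, if_false, hf]
        field_simp
        simp [mul_comm]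
  rw [heq]
  have hc : ContinuousAt (dslope f 0) (γ * x) := by
    by_cases h0 : γ * x = 0
    · rw [h0]
      exact continuousAt_dslope_same.2 hfd.differentiableAt
    · rw [continuousAt_dslope_of_ne h0]
      exact (continuousAt_const.add continuousAt_id).log hx.ne'
  have hc' : ContinuousAt (fun p : ℝ × ℝ => dslope f 0 (p.1 * p.2)) (γ, x) :=
    ContinuousAt.comp (g := dslope f 0) (f := fun p : ℝ × ℝ => p.1 * p.2) hc (by fun_prop)
  exact continuousAt_snd.mul hc'

lemma continuousAt_gevLogLik₁ {γ x : ℝ} (hγ : -1 < γ) :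
    ContinuousAt (fun p : ℝ × ℝ => gevLogLik₁ p.1 p.2) (γ, x) := by
  have hz : Continuous (fun p : ℝ × ℝ => 1 + p.1 * p.2) := by fun_prop
  rcases lt_trichotomy (1 + γ * x) 0 with h | h | h
  · have : ∀ᶠ p : ℝ × ℝ in 𝓝 (γ, x), gevLogLik₁ p.1 p.2 = ⊥ := by
      filter_upwards [hz.continuousAt.eventually (gt_mem_nhds h)] with p hp
      exact gevLogLik₁_of_nonpos (le_of_lt hp)
    refine ContinuousAt.congr (f := fun _ => (⊥ : EReal)) continuousAt_const ?_
    filter_upwards [this] with p hp using hp.symm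
  · have hγ0 : γ ≠ 0 := by
      rintro rfl
      norm_num at h
    rw [ContinuousAt, gevLogLik₁_of_nonpos h.le, EReal.tendsto_nhds_bot_iff_real]
    intro c
    set κ := (1 + γ) / 2 with hκ
    set L := 2 + γ with hL
    have hκ0 : 0 < κ := by
      rw [hκ]
      linarith
    -- Chosen so that `-κ N + (κ + L)² / 2 = c - κ < c`; it then suffices that the Gumbel coordinate
    -- has absolute value at least `N`.
    set N := (((κ + L) ^ 2 / 2 - c) / κ + 1) with hN
    set N' := max N 0 with hN'
    have e1 : ∀ᶠ p : ℝ × ℝ in 𝓝 (γ, x), κ < 1 + p.1 :=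
      (show Continuous fun p : ℝ × ℝ => 1 + p.1 by fun_prop).continuousAt.eventually
        (lt_mem_nhds (by simp only; linarith))
    have e2 : ∀ᶠ p : ℝ × ℝ in 𝓝 (γ, x), 1 + p.1 < L :=
      (show Continuous fun p : ℝ × ℝ => 1 + p.1 by fun_prop).continuousAt.eventually
        (gt_mem_nhds (by simp only; linarith))
    have e3 : ∀ᶠ p : ℝ × ℝ in 𝓝 (γ, x), |p.1| < 2 * |γ| :=
      (show Continuous fun p : ℝ × ℝ => |p.1| by fun_prop).continuousAt.eventually
        (gt_mem_nhds (by simp only; linarith [abs_pos.2 hγ0]))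
    have e4 : ∀ᶠ p : ℝ × ℝ in 𝓝 (γ, x), p.1 ≠ 0 :=
      continuousAt_fst.eventually_ne hγ0
    -- Dividing the logarithm of this bound by `|p.1| < 2 |γ|` gives a Gumbel coordinate of size at
    -- least `N'`.
    have e5 : ∀ᶠ p : ℝ × ℝ in 𝓝 (γ, x), 1 + p.1 * p.2 < Real.exp (-(2 * |γ| * N')) :=
      hz.continuousAt.eventually (gt_mem_nhds (by simp only [h]; positivity))
    filter_upwards [e1, e2, e3, e4, e5] with p h1 h2 h3 h4 h5
    by_cases hp : 0 < 1 + p.1 * p.2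
    · rw [gevLogLik₁_of_pos hp, EReal.coe_lt_coe_iff]
      refine (gumbelLogLik_le h1.le h2.le).trans_lt ?_
      have hw : N' ≤ |gumbelCoord p.1 p.2| := by
        rw [gumbelCoord, if_neg h4, abs_div, le_div_iff₀ (abs_pos.2 h4)]
        have hlog : Real.log (1 + p.1 * p.2) < -(2 * |γ| * N') := by
          rwa [Real.log_lt_iff_lt_exp hp]
        have hNp : 0 ≤ N' := le_max_right _ _
        have : N' * |p.1| ≤ 2 * |γ| * N' := by nlinarith
        have := neg_abs_le (Real.log (1 + p.1 * p.2))
        linarith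
      have hN2 : N ≤ |gumbelCoord p.1 p.2| := (le_max_left _ _).trans hw
      have : κ * N = (κ + L) ^ 2 / 2 - c + κ := by
        rw [hN]
        field_simp
      nlinarith
    · rw [gevLogLik₁_of_nonpos (not_lt.1 hp)]
      exact EReal.bot_lt_coe _
  · have : ∀ᶠ p : ℝ × ℝ in 𝓝 (γ, x),
        ((gumbelLogLik p.1 (gumbelCoord p.1 p.2) : ℝ) : EReal) = gevLogLik₁ p.1 p.2 := by
      filter_upwards [hz.continuousAt.eventually (lt_mem_nhds h)] with p hp
      exact (gevLogLik₁_of_pos hp).symm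
    refine ContinuousAt.congr ?_ this
    have hc := continuousAt_gumbelCoord h
    refine continuous_coe_real_ereal.continuousAt.comp' ?_
    unfold gumbelLogLik
    fun_prop

lemma continuousAt_gevLogLik {θ : ℝ × ℝ × ℝ} (hθ : θ ∈ gevParamSpace) (x : ℝ) :
    ContinuousAt (fun p : (ℝ × ℝ × ℝ) × ℝ => gevLogLik p.1 p.2) (θ, x) := by
  obtain ⟨h1, h2⟩ := hθ
  have hf : ContinuousAt (fun p : (ℝ × ℝ × ℝ) × ℝ => (p.1.1, (p.2 - p.1.2.1) / p.1.2.2)) (θ, x) := by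
    refine ContinuousAt.prodMk (by fun_prop) (ContinuousAt.div (by fun_prop) (by fun_prop) h2.ne')
  have hg : ContinuousAt (fun p : (ℝ × ℝ × ℝ) × ℝ =>
      gevLogLik₁ p.1.1 ((p.2 - p.1.2.1) / p.1.2.2)) (θ, x) :=
    ContinuousAt.comp (g := fun p : ℝ × ℝ => gevLogLik₁ p.1 p.2)
      (f := fun p : (ℝ × ℝ × ℝ) × ℝ => (p.1.1, (p.2 - p.1.2.1) / p.1.2.2))
      (continuousAt_gevLogLik₁ h1) hf
  have hl : ContinuousAt (fun p : (ℝ × ℝ × ℝ) × ℝ => ((-Real.log p.1.2.2 : ℝ) : EReal)) (θ, x) := by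
    refine continuous_coe_real_ereal.continuousAt.comp' ?_
    have hs : ContinuousAt (fun p : (ℝ × ℝ × ℝ) × ℝ => p.1.2.2) (θ, x) := by fun_prop
    exact (hs.log h2.ne').neg
  have hadd : ContinuousAt (fun p : (ℝ × ℝ × ℝ) × ℝ =>
      gevLogLik₁ p.1.1 ((p.2 - p.1.2.1) / p.1.2.2) + ((-Real.log p.1.2.2 : ℝ) : EReal)) (θ, x) :=
    ContinuousAt.comp (g := fun q : EReal × EReal => q.1 + q.2)
      (EReal.continuousAt_add (Or.inr (EReal.coe_ne_bot _)) (Or.inr (EReal.coe_ne_top _)))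
      (hg.prodMk hl)
  convert hadd using 2 with p
  simp [gevLogLik, sub_eq_add_neg]

lemma gevLogLik_ne_top (θ : ℝ × ℝ × ℝ) (x : ℝ) : gevLogLik θ x ≠ ⊤ := by
  by_cases hx : 0 < 1 + θ.1 * ((x - θ.2.1) / θ.2.2)
  · rw [gevLogLik_of_pos hx]
    exact EReal.coe_ne_top _
  · rw [gevLogLik_of_nonpos (not_lt.1 hx)]
    exact bot_ne_top

lemma exists_gevLogLik_le {K : Set (ℝ × ℝ × ℝ)} (hKΘ : K ⊆ gevParamSpace) (hK : IsCompact K) :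
    ∃ B : ℝ, 0 ≤ B ∧ ∀ θ ∈ K, ∀ x, gevLogLik θ x ≤ (B : EReal) := by
  have hc : ContinuousOn (fun θ : ℝ × ℝ × ℝ => (1 + θ.1) ^ 2 / 2 - Real.log θ.2.2) K := by
    refine ContinuousOn.sub (by fun_prop) (ContinuousOn.log (by fun_prop) fun θ hθ => ?_)
    exact (hKΘ hθ).2.ne'
  obtain ⟨B, hB⟩ := hK.bddAbove_image hc
  refine ⟨max B 0, le_max_right _ _, fun θ hθ x => ?_⟩
  by_cases hx : 0 < 1 + θ.1 * ((x - θ.2.1) / θ.2.2)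
  · rw [gevLogLik_of_pos hx, EReal.coe_le_coe_iff]
    have h1 := gumbelLogLik_le (γ := θ.1) (κ := 0) (L := 1 + θ.1)
      (w := gumbelCoord θ.1 ((x - θ.2.1) / θ.2.2)) (by linarith [(hKΘ hθ).1]) le_rfl
    have h2 : (1 + θ.1) ^ 2 / 2 - Real.log θ.2.2 ≤ B := hB ⟨θ, hθ, rfl⟩
    have h3 := le_max_left B 0
    simp only [zero_add, neg_zero, zero_mul] at h1
    linarith
  · rw [gevLogLik_of_nonpos (not_lt.1 hx)]
    exact bot_le

lemma ereal_sum_ne_top {ι : Type*} (s : Finset ι) (f : ι → EReal) (h : ∀ i ∈ s, f i ≠ ⊤) :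
    ∑ i ∈ s, f i ≠ ⊤ := by
  classical
  induction s using Finset.induction_on with
  | empty => simp
  | insert i s hi ih =>
    rw [Finset.sum_insert hi]
    exact EReal.add_ne_top (h i (by simp)) (ih fun j hj => h j (by simp [hj]))

lemma continuousOn_sum_gevLogLik {K : Set (ℝ × ℝ × ℝ)} (hKΘ : K ⊆ gevParamSpace)
    (y : ℕ → ℝ) (n : ℕ) :
    ContinuousOn (fun θ => ∑ k ∈ Finset.range n, gevLogLik θ (y k)) K := by
  induction n with
  | zero => simpa using continuousOn_const
  | succ n ih =>
    simp only [Finset.sum_range_succ]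
    intro θ hθ
    have h1 : ContinuousWithinAt (fun θ => gevLogLik θ (y n)) K θ :=
      (ContinuousAt.comp (g := fun p : (ℝ × ℝ × ℝ) × ℝ => gevLogLik p.1 p.2)
        (f := fun θ : ℝ × ℝ × ℝ => (θ, y n)) (continuousAt_gevLogLik (hKΘ hθ) (y n))
        (by fun_prop)).continuousWithinAt
    exact ContinuousAt.comp_continuousWithinAt (g := fun q : EReal × EReal => q.1 + q.2)
      (f := fun θ => (∑ k ∈ Finset.range n, gevLogLik θ (y k), gevLogLik θ (y n)))
      (EReal.continuousAt_add
        (Or.inl (ereal_sum_ne_top (Finset.range n) (fun k => gevLogLik θ (y k))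
          fun k _ => gevLogLik_ne_top θ (y k)))
        (Or.inr (gevLogLik_ne_top _ _))) ((ih θ hθ).prodMk h1)

lemma exists_isMaxOn_normLogLik {Ω : Type*} (X : ℕ → Ω → ℝ) (a b : ℕ → ℝ)
    {K : Set (ℝ × ℝ × ℝ)} (hKΘ : K ⊆ gevParamSpace) (hK : IsCompact K) (hne : K.Nonempty)
    (m n : ℕ) (ω : Ω) : ∃ θ ∈ K, IsMaxOn (normLogLik X a b m n ω) K θ := by
  refine hK.exists_isMaxOn hne ?_
  unfold normLogLik
  -- Multiplication on `EReal` is discontinuous at `(0, ⊥)`, so `n = 0`, where the factor `n⁻¹` is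
  -- `0`, is treated apart.
  rcases Nat.eq_zero_or_pos n with rfl | hn
  · simpa using continuousOn_const
  have hc : (((n : ℝ)⁻¹ : ℝ) : EReal) ≠ 0 := by
    have : (n : ℝ)⁻¹ ≠ 0 := by positivity
    exact_mod_cast this
  intro θ hθ
  exact ContinuousAt.comp_continuousWithinAt (g := fun q : EReal × EReal => q.1 * q.2)
    (f := fun θ => ((((n : ℝ)⁻¹ : ℝ) : EReal),
      ∑ k ∈ Finset.range n, gevLogLik θ (normBlockMax X a b m k ω)))
    (EReal.continuousAt_mul (Or.inl hc) (Or.inl hc) (Or.inl (EReal.coe_ne_bot _))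
      (Or.inl (EReal.coe_ne_top _)))
    (continuousWithinAt_const.prodMk
      (continuousOn_sum_gevLogLik hKΘ (fun k => normBlockMax X a b m k ω) n θ hθ))

/-! ### The tail quantile function and its extended regular variation. -/

/-- The properties that characterize a distribution function, up to right continuity. -/
structure IsDistributionFunction (F : ℝ → ℝ) : Prop where
  mono : Monotone F
  tendsto_atBot : Tendsto F atBot (𝓝 0)
  tendsto_atTop : Tendsto F atTop (𝓝 1)

lemma IsDistributionFunction.nonneg {F : ℝ → ℝ} (hF : IsDistributionFunction F) (x : ℝ) :
    0 ≤ F x := hF.mono.le_of_tendsto hF.tendsto_atBot x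

lemma IsDistributionFunction.le_one {F : ℝ → ℝ} (hF : IsDistributionFunction F) (x : ℝ) :
    F x ≤ 1 := hF.mono.ge_of_tendsto hF.tendsto_atTop x

lemma bddBelow_tailQuantile_set {F : ℝ → ℝ} (hF : IsDistributionFunction F) {t : ℝ} (ht : 1 < t) :
    BddBelow {x : ℝ | t * (1 - F x) ≤ 1} := by
  have h1 : Tendsto (fun x => t * (1 - F x)) atBot (𝓝 (t * (1 - 0))) :=
    (tendsto_const_nhds.sub hF.tendsto_atBot).const_mul t
  obtain ⟨y, hy⟩ := eventually_atBot.1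
    (h1.eventually (lt_mem_nhds (show (1 : ℝ) < t * (1 - 0) by linarith)))
  refine ⟨y, fun x hx => ?_⟩
  by_contra! hxy
  have := hy x hxy.le
  have hx' : t * (1 - F x) ≤ 1 := hx
  linarith

lemma tailQuantile_set_nonempty {F : ℝ → ℝ} (hF : IsDistributionFunction F) (t : ℝ) :
    {x : ℝ | t * (1 - F x) ≤ 1}.Nonempty := by
  have h1 : Tendsto (fun x => t * (1 - F x)) atTop (𝓝 (t * (1 - 1))) :=
    (tendsto_const_nhds.sub hF.tendsto_atTop).const_mul t
  obtain ⟨y, hy⟩ := (h1.eventually (gt_mem_nhds (show t * (1 - 1) < (1 : ℝ) by simp))).exists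
  exact ⟨y, hy.le⟩

lemma tailQuantile_le {F : ℝ → ℝ} (hF : IsDistributionFunction F) {t x : ℝ} (ht : 1 < t)
    (hx : t * (1 - F x) ≤ 1) : tailQuantile F t ≤ x :=
  csInf_le (bddBelow_tailQuantile_set hF ht) hx

lemma le_tailQuantile {F : ℝ → ℝ} (hF : IsDistributionFunction F) {t x : ℝ} (ht : 0 < t)
    (hx : 1 < t * (1 - F x)) : x ≤ tailQuantile F t := by
  refine le_csInf (tailQuantile_set_nonempty hF t) fun y hy => ?_
  by_contra! hxy
  have h1 : t * (1 - F y) ≤ 1 := hy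
  have h2 := mul_le_mul_of_nonneg_left (hF.mono hxy.le) ht.le
  linarith

lemma exists_lt_of_tailQuantile_lt {F : ℝ → ℝ} (hF : IsDistributionFunction F) {t x : ℝ}
    (hx : tailQuantile F t < x) : ∃ y < x, t * (1 - F y) ≤ 1 := by
  obtain ⟨y, hy, hyx⟩ := exists_lt_of_csInf_lt (tailQuantile_set_nonempty hF t) hx
  exact ⟨y, hyx, hy⟩

lemma monotoneOn_tailQuantile {F : ℝ → ℝ} (hF : IsDistributionFunction F) :
    MonotoneOn (tailQuantile F) (Set.Ioi 1) := by
  intro s hs t _ hst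
  refine csInf_le_csInf (bddBelow_tailQuantile_set hF hs) (tailQuantile_set_nonempty hF t) ?_
  intro x hx
  have h1 : t * (1 - F x) ≤ 1 := hx
  have h2 := mul_le_mul_of_nonneg_right hst (sub_nonneg.2 (hF.le_one x))
  exact h2.trans h1

/-- Otherwise `1 - F > 1 / (t e^w)` at the point `a x + b`, so `F ≤ exp (-1 / (t e^w))` there, and
the power `⌊t⌋` is asymptotically at most `exp (-e^(-w))`, strictly below its limit `F_γ(x)`. -/
lemma eventually_tailQuantile_le {F : ℝ → ℝ} (hF : IsDistributionFunction F) {γ : ℝ} {a b : ℕ → ℝ}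
    (hab : IsNorming F γ a b) {w x : ℝ} (hx : gevQuantile γ w < x) :
    ∀ᶠ t : ℝ in atTop, tailQuantile F (t * Real.exp w) ≤ a ⌊t⌋₊ * x + b ⌊t⌋₊ := by
  have hG : Real.exp (-Real.exp (-w)) < gevCDF γ x := by
    obtain ⟨y, hy, hyx⟩ := exists_between hx
    have h1 : Real.exp (-Real.exp (-w)) ≤ gevCDF γ y := by
      rw [← gevCDF_gevQuantile γ w]
      exact monotone_gevCDF γ hy.le
    refine lt_of_le_of_ne (h1.trans (monotone_gevCDF γ hyx.le)) fun h => ?_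
    have := eq_gevQuantile_of_gevCDF_eq h.symm
    linarith
  obtain ⟨c, hc1, hc2⟩ := exists_between hG
  have e1 := ((hab.2 x).comp (tendsto_nat_floor_atTop (α := ℝ))).eventually (lt_mem_nhds hc2)
  have h2 : Tendsto (fun t : ℝ => Real.exp (-(⌊t⌋₊ / t * Real.exp (-w)))) atTop
      (𝓝 (Real.exp (-(1 * Real.exp (-w))))) :=
    (Real.continuous_exp.tendsto _).comp (tendsto_nat_floor_div_atTop.mul_const _).neg
  rw [one_mul] at h2
  have e2 := h2.eventually (gt_mem_nhds hc1)
  have hs := Real.exp_pos w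
  filter_upwards [e1, e2, eventually_gt_atTop 0, eventually_gt_atTop (Real.exp w)⁻¹]
    with t h1 h2 h3 h4
  have h5 : 1 < t * Real.exp w := by
    rwa [inv_lt_iff_one_lt_mul₀ hs] at h4
  refine tailQuantile_le hF h5 ?_
  by_contra! h6
  simp only [Function.comp] at h1
  set y := F (a ⌊t⌋₊ * x + b ⌊t⌋₊) with hy
  have hy0 : 0 ≤ y := hF.nonneg _
  have h7 : y ≤ Real.exp (-(t * Real.exp w)⁻¹) := by
    have h8 := Real.add_one_le_exp (-(t * Real.exp w)⁻¹)
    have h9 : (t * Real.exp w)⁻¹ < 1 - y := by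
      rw [inv_lt_iff_one_lt_mul₀ (by positivity)]
      linarith
    linarith
  have h8 : y ^ ⌊t⌋₊ ≤ Real.exp (-(⌊t⌋₊ / t * Real.exp (-w))) := by
    refine (pow_le_pow_left₀ hy0 h7 _).trans (le_of_eq ?_)
    rw [← Real.exp_nat_mul, Real.exp_neg w]
    congr 1
    field_simp
  linarith

/-- The mirror argument, with the reverse estimate `1 - 1/q ≥ exp (-1 / (q - 1))` for `q = t e^w`.
-/
lemma eventually_le_tailQuantile {F : ℝ → ℝ} (hF : IsDistributionFunction F) {γ : ℝ} {a b : ℕ → ℝ}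
    (hab : IsNorming F γ a b) {w x : ℝ} (hx : x < gevQuantile γ w) :
    ∀ᶠ t : ℝ in atTop, a ⌊t⌋₊ * x + b ⌊t⌋₊ ≤ tailQuantile F (t * Real.exp w) := by
  have hG : gevCDF γ x < Real.exp (-Real.exp (-w)) := by
    refine lt_of_le_of_ne ?_ fun h => ?_
    · rw [← gevCDF_gevQuantile γ w]
      exact monotone_gevCDF γ hx.le
    · have := eq_gevQuantile_of_gevCDF_eq h
      linarith
  obtain ⟨c, hc1, hc2⟩ := exists_between hG
  have e1 := ((hab.2 x).comp (tendsto_nat_floor_atTop (α := ℝ))).eventually (gt_mem_nhds hc1)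
  have hs := Real.exp_pos w
  have h2 : Tendsto (fun t : ℝ => Real.exp (-(⌊t⌋₊ / t * (Real.exp w - t⁻¹)⁻¹))) atTop
      (𝓝 (Real.exp (-(1 * (Real.exp w - 0)⁻¹)))) := by
    refine (Real.continuous_exp.tendsto _).comp (tendsto_nat_floor_div_atTop.mul ?_).neg
    exact (tendsto_const_nhds.sub tendsto_inv_atTop_zero).inv₀ (by simp)
  rw [one_mul, sub_zero, ← Real.exp_neg] at h2
  have e2 := h2.eventually (lt_mem_nhds hc2)
  filter_upwards [e1, e2, eventually_gt_atTop 0, eventually_gt_atTop (Real.exp w)⁻¹]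
    with t h1 h2 h3 h4
  have h5 : 1 < t * Real.exp w := by
    rwa [inv_lt_iff_one_lt_mul₀ hs] at h4
  refine le_tailQuantile hF (by linarith) ?_
  by_contra! h6
  simp only [Function.comp] at h1
  set y := F (a ⌊t⌋₊ * x + b ⌊t⌋₊) with hy
  set q := t * Real.exp w with hq
  have h7 : Real.exp (-(q - 1)⁻¹) ≤ y := by
    have h8 := Real.add_one_le_exp ((q - 1)⁻¹)
    have h9 : 1 - q⁻¹ ≤ y := by
      have : 1 - y ≤ q⁻¹ := by
        rw [← one_div, le_div_iff₀ (by linarith)]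
        linarith
      linarith
    refine le_trans ?_ h9
    rw [Real.exp_neg]
    have h10 : (q - 1)⁻¹ + 1 = (1 - q⁻¹)⁻¹ := by
      have : q - 1 ≠ 0 := by linarith
      have : q ≠ 0 := by linarith
      field_simp
      ring
    rw [h10] at h8
    have h11 : 0 < 1 - q⁻¹ := by
      have := inv_lt_one_of_one_lt₀ h5
      linarith
    rwa [inv_le_comm₀ (by positivity) h11]
  have h8 : Real.exp (-(⌊t⌋₊ / t * (Real.exp w - t⁻¹)⁻¹)) ≤ y ^ ⌊t⌋₊ := by
    refine le_trans (le_of_eq ?_) (pow_le_pow_left₀ (Real.exp_pos _).le h7 _)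
    rw [← Real.exp_nat_mul]
    congr 1
    have : q - 1 ≠ 0 := by linarith
    have h12 : Real.exp w - t⁻¹ = (q - 1) / t := by
      rw [hq]
      field_simp
    rw [h12]
    field_simp
  linarith

/-- Extended regular variation of the tail quantile function. -/
theorem tendsto_tailQuantile {F : ℝ → ℝ} (hF : IsDistributionFunction F) {γ : ℝ} {a b : ℕ → ℝ}
    (hab : IsNorming F γ a b) (w : ℝ) :
    Tendsto (fun t : ℝ => (tailQuantile F (t * Real.exp w) - b ⌊t⌋₊) / a ⌊t⌋₊) atTop
      (𝓝 (gevQuantile γ w)) := by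
  have ha := tendsto_nat_floor_atTop (α := ℝ) |>.eventually hab.1
  refine tendsto_order.2 ⟨fun c hc => ?_, fun c hc => ?_⟩
  · obtain ⟨x, hx1, hx2⟩ := exists_between hc
    filter_upwards [ha, eventually_le_tailQuantile hF hab hx2] with t h1 h2
    rw [lt_div_iff₀ h1]
    nlinarith
  · obtain ⟨x, hx1, hx2⟩ := exists_between hc
    filter_upwards [ha, eventually_tailQuantile_le hF hab hx1] with t h1 h2
    rw [div_lt_iff₀ h1]
    nlinarith

theorem tendsto_tailQuantile_sub {F : ℝ → ℝ} (hF : IsDistributionFunction F) {γ : ℝ}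
    {a b : ℕ → ℝ} (hab : IsNorming F γ a b) (w v : ℝ) :
    Tendsto (fun t : ℝ => (tailQuantile F (t * Real.exp w) - tailQuantile F (t * Real.exp v))
      / a ⌊t⌋₊) atTop (𝓝 (gevQuantile γ w - gevQuantile γ v)) := by
  refine ((tendsto_tailQuantile hF hab w).sub (tendsto_tailQuantile hF hab v)).congr fun t => ?_
  rw [← sub_div]
  congr 1
  ring

/-- The increment of `U` from `t e^v` to `t e^(2v)` is normalized once by `a(t)` and once by `a(t
e^v)`; the quotient of the two limits is `e^(γ v)`. They are nonzero because `v ≠ 0`. -/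
theorem tendsto_norming_ratio {F : ℝ → ℝ} (hF : IsDistributionFunction F) {γ : ℝ}
    {a b : ℕ → ℝ} (hab : IsNorming F γ a b) {v : ℝ} (hv : v ≠ 0) :
    Tendsto (fun t : ℝ => a ⌊t * Real.exp v⌋₊ / a ⌊t⌋₊) atTop (𝓝 (Real.exp (γ * v))) := by
  have h1 := tendsto_tailQuantile_sub hF hab (v + v) v
  have hlim : Tendsto (fun t : ℝ => t * Real.exp v) atTop atTop :=
    tendsto_id.atTop_mul_const (Real.exp_pos v)
  have h2 := (tendsto_tailQuantile_sub hF hab v 0).comp hlim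
  have hQ : gevQuantile γ v ≠ 0 := by
    rw [← gevQuantile_zero γ]
    exact (strictMono_gevQuantile γ).injective.ne hv
  have hQ2 : gevQuantile γ (v + v) - gevQuantile γ v
      = Real.exp (γ * v) * gevQuantile γ v := by
    unfold gevQuantile
    split_ifs with h
    · simp [h]
    · rw [mul_add, Real.exp_add]
      field_simp
      ring
  rw [hQ2] at h1
  rw [gevQuantile_zero, sub_zero] at h2
  have h3 := h1.div h2 hQ
  rw [mul_div_cancel_right₀ _ hQ] at h3
  refine h3.congr' ?_
  filter_upwards [h2.eventually_ne hQ] with t ht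
  simp only [Function.comp] at ht ⊢
  rw [Real.exp_zero, mul_one, mul_assoc, ← Real.exp_add] at *
  have hne := div_ne_zero_iff.1 ht
  simp only [Pi.div_apply, Function.comp]
  rw [mul_one, mul_assoc, ← Real.exp_add]
  have h4 := hne.1
  have h5 := hne.2
  rw [div_div_div_eq, mul_comm (a ⌊t⌋₊), mul_div_mul_left _ _ h4]

/-! ### Potter bounds for increments of the tail quantile function. -/

/-- Induction on the number of halvings that lead from `t` down to `s`. One halving costs `D A(t)`
and multiplies the scale by `κ`; `D ≤ C (2^ρ - κ)` is what lets the factor `2^ρ` gained by `(t /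
s)^ρ` absorb both. -/
lemma sub_le_rpow_mul_of_halving {U A : ℝ → ℝ} {t₀ D κ C ρ : ℝ} (ht₀ : 2 < t₀)
    (hU : MonotoneOn U (Set.Ioi 1)) (hA : ∀ t ≥ t₀, 0 ≤ A t)
    (h1 : ∀ t ≥ t₀, U t - U (t / 2) ≤ D * A t) (h2 : ∀ t ≥ t₀, A (t / 2) ≤ κ * A t)
    (hC : 0 ≤ C) (hρ : 0 ≤ ρ) (hDC : D ≤ C) (hDκ : D ≤ C * (2 ^ ρ - κ)) (hκ : κ ≤ 2 ^ ρ)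
    {s t : ℝ} (hs : t₀ ≤ s) (hst : s ≤ t) : U t - U s ≤ C * (t / s) ^ ρ * A t := by
  have key : ∀ j : ℕ, ∀ t, s ≤ t → t ≤ 2 ^ j * (2 * s) → U t - U s ≤ C * (t / s) ^ ρ * A t := by
    have hs0 : 0 < s := by linarith
    have base : ∀ t, s ≤ t → t ≤ 2 * s → U t - U s ≤ C * (t / s) ^ ρ * A t := by
      intro t hst hts
      have ht : t₀ ≤ t := hs.trans hst
      have h3 : U (t / 2) ≤ U s := hU (show (1 : ℝ) < t / 2 by linarith)
        (show (1 : ℝ) < s by linarith) (by linarith)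
      have h4 : 1 ≤ (t / s) ^ ρ := Real.one_le_rpow ((one_le_div hs0).2 hst) hρ
      have h5 : D * A t ≤ C * (t / s) ^ ρ * A t :=
        mul_le_mul_of_nonneg_right (by nlinarith) (hA t ht)
      linarith [h1 t ht]
    intro j
    induction j with
    | zero => simpa using base
    | succ j ih =>
      intro t hst hts
      rcases le_total t (2 * s) with h | h
      · exact base t hst h
      · have ht : t₀ ≤ t := hs.trans hst
        have h3 := ih (t / 2) (by linarith) (by rw [pow_succ] at hts; linarith)
        have h4 : 1 ≤ (t / 2 / s) ^ ρ :=
          Real.one_le_rpow ((one_le_div hs0).2 (by linarith)) hρ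
        have h5 : (t / s) ^ ρ = 2 ^ ρ * (t / 2 / s) ^ ρ := by
          have ht0 : 0 < t := by linarith
          rw [← Real.mul_rpow (by norm_num) (by positivity)]
          congr 1
          field_simp
        set x := (t / 2 / s) ^ ρ
        have h6 : C * x * A (t / 2) ≤ C * x * (κ * A t) :=
          mul_le_mul_of_nonneg_left (h2 t ht) (by positivity)
        have h7 : (D + C * x * κ) * A t ≤ C * (2 ^ ρ * x) * A t := by
          refine mul_le_mul_of_nonneg_right ?_ (hA t ht)
          have : C * (2 ^ ρ - κ) * 1 ≤ C * (2 ^ ρ - κ) * x :=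
            mul_le_mul_of_nonneg_left h4 (mul_nonneg hC (sub_nonneg.2 hκ))
          linarith
        rw [h5]
        linarith [h1 t ht]
  obtain ⟨j, hj⟩ := pow_unbounded_of_one_lt (t / (2 * s)) (by norm_num : (1 : ℝ) < 2)
  rw [div_lt_iff₀ (by linarith)] at hj
  exact key j t hst hj.le

lemma sub_le_rpow_mul_of_doubling {U A : ℝ → ℝ} {t₀ D κ C ρ : ℝ} (ht₀ : 1 < t₀)
    (hU : MonotoneOn U (Set.Ioi 1)) (hA : ∀ t ≥ t₀, 0 ≤ A t)
    (h1 : ∀ t ≥ t₀, U (t * 2) - U t ≤ D * A t) (h2 : ∀ t ≥ t₀, A (t * 2) ≤ κ * A t)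
    (hC : 0 ≤ C) (hρ : 0 ≤ ρ) (hDC : D ≤ C) (hDκ : D ≤ C * (2 ^ ρ - κ)) (hκ : κ ≤ 2 ^ ρ)
    {s t : ℝ} (ht : t₀ ≤ t) (hst : t ≤ s) : U s - U t ≤ C * (s / t) ^ ρ * A t := by
  have base : ∀ t, t₀ ≤ t → t ≤ s → s ≤ t * 2 → U s - U t ≤ C * (s / t) ^ ρ * A t := by
    intro t ht hts hst
    have ht0 : 0 < t := by linarith
    have h3 : U s ≤ U (t * 2) := hU (show (1 : ℝ) < s by linarith)
      (show (1 : ℝ) < t * 2 by linarith) hst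
    have h4 : 1 ≤ (s / t) ^ ρ := Real.one_le_rpow ((one_le_div ht0).2 hts) hρ
    have h5 : D * A t ≤ C * (s / t) ^ ρ * A t :=
      mul_le_mul_of_nonneg_right (by nlinarith) (hA t ht)
    linarith [h1 t ht]
  have key : ∀ j : ℕ, ∀ t, t₀ ≤ t → t ≤ s → s ≤ 2 ^ j * (t * 2) →
      U s - U t ≤ C * (s / t) ^ ρ * A t := by
    intro j
    induction j with
    | zero => simpa using base
    | succ j ih =>
      intro t ht hts hst
      have ht0 : 0 < t := by linarith
      rcases le_total s (t * 2) with h | h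
      · exact base t ht hts h
      · have h3 := ih (t * 2) (by linarith) h (by rw [pow_succ] at hst; linarith)
        have h4 : 1 ≤ (s / (t * 2)) ^ ρ :=
          Real.one_le_rpow ((one_le_div (by linarith)).2 h) hρ
        have hs0 : 0 < s := by linarith
        have h5 : (s / t) ^ ρ = 2 ^ ρ * (s / (t * 2)) ^ ρ := by
          rw [← Real.mul_rpow (by norm_num) (by positivity)]
          congr 1
          field_simp
        set x := (s / (t * 2)) ^ ρ
        have h6 : C * x * A (t * 2) ≤ C * x * (κ * A t) :=
          mul_le_mul_of_nonneg_left (h2 t ht) (by positivity)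
        have h7 : (D + C * x * κ) * A t ≤ C * (2 ^ ρ * x) * A t := by
          refine mul_le_mul_of_nonneg_right ?_ (hA t ht)
          have : C * (2 ^ ρ - κ) * 1 ≤ C * (2 ^ ρ - κ) * x :=
            mul_le_mul_of_nonneg_left h4 (mul_nonneg hC (sub_nonneg.2 hκ))
          linarith
        rw [h5]
        linarith [h1 t ht]
  obtain ⟨j, hj⟩ := pow_unbounded_of_one_lt (s / (t * 2)) (by norm_num : (1 : ℝ) < 2)
  rw [div_lt_iff₀ (by linarith)] at hj
  exact key j t ht hst hj.le

/-- Room for the constants in the two lemmas above, given the limits `d` and `q` of `D` and `κ`. -/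
lemma exists_potter_constants {d q C R : ℝ} (hC : 0 < C) (h1 : d < C) (h2 : d + C * q < C * R)
    (hd : 0 ≤ d) :
    ∃ D κ, d < D ∧ q < κ ∧ D ≤ C ∧ D ≤ C * (R - κ) ∧ κ ≤ R := by
  have h3 : q < R - d / C := by
    rw [lt_sub_iff_add_lt, ← sub_pos]
    have : R - (q + d / C) = (C * R - (d + C * q)) / C := by
      field_simp
      ring
    rw [this]
    exact div_pos (by linarith) hC
  obtain ⟨κ, hκ1, hκ2⟩ := exists_between h3
  have h4 : d < C * (R - κ) := by
    have : d = C * (d / C) := by field_simp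
    rw [this]
    exact mul_lt_mul_of_pos_left (by linarith) hC
  obtain ⟨D, hD1, hD2⟩ := exists_between (lt_min h1 h4)
  refine ⟨D, κ, hD1, hκ1, (hD2.trans_le (min_le_left _ _)).le,
    (hD2.trans_le (min_le_right _ _)).le, ?_⟩
  have : 0 ≤ d / C := by positivity
  linarith

lemma mul_exp_log_two (t : ℝ) : t * Real.exp (Real.log 2) = t * 2 := by
  rw [Real.exp_log (by norm_num)]

lemma mul_exp_neg_log_two (t : ℝ) : t * Real.exp (-Real.log 2) = t / 2 := by
  rw [Real.exp_neg, Real.exp_log (by norm_num)]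
  ring

/-- The limits of `(U(t) - U(t/2)) / a(t)` and `a(t/2) / a(t)` supply the constants. The conditions
on `C` and `ρ` are kept explicit so that `ρ = 0` with a sharp `C` remains available. -/
lemma potter_left {F : ℝ → ℝ} (hF : IsDistributionFunction F) {γ : ℝ} {a b : ℕ → ℝ}
    (hab : IsNorming F γ a b) {C ρ : ℝ} (hC : 0 < C) (hρ : 0 ≤ ρ)
    (h1 : -gevQuantile γ (-Real.log 2) < C)
    (h2 : -gevQuantile γ (-Real.log 2) + C * Real.exp (γ * -Real.log 2) < C * 2 ^ ρ) :
    ∃ t₀ > 2, ∀ s ≥ t₀, ∀ t ≥ s,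
      tailQuantile F t - tailQuantile F s ≤ C * (t / s) ^ ρ * a ⌊t⌋₊ := by
  have hl : -Real.log 2 < 0 := by
    have := Real.log_pos (by norm_num : (1 : ℝ) < 2)
    linarith
  have hd : 0 ≤ -gevQuantile γ (-Real.log 2) := by
    have := (strictMono_gevQuantile γ) hl
    rw [gevQuantile_zero] at this
    linarith
  obtain ⟨D, κ, hD, hκ, e1, e2, e3⟩ := exists_potter_constants hC h1 h2 hd
  have l1 := tendsto_tailQuantile_sub hF hab 0 (-Real.log 2)
  have l2 := tendsto_norming_ratio hF hab hl.ne
  rw [gevQuantile_zero, zero_sub] at l1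
  obtain ⟨t₁, ht₁⟩ := eventually_atTop.1 ((l1.eventually (gt_mem_nhds hD)).and
    ((l2.eventually (gt_mem_nhds hκ)).and (tendsto_nat_floor_atTop (α := ℝ) |>.eventually hab.1)))
  refine ⟨max t₁ 3, lt_max_of_lt_right (by norm_num), fun s hs t hst => ?_⟩
  refine sub_le_rpow_mul_of_halving (U := tailQuantile F) (A := fun t => a ⌊t⌋₊)
    (t₀ := max t₁ 3) (D := D) (κ := κ)
    (lt_max_of_lt_right (by norm_num)) (monotoneOn_tailQuantile hF)
    (fun t ht => (ht₁ t ((le_max_left _ _).trans ht)).2.2.le) ?_ ?_ hC.le hρ e1 e2 e3 hs hst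
  · intro t ht
    obtain ⟨h3, -, h5⟩ := ht₁ t ((le_max_left _ _).trans ht)
    rw [div_lt_iff₀ h5, mul_exp_neg_log_two, Real.exp_zero, mul_one] at h3
    exact h3.le
  · intro t ht
    obtain ⟨-, h4, h5⟩ := ht₁ t ((le_max_left _ _).trans ht)
    rw [div_lt_iff₀ h5, mul_exp_neg_log_two] at h4
    exact h4.le

lemma potter_right {F : ℝ → ℝ} (hF : IsDistributionFunction F) {γ : ℝ} {a b : ℕ → ℝ}
    (hab : IsNorming F γ a b) {C ρ : ℝ} (hC : 0 < C) (hρ : 0 ≤ ρ)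
    (h1 : gevQuantile γ (Real.log 2) < C)
    (h2 : gevQuantile γ (Real.log 2) + C * Real.exp (γ * Real.log 2) < C * 2 ^ ρ) :
    ∃ t₀ > 2, ∀ t ≥ t₀, ∀ s ≥ t,
      tailQuantile F s - tailQuantile F t ≤ C * (s / t) ^ ρ * a ⌊t⌋₊ := by
  have hl : 0 < Real.log 2 := Real.log_pos (by norm_num)
  have hd : 0 ≤ gevQuantile γ (Real.log 2) := by
    have := (strictMono_gevQuantile γ) hl
    rw [gevQuantile_zero] at this
    linarith
  obtain ⟨D, κ, hD, hκ, e1, e2, e3⟩ := exists_potter_constants hC h1 h2 hd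
  have l1 := tendsto_tailQuantile_sub hF hab (Real.log 2) 0
  have l2 := tendsto_norming_ratio hF hab hl.ne'
  rw [gevQuantile_zero, sub_zero] at l1
  obtain ⟨t₁, ht₁⟩ := eventually_atTop.1 ((l1.eventually (gt_mem_nhds hD)).and
    ((l2.eventually (gt_mem_nhds hκ)).and (tendsto_nat_floor_atTop (α := ℝ) |>.eventually hab.1)))
  refine ⟨max t₁ 3, lt_max_of_lt_right (by norm_num), fun t ht s hst => ?_⟩
  refine sub_le_rpow_mul_of_doubling (U := tailQuantile F) (A := fun t => a ⌊t⌋₊)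
    (t₀ := max t₁ 3) (D := D) (κ := κ)
    (lt_max_of_lt_right (by norm_num)) (monotoneOn_tailQuantile hF)
    (fun t ht => (ht₁ t ((le_max_left _ _).trans ht)).2.2.le) ?_ ?_ hC.le hρ e1 e2 e3 ht hst
  · intro t ht
    obtain ⟨h3, -, h5⟩ := ht₁ t ((le_max_left _ _).trans ht)
    rw [div_lt_iff₀ h5, mul_exp_log_two, Real.exp_zero, mul_one] at h3
    exact h3.le
  · intro t ht
    obtain ⟨-, h4, h5⟩ := ht₁ t ((le_max_left _ _).trans ht)
    rw [div_lt_iff₀ h5, mul_exp_log_two] at h4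
    exact h4.le

lemma exists_constant_of_exp_lt {d q R : ℝ} (hd : 0 ≤ d) (h : q < R) :
    ∃ C > 0, d < C ∧ d + C * q < C * R := by
  refine ⟨d + 1 + d / (R - q), by have := sub_pos.2 h; positivity, ?_, ?_⟩
  · have : 0 ≤ d / (R - q) := div_nonneg hd (by linarith)
    linarith
  · have h1 : 0 < R - q := by linarith
    have h2 : (d + 1 + d / (R - q)) * (R - q) = (d + 1) * (R - q) + d := by
      field_simp
    nlinarith [mul_pos (show (0 : ℝ) < d + 1 by linarith) h1]

/-- For `ρ > -γ` the ratio `2^(-γ)` is below `2^ρ`, so every large `C` is admissible. -/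
theorem exists_potter_left {F : ℝ → ℝ} (hF : IsDistributionFunction F) {γ : ℝ} {a b : ℕ → ℝ}
    (hab : IsNorming F γ a b) {ρ : ℝ} (hρ : 0 ≤ ρ) (hγ : -γ < ρ) :
    ∃ C > 0, ∃ t₀ > 2, ∀ s ≥ t₀, ∀ t ≥ s,
      tailQuantile F t - tailQuantile F s ≤ C * (t / s) ^ ρ * a ⌊t⌋₊ := by
  have hl : 0 < Real.log 2 := Real.log_pos (by norm_num)
  have h1 : Real.exp (γ * -Real.log 2) < 2 ^ ρ := by
    rw [Real.rpow_def_of_pos (by norm_num)]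
    exact Real.exp_lt_exp.2 (by nlinarith)
  have hd : 0 ≤ -gevQuantile γ (-Real.log 2) := by
    have := (strictMono_gevQuantile γ) (neg_neg_of_pos hl)
    rw [gevQuantile_zero] at this
    linarith
  obtain ⟨C, hC, h2, h3⟩ := exists_constant_of_exp_lt hd h1
  exact ⟨C, hC, potter_left hF hab hC hρ h2 h3⟩

theorem exists_potter_right {F : ℝ → ℝ} (hF : IsDistributionFunction F) {γ : ℝ} {a b : ℕ → ℝ}
    (hab : IsNorming F γ a b) {ρ : ℝ} (hρ : 0 ≤ ρ) (hγ : γ < ρ) :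
    ∃ C > 0, ∃ t₀ > 2, ∀ t ≥ t₀, ∀ s ≥ t,
      tailQuantile F s - tailQuantile F t ≤ C * (s / t) ^ ρ * a ⌊t⌋₊ := by
  have hl : 0 < Real.log 2 := Real.log_pos (by norm_num)
  have h1 : Real.exp (γ * Real.log 2) < 2 ^ ρ := by
    rw [Real.rpow_def_of_pos (by norm_num)]
    exact Real.exp_lt_exp.2 (by nlinarith)
  have hd : 0 ≤ gevQuantile γ (Real.log 2) := by
    have := (strictMono_gevQuantile γ) hl
    rw [gevQuantile_zero] at this
    linarith
  obtain ⟨C, hC, h2, h3⟩ := exists_constant_of_exp_lt hd h1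
  exact ⟨C, hC, potter_right hF hab hC hρ h2 h3⟩

/-- With `ρ = 0` the admissible constants are those above the geometric sum `d / (1 - q)`, where `q
= 2^(-γ)` and `d = (1 - q) / γ`: exactly `C > 1 / γ`. This sharpness fixes the endpoint of the
limiting support. -/
theorem tailQuantile_sub_le_of_pos {F : ℝ → ℝ} (hF : IsDistributionFunction F) {γ : ℝ}
    {a b : ℕ → ℝ} (hab : IsNorming F γ a b) (hγ : 0 < γ) {C : ℝ} (hC : 1 / γ < C) :
    ∃ t₀ > 2, ∀ s ≥ t₀, ∀ t ≥ s, tailQuantile F t - tailQuantile F s ≤ C * a ⌊t⌋₊ := by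
  have hl : 0 < Real.log 2 := Real.log_pos (by norm_num)
  have hq : Real.exp (γ * -Real.log 2) < 1 := Real.exp_lt_one_iff.2 (by nlinarith)
  have hq0 := Real.exp_pos (γ * -Real.log 2)
  have hg : 0 < 1 / γ := by positivity
  have hQ : -gevQuantile γ (-Real.log 2) = 1 / γ * (1 - Real.exp (γ * -Real.log 2)) := by
    rw [gevQuantile, if_neg hγ.ne']
    ring
  have h1 : -gevQuantile γ (-Real.log 2) < C := by
    rw [hQ]
    nlinarith
  have h2 : -gevQuantile γ (-Real.log 2) + C * Real.exp (γ * -Real.log 2) < C * 2 ^ (0 : ℝ) := by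
    rw [hQ, Real.rpow_zero]
    nlinarith
  simpa using potter_left hF hab (hg.trans hC) le_rfl h1 h2

theorem tailQuantile_sub_le_of_neg {F : ℝ → ℝ} (hF : IsDistributionFunction F) {γ : ℝ}
    {a b : ℕ → ℝ} (hab : IsNorming F γ a b) (hγ : γ < 0) {C : ℝ} (hC : 1 / (-γ) < C) :
    ∃ t₀ > 2, ∀ t ≥ t₀, ∀ s ≥ t, tailQuantile F s - tailQuantile F t ≤ C * a ⌊t⌋₊ := by
  have hl : 0 < Real.log 2 := Real.log_pos (by norm_num)
  have hq : Real.exp (γ * Real.log 2) < 1 := Real.exp_lt_one_iff.2 (by nlinarith)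
  have hq0 := Real.exp_pos (γ * Real.log 2)
  have hg : 0 < 1 / (-γ) := one_div_pos.2 (by linarith)
  have hQ : gevQuantile γ (Real.log 2) = 1 / (-γ) * (1 - Real.exp (γ * Real.log 2)) := by
    rw [gevQuantile, if_neg hγ.ne]
    have := hγ.ne
    field_simp
    ring
  have h1 : gevQuantile γ (Real.log 2) < C := by
    rw [hQ]
    nlinarith
  have h2 : gevQuantile γ (Real.log 2) + C * Real.exp (γ * Real.log 2) < C * 2 ^ (0 : ℝ) := by
    rw [hQ, Real.rpow_zero]
    nlinarith
  simpa using potter_right hF hab (hg.trans hC) le_rfl h1 h2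

/-! ### The standard norming sequences. -/

/-- The easy half of the convergence of types theorem. -/
theorem IsNorming.of_equiv {F : ℝ → ℝ} (hF : IsDistributionFunction F) {γ : ℝ}
    {a b a' b' : ℕ → ℝ} (hab : IsNorming F γ a b)
    (ha : Tendsto (fun m => a' m / a m) atTop (𝓝 1))
    (hb : Tendsto (fun m => (b' m - b m) / a m) atTop (𝓝 0)) : IsNorming F γ a' b' := by
  have hpos : ∀ᶠ m in atTop, 0 < a' m := by
    filter_upwards [hab.1, ha.eventually (lt_mem_nhds one_pos)] with m h1 h2
    exact (div_pos_iff_of_pos_right h1).1 h2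
  refine ⟨hpos, fun x => ?_⟩
  have hx : Tendsto (fun m => a' m / a m * x + (b' m - b m) / a m) atTop (𝓝 x) := by
    simpa using (ha.mul_const x).add hb
  refine tendsto_order.2 ⟨fun c hc => ?_, fun c hc => ?_⟩
  · rcases lt_or_ge c 0 with h0 | h0
    · exact Eventually.of_forall fun m => h0.trans_le (pow_nonneg (hF.nonneg _) m)
    obtain ⟨y, hy, hcy⟩ := exists_lt_of_lt_gevCDF hc h0
    filter_upwards [hab.1, hx.eventually (lt_mem_nhds hy), (hab.2 y).eventually (lt_mem_nhds hcy)]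
      with m h1 h2 h3
    refine h3.trans_le (pow_le_pow_left₀ (hF.nonneg _) (hF.mono ?_) m)
    rw [div_mul_eq_mul_div, ← add_div, lt_div_iff₀ h1] at h2
    linarith
  · rcases lt_or_ge 1 c with h0 | h0
    · exact Eventually.of_forall fun m => (pow_le_one₀ (hF.nonneg _) (hF.le_one _)).trans_lt h0
    obtain ⟨y, hy, hcy⟩ := exists_gt_of_gevCDF_lt hc h0
    filter_upwards [hab.1, hx.eventually (gt_mem_nhds hy), (hab.2 y).eventually (gt_mem_nhds hcy)]
      with m h1 h2 h3
    refine (pow_le_pow_left₀ (hF.nonneg _) (hF.mono ?_) m).trans_lt h3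
    rw [div_mul_eq_mul_div, ← add_div, div_lt_iff₀ h1] at h2
    linarith

/-- Beyond some `t₂` doubling increases `a`, since the ratio tends to `2^γ > 1`, so each doubling
adds to `U` at least a fixed positive amount. -/
lemma tendsto_tailQuantile_atTop {F : ℝ → ℝ} (hF : IsDistributionFunction F) {γ : ℝ}
    {a b : ℕ → ℝ} (hab : IsNorming F γ a b) (hγ : 0 < γ) :
    Tendsto (tailQuantile F) atTop atTop := by
  have hl : 0 < Real.log 2 := Real.log_pos (by norm_num)
  have hQ : 0 < gevQuantile γ (Real.log 2) := by
    rw [← gevQuantile_zero γ]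
    exact strictMono_gevQuantile γ hl
  have l1 := tendsto_tailQuantile_sub hF hab (Real.log 2) 0
  have l2 := tendsto_norming_ratio hF hab hl.ne'
  rw [gevQuantile_zero, sub_zero] at l1
  have h1 : 1 < Real.exp (γ * Real.log 2) := Real.one_lt_exp_iff.2 (by positivity)
  obtain ⟨t₁, ht₁⟩ := eventually_atTop.1
    ((l1.eventually (lt_mem_nhds (half_lt_self hQ))).and
    ((l2.eventually (lt_mem_nhds h1)).and (tendsto_nat_floor_atTop (α := ℝ) |>.eventually hab.1)))
  set t₂ := max t₁ 2 with ht₂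
  set q := gevQuantile γ (Real.log 2) / 2 with hq
  have ht2 : 2 ≤ t₂ := le_max_right _ _
  have hpos : 0 < a ⌊t₂⌋₊ := (ht₁ t₂ (le_max_left _ _)).2.2
  have hge : ∀ j : ℕ, t₂ ≤ t₂ * 2 ^ j := fun j => by
    have : (1 : ℝ) ≤ 2 ^ j := one_le_pow₀ (by norm_num)
    nlinarith
  have key : ∀ j : ℕ, a ⌊t₂⌋₊ ≤ a ⌊t₂ * 2 ^ j⌋₊ ∧
      tailQuantile F t₂ + j * (q * a ⌊t₂⌋₊) ≤ tailQuantile F (t₂ * 2 ^ j) := by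
    intro j
    induction j with
    | zero => simp
    | succ j ih =>
      obtain ⟨h3, h4, h5⟩ := ht₁ (t₂ * 2 ^ j) ((le_max_left _ _).trans (hge j))
      rw [lt_div_iff₀ h5, mul_exp_log_two, Real.exp_zero, mul_one, mul_assoc, ← pow_succ] at h3
      rw [lt_div_iff₀ h5, mul_exp_log_two, mul_assoc, ← pow_succ, one_mul] at h4
      refine ⟨by linarith [ih.1], ?_⟩
      have : q * a ⌊t₂⌋₊ ≤ q * a ⌊t₂ * 2 ^ j⌋₊ :=
        mul_le_mul_of_nonneg_left ih.1 (by positivity)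
      push_cast
      linarith [ih.2]
  refine tendsto_atTop.2 fun c => ?_
  have h6 : Tendsto (fun j : ℕ => tailQuantile F t₂ + j * (q * a ⌊t₂⌋₊)) atTop atTop :=
    tendsto_atTop_add_const_left _ _ (tendsto_natCast_atTop_atTop.atTop_mul_const (by positivity))
  obtain ⟨j, hj⟩ := (h6.eventually_ge_atTop c).exists
  filter_upwards [eventually_ge_atTop (t₂ * 2 ^ j)] with t ht
  refine hj.trans ((key j).2.trans (monotoneOn_tailQuantile hF ?_ ?_ ht))
  · exact lt_of_lt_of_le (by linarith) (hge j)
  · exact lt_of_lt_of_le (by linarith) ((hge j).trans ht)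

/-- From above, the bound with `C` close to `1 / γ` and a fixed lower point, since `a → ∞`. From
below, `U(t) ≥ U(t) - U(t e^(-w))` once the subtracted value is nonnegative, and `γ` times the
normalized difference tends to `1 - e^(-γ w)`, which is near `1` for large `w`. -/
lemma tendsto_tailQuantile_div {F : ℝ → ℝ} (hF : IsDistributionFunction F) {γ : ℝ}
    {a b : ℕ → ℝ} (hab : IsNorming F γ a b) (hγ : 0 < γ) :
    Tendsto (fun t : ℝ => γ * tailQuantile F t / a ⌊t⌋₊) atTop (𝓝 1) := by
  have hUtop := tendsto_tailQuantile_atTop hF hab hγ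
  have hapos := tendsto_nat_floor_atTop (α := ℝ) |>.eventually hab.1
  have hainv : Tendsto (fun t : ℝ => (a ⌊t⌋₊)⁻¹) atTop (𝓝 0) := by
    obtain ⟨t₀, -, h⟩ := tailQuantile_sub_le_of_pos hF hab hγ
      (show 1 / γ < 1 / γ + 1 by linarith)
    have hC : 0 < 1 / γ + 1 := by positivity
    refine tendsto_inv_atTop_zero.comp (tendsto_atTop_mono' _ ?_
      ((tendsto_atTop_add_const_right _ (-tailQuantile F t₀) hUtop).atTop_div_const hC))
    filter_upwards [eventually_ge_atTop t₀] with t ht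
    rw [div_le_iff₀ hC]
    linarith [h t₀ le_rfl t ht]
  refine tendsto_order.2 ⟨fun c hc => ?_, fun c hc => ?_⟩
  · have hlim : Tendsto (fun w : ℝ => γ * (-gevQuantile γ (-w))) atTop (𝓝 1) := by
      have h1 : Tendsto (fun w : ℝ => 1 - Real.exp (-(γ * w))) atTop (𝓝 (1 - 0)) :=
        tendsto_const_nhds.sub (Real.tendsto_exp_neg_atTop_nhds_zero.comp
          (tendsto_id.const_mul_atTop hγ))
      rw [sub_zero] at h1
      refine h1.congr fun w => ?_
      rw [gevQuantile, if_neg hγ.ne']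
      field_simp
      ring
    obtain ⟨w, hw⟩ := (hlim.eventually (lt_mem_nhds hc)).exists
    have h2 := (tendsto_tailQuantile_sub hF hab 0 (-w)).const_mul γ
    rw [gevQuantile_zero, zero_sub] at h2
    have h3 : Tendsto (fun t => tailQuantile F (t * Real.exp (-w))) atTop atTop :=
      hUtop.comp (tendsto_id.atTop_mul_const (Real.exp_pos _))
    filter_upwards [h2.eventually (lt_mem_nhds hw), h3.eventually_ge_atTop 0, hapos] with t h4 h5 h6
    refine h4.trans_le ?_
    rw [mul_div_assoc]
    refine mul_le_mul_of_nonneg_left (div_le_div_of_nonneg_right ?_ h6.le) hγ.le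
    rw [Real.exp_zero, mul_one]
    linarith
  · have hC : 1 / γ < (1 + c) / (2 * γ) := by
      rw [div_lt_div_iff₀ hγ (by positivity)]
      nlinarith
    obtain ⟨t₀, -, h⟩ := tailQuantile_sub_le_of_pos hF hab hγ hC
    have h1 : Tendsto (fun t : ℝ => γ * ((1 + c) / (2 * γ) + tailQuantile F t₀ * (a ⌊t⌋₊)⁻¹)) atTop
        (𝓝 (γ * ((1 + c) / (2 * γ) + tailQuantile F t₀ * 0))) :=
      (tendsto_const_nhds.add (hainv.const_mul _)).const_mul _
    have h2 : γ * ((1 + c) / (2 * γ) + tailQuantile F t₀ * 0) < c := by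
      have : γ * ((1 + c) / (2 * γ) + tailQuantile F t₀ * 0) = (1 + c) / 2 := by
        field_simp
        ring
      linarith
    filter_upwards [h1.eventually (gt_mem_nhds h2), hapos, eventually_ge_atTop t₀] with t h3 h4 h5
    refine lt_of_le_of_lt ?_ h3
    rw [mul_div_assoc]
    refine mul_le_mul_of_nonneg_left ?_ hγ.le
    rw [div_le_iff₀ h4, add_mul, mul_assoc, inv_mul_cancel₀ h4.ne']
    linarith [h t₀ le_rfl t h5]

lemma bddAbove_tailQuantile {F : ℝ → ℝ} (hF : IsDistributionFunction F) {γ : ℝ}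
    {a b : ℕ → ℝ} (hab : IsNorming F γ a b) (hγ : γ < 0) :
    BddAbove (tailQuantile F '' Set.Ioi 1) := by
  obtain ⟨t₀, ht₀, h⟩ := tailQuantile_sub_le_of_neg hF hab hγ
    (show 1 / (-γ) < 1 / (-γ) + 1 by linarith)
  refine ⟨tailQuantile F t₀ + max 0 ((1 / (-γ) + 1) * a ⌊t₀⌋₊), ?_⟩
  rintro _ ⟨s, hs, rfl⟩
  rcases le_total s t₀ with h1 | h1
  · have h2 := monotoneOn_tailQuantile hF hs (show (1 : ℝ) < t₀ by linarith) h1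
    linarith [le_max_left 0 ((1 / (-γ) + 1) * a ⌊t₀⌋₊)]
  · have := h t₀ le_rfl s h1
    linarith [le_max_right 0 ((1 / (-γ) + 1) * a ⌊t₀⌋₊)]

/-- As for `γ > 0`, with `U(∞) ≥ U(t e^w)` for the lower bound and the sharp bound, uniform in `s ≥
t`, for the upper one. -/
lemma tendsto_endpoint_sub_div {F : ℝ → ℝ} (hF : IsDistributionFunction F) {γ : ℝ}
    {a b : ℕ → ℝ} (hab : IsNorming F γ a b) (hγ : γ < 0) :
    Tendsto (fun t : ℝ => -γ * (sSup (tailQuantile F '' Set.Ioi 1) - tailQuantile F t) / a ⌊t⌋₊)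
      atTop (𝓝 1) := by
  have hapos := tendsto_nat_floor_atTop (α := ℝ) |>.eventually hab.1
  have hbdd := bddAbove_tailQuantile hF hab hγ
  have hγ' : 0 < -γ := by linarith
  refine tendsto_order.2 ⟨fun c hc => ?_, fun c hc => ?_⟩
  · have hlim : Tendsto (fun w : ℝ => -γ * (gevQuantile γ w)) atTop (𝓝 1) := by
      have h1 : Tendsto (fun w : ℝ => 1 - Real.exp (-(-γ * w))) atTop (𝓝 (1 - 0)) :=
        tendsto_const_nhds.sub (Real.tendsto_exp_neg_atTop_nhds_zero.comp
          (tendsto_id.const_mul_atTop hγ'))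
      rw [sub_zero] at h1
      refine h1.congr fun w => ?_
      have h2 : γ ≠ 0 := hγ.ne
      rw [gevQuantile, if_neg h2, neg_mul, neg_neg]
      field_simp
      ring
    obtain ⟨w, hw⟩ := (hlim.eventually (lt_mem_nhds hc)).exists
    have h2 := (tendsto_tailQuantile_sub hF hab w 0).const_mul (-γ)
    rw [gevQuantile_zero, sub_zero] at h2
    filter_upwards [h2.eventually (lt_mem_nhds hw), hapos,
      (tendsto_id.atTop_mul_const (Real.exp_pos w)).eventually_gt_atTop 1] with t h4 h6 h7
    refine h4.trans_le ?_
    rw [mul_div_assoc]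
    refine mul_le_mul_of_nonneg_left (div_le_div_of_nonneg_right ?_ h6.le) hγ'.le
    rw [Real.exp_zero, mul_one]
    have := le_csSup hbdd ⟨t * Real.exp w, h7, rfl⟩
    linarith
  · have hC : 1 / (-γ) < (1 + c) / (2 * -γ) := by
      rw [div_lt_div_iff₀ hγ' (by positivity)]
      nlinarith
    obtain ⟨t₀, ht₀, h⟩ := tailQuantile_sub_le_of_neg hF hab hγ hC
    filter_upwards [hapos, eventually_ge_atTop t₀] with t h4 h5
    rw [div_lt_iff₀ h4]
    have h6 : sSup (tailQuantile F '' Set.Ioi 1) ≤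
        tailQuantile F t + (1 + c) / (2 * -γ) * a ⌊t⌋₊ := by
      refine csSup_le (Set.nonempty_Ioi.image _) ?_
      rintro _ ⟨s, hs, rfl⟩
      rcases le_total s t with h1 | h1
      · have h2 := monotoneOn_tailQuantile hF hs (show (1 : ℝ) < t by linarith) h1
        have : 0 ≤ (1 + c) / (2 * -γ) * a ⌊t⌋₊ := by
          have : (0 : ℝ) < (1 + c) / (2 * -γ) := div_pos (by linarith) (by linarith)
          positivity
        linarith
      · linarith [h t h5 s h1]
    have h7 : -γ * ((1 + c) / (2 * -γ) * a ⌊t⌋₊) = (1 + c) / 2 * a ⌊t⌋₊ := by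
      have := hγ.ne
      field_simp
    nlinarith

/-- After scaling, the quantity is `∫₀¹ (U(t) - U(t r)) / a(t) dr`, which tends to `∫₀¹ -log r dr =
1`. Freezing `U` below `t₁` makes it monotone on the whole line and keeps the Potter bound `C
r^(-1/2)` valid for every `r`. -/
lemma tendsto_integral_tailQuantile {F : ℝ → ℝ} (hF : IsDistributionFunction F)
    {a b : ℕ → ℝ} (hab : IsNorming F 0 a b) (c₀ : ℝ) :
    ∃ t₁ ≥ c₀, 2 < t₁ ∧ Tendsto (fun t : ℝ => (t * a ⌊t⌋₊)⁻¹) atTop (𝓝 0) ∧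
      Tendsto (fun t : ℝ => (tailQuantile F t
        - t⁻¹ * ∫ x in (0 : ℝ)..t, tailQuantile F (max x t₁)) / a ⌊t⌋₊) atTop (𝓝 1) := by
  have hapos := tendsto_nat_floor_atTop (α := ℝ) |>.eventually hab.1
  obtain ⟨C, hC, t₀, ht₀, hpot⟩ := exists_potter_left hF hab (ρ := 1 / 2) (by norm_num) (by norm_num)
  have l1 := tendsto_tailQuantile_sub hF hab (Real.log 2) 0
  have hl : 0 < Real.log 2 := Real.log_pos (by norm_num)
  have hQ : 0 < gevQuantile 0 (Real.log 2) := by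
    simpa [gevQuantile] using hl
  rw [gevQuantile_zero, sub_zero] at l1
  -- At `t₁` the increment `η = U(2 t₁) - U(t₁)` is positive. As `η ≤ C (t / t₁)^(1/2) a(t)` for `t
  -- ≥ 2 t₁`, the product `t a(t)` grows at least like `t^(1/2)`.
  obtain ⟨t₁, hinc, ha1, hge⟩ := ((l1.eventually (lt_mem_nhds hQ)).and
    (hapos.and (eventually_ge_atTop (max t₀ c₀)))).exists
  have ht10 : t₀ ≤ t₁ := (le_max_left _ _).trans hge
  have ht1pos : 0 < t₁ := by linarith
  rw [lt_div_iff₀ ha1, mul_exp_log_two, Real.exp_zero, mul_one, zero_mul] at hinc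
  set η := tailQuantile F (t₁ * 2) - tailQuantile F t₁ with hη
  refine ⟨t₁, (le_max_right _ _).trans hge, by linarith, ?_, ?_⟩
  · have h1 : Tendsto (fun t : ℝ => C / η * t₁ ^ (-(1 / 2) : ℝ) * t ^ (-(1 / 2) : ℝ)) atTop
        (𝓝 (C / η * t₁ ^ (-(1 / 2) : ℝ) * 0)) :=
      (tendsto_rpow_neg_atTop (by norm_num)).const_mul _
    rw [mul_zero] at h1
    refine squeeze_zero' ?_ ?_ h1
    · filter_upwards [hapos, eventually_gt_atTop 0] with t h2 h3
      positivity
    · filter_upwards [hapos, eventually_ge_atTop (t₁ * 2)] with t h2 h3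
      have ht : 0 < t := by linarith
      have h4 := hpot t₁ ht10 t (by linarith)
      have h5 := monotoneOn_tailQuantile hF (show (1 : ℝ) < t₁ * 2 by linarith)
        (show (1 : ℝ) < t by linarith) h3
      have h6 : η ≤ C * (t / t₁) ^ (1 / 2 : ℝ) * a ⌊t⌋₊ := by linarith
      rw [mul_inv, ← div_eq_mul_inv, div_le_iff₀ h2, Real.rpow_neg ht1pos.le, Real.rpow_neg ht.le]
      rw [Real.div_rpow ht.le ht1pos.le] at h6
      have h7 : t = t ^ (1 / 2 : ℝ) * t ^ (1 / 2 : ℝ) := by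
        rw [← Real.rpow_add ht]
        norm_num
      have h8 : 0 < t ^ (1 / 2 : ℝ) := by positivity
      have h9 : 0 < t₁ ^ (1 / 2 : ℝ) := by positivity
      calc t⁻¹ = (t ^ (1 / 2 : ℝ) * t ^ (1 / 2 : ℝ))⁻¹ * (η / η) := by
            rw [← h7, div_self hinc.ne', mul_one]
        _ = η * ((t ^ (1 / 2 : ℝ) * t ^ (1 / 2 : ℝ))⁻¹ * η⁻¹) := by ring
        _ ≤ C * (t ^ (1 / 2 : ℝ) / t₁ ^ (1 / 2 : ℝ)) * a ⌊t⌋₊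
            * ((t ^ (1 / 2 : ℝ) * t ^ (1 / 2 : ℝ))⁻¹ * η⁻¹) := by gcongr
        _ = C / η * (t₁ ^ (1 / 2 : ℝ))⁻¹ * (t ^ (1 / 2 : ℝ))⁻¹ * a ⌊t⌋₊ := by
            field_simp
  · set V : ℝ → ℝ := fun x => tailQuantile F (max x t₁) with hV
    have hVmono : Monotone V := fun x y hxy => monotoneOn_tailQuantile hF
      (show (1 : ℝ) < max x t₁ from lt_max_of_lt_right (by linarith))
      (show (1 : ℝ) < max y t₁ from lt_max_of_lt_right (by linarith)) (max_le_max hxy le_rfl)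
    have hVt : ∀ t, t₁ ≤ t → V t = tailQuantile F t := fun t ht => by simp [hV, max_eq_left ht]
    have hdct : Tendsto (fun t : ℝ => ∫ r in (0 : ℝ)..1, (V t - V (t * r)) / a ⌊t⌋₊) atTop
        (𝓝 (∫ r in (0 : ℝ)..1, -Real.log r)) := by
      refine intervalIntegral.tendsto_integral_filter_of_dominated_convergence
        (fun r => C * r ^ (-(1 / 2) : ℝ)) ?_ ?_ ?_ ?_
      · refine Eventually.of_forall fun t => ?_
        exact ((measurable_const.sub (hVmono.measurable.comp
          (measurable_const.mul measurable_id))).div_const _).aestronglyMeasurable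
      · filter_upwards [eventually_ge_atTop t₁, hapos] with t ht hat
        refine Eventually.of_forall fun r hr => ?_
        rw [Set.uIoc_of_le zero_le_one] at hr
        have ht0 : 0 < t := by linarith
        have h1 : V (t * r) ≤ V t := hVmono (by nlinarith [hr.2])
        rw [Real.norm_of_nonneg (div_nonneg (by linarith) hat.le), div_le_iff₀ hat, hVt t ht]
        refine (hpot (max (t * r) t₁) (ht10.trans (le_max_right _ _)) t
          (max_le (by nlinarith [hr.2]) ht)).trans ?_
        refine mul_le_mul_of_nonneg_right (mul_le_mul_of_nonneg_left ?_ hC.le) hat.le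
        rw [Real.rpow_neg hr.1.le, ← Real.inv_rpow hr.1.le]
        refine Real.rpow_le_rpow (by positivity) ?_ (by norm_num)
        rw [div_le_iff₀ (lt_max_of_lt_right ht1pos)]
        calc t = r⁻¹ * (t * r) := by
              have := hr.1.ne'
              field_simp
          _ ≤ r⁻¹ * max (t * r) t₁ :=
              mul_le_mul_of_nonneg_left (le_max_left _ _) (inv_nonneg.2 hr.1.le)
      · exact (intervalIntegral.intervalIntegrable_rpow' (by norm_num)).const_mul C
      · refine Eventually.of_forall fun r hr => ?_
        rw [Set.uIoc_of_le zero_le_one] at hr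
        have h1 := tendsto_tailQuantile_sub hF hab 0 (Real.log r)
        simp only [gevQuantile, if_true, zero_sub, Real.exp_zero, mul_one, Real.exp_log hr.1] at h1
        refine h1.congr' ?_
        filter_upwards [eventually_ge_atTop t₁,
          (tendsto_id.atTop_mul_const hr.1).eventually_ge_atTop t₁] with t h2 h3
        rw [hVt t h2, hVt (t * r) h3]
    have hlog : ∫ r in (0 : ℝ)..1, -Real.log r = 1 := by
      rw [intervalIntegral.integral_neg, integral_log]
      simp
    rw [hlog] at hdct
    refine hdct.congr' ?_
    filter_upwards [eventually_ge_atTop t₁] with t ht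
    have ht0 : 0 < t := by linarith
    have hVi : IntervalIntegrable (fun r => V (t * r)) volume 0 1 :=
      Monotone.intervalIntegrable fun x y hxy => hVmono (mul_le_mul_of_nonneg_left hxy ht0.le)
    rw [intervalIntegral.integral_div, intervalIntegral.integral_sub (by simp) hVi,
      intervalIntegral.integral_comp_mul_left V ht0.ne']
    simp [hVt t ht]

lemma tendsto_auxScale_zero {F : ℝ → ℝ} (hF : IsDistributionFunction F)
    {a b : ℕ → ℝ} (hab : IsNorming F 0 a b) {c : ℝ}
    (hint : IntegrableOn (tailQuantile F) (Set.Ioc c 2)) :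
    Tendsto (fun t : ℝ => auxScale F 0 c t / a ⌊t⌋₊) atTop (𝓝 1) := by
  obtain ⟨t₁, ht1c, ht12, h1, h2⟩ := tendsto_integral_tailQuantile hF hab c
  set V : ℝ → ℝ := fun x => tailQuantile F (max x t₁) with hV
  have hVmono : Monotone V := fun x y hxy => monotoneOn_tailQuantile hF
    (show (1 : ℝ) < max x t₁ from lt_max_of_lt_right (by linarith))
    (show (1 : ℝ) < max y t₁ from lt_max_of_lt_right (by linarith)) (max_le_max hxy le_rfl)
  have hmono : ∀ x y : ℝ, 1 < x → x ≤ y → IntervalIntegrable (tailQuantile F) volume x y := by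
    intro x y hx hxy
    refine MonotoneOn.intervalIntegrable ((monotoneOn_tailQuantile hF).mono ?_)
    rw [Set.uIcc_of_le hxy]
    exact fun z hz => hx.trans_le hz.1
  have hct1 : IntervalIntegrable (tailQuantile F) volume c t₁ := by
    rcases le_total c 2 with h | h
    · refine IntervalIntegrable.trans (b := 2) ?_ (hmono 2 t₁ (by norm_num) ht12.le)
      rwa [intervalIntegrable_iff_integrableOn_Ioc_of_le h]
    · exact hmono c t₁ (by linarith) ht1c
  -- The choice of `c` and the freezing below `t₁` change the integral only by this constant, which
  -- is negligible after division by `t a(t)`.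
  set κ := (∫ x in (0 : ℝ)..t₁, V x) - ∫ x in c..t₁, tailQuantile F x with hκ
  have h3 := h2.add (h1.const_mul κ)
  rw [mul_zero, add_zero] at h3
  refine h3.congr' ?_
  filter_upwards [eventually_ge_atTop t₁] with t ht
  have h4 : ∫ x in c..t, tailQuantile F x
      = (∫ x in c..t₁, tailQuantile F x) + ∫ x in t₁..t, tailQuantile F x :=
    (intervalIntegral.integral_add_adjacent_intervals hct1 (hmono t₁ t (by linarith) ht)).symm
  have h5 : ∫ x in (0 : ℝ)..t, V x = (∫ x in (0 : ℝ)..t₁, V x) + ∫ x in t₁..t, V x :=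
    (intervalIntegral.integral_add_adjacent_intervals hVmono.intervalIntegrable
      hVmono.intervalIntegrable).symm
  have h6 : ∫ x in t₁..t, V x = ∫ x in t₁..t, tailQuantile F x := by
    refine intervalIntegral.integral_congr fun x hx => ?_
    rw [Set.uIcc_of_le ht] at hx
    simp [hV, max_eq_left hx.1]
  simp only [auxScale, lt_irrefl, if_false]
  rw [h5, h4, h6, mul_inv, hκ]
  ring

/-- The standard norming sequences are norming sequences. -/
theorem IsStandardNorming.isNorming {F : ℝ → ℝ} (hF : IsDistributionFunction F) {γ : ℝ}
    (hD : InDomainOfAttraction F γ) {a b : ℕ → ℝ} (h : IsStandardNorming F γ a b) :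
    IsNorming F γ a b := by
  obtain ⟨a', b', hab⟩ := hD
  obtain ⟨c, -, hint, hst⟩ := h
  have hcast := tendsto_natCast_atTop_atTop (R := ℝ)
  have hb : Tendsto (fun m => (b m - b' m) / a' m) atTop (𝓝 0) := by
    have h1 := (tendsto_tailQuantile hF hab 0).comp hcast
    rw [gevQuantile_zero] at h1
    refine h1.congr' ?_
    filter_upwards [eventually_ge_atTop 2] with m hm
    simp [(hst m hm).2]
  refine hab.of_equiv hF ?_ hb
  have key : Tendsto (fun t : ℝ => auxScale F γ c t / a' ⌊t⌋₊) atTop (𝓝 1) := by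
    rcases lt_trichotomy γ 0 with hγ | hγ | hγ
    · refine (tendsto_endpoint_sub_div hF hab hγ).congr fun t => ?_
      simp [auxScale, hγ, not_lt.2 hγ.le]
    · subst hγ
      exact tendsto_auxScale_zero hF hab hint
    · refine (tendsto_tailQuantile_div hF hab hγ).congr fun t => ?_
      simp [auxScale, hγ]
  refine (key.comp hcast).congr' ?_
  filter_upwards [eventually_ge_atTop 2] with m hm
  simp [(hst m hm).1]

/-! ### The laws `G_θ` as images of the exponential law, identifiability and Gibbs' inequality. -/

/-- The standard exponential law. -/
def expLaw : Measure ℝ :=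
  (volume.restrict (Set.Ioi 0)).withDensity fun e => ENNReal.ofReal (Real.exp (-e))

lemma expLaw_apply {s : Set ℝ} (hs : MeasurableSet s) :
    expLaw s = ∫⁻ e in s ∩ Set.Ioi 0, ENNReal.ofReal (Real.exp (-e)) := by
  rw [expLaw, withDensity_apply _ hs, Measure.restrict_restrict hs]

lemma expLaw_Ici {u : ℝ} (hu : 0 ≤ u) :
    expLaw (Set.Ici u) = ENNReal.ofReal (Real.exp (-u)) := by
  have h1 : expLaw (Set.Ici u) = ∫⁻ e in Set.Ioi u, ENNReal.ofReal (Real.exp (-e)) := by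
    rw [expLaw_apply measurableSet_Ici]
    refine setLIntegral_congr ?_
    rcases hu.eq_or_lt with rfl | hu
    · rw [Set.inter_eq_right.2 Set.Ioi_subset_Ici_self]
      exact ae_eq_refl _
    · have h : Set.Ici u ∩ Set.Ioi 0 = Set.Ici u :=
        Set.inter_eq_left.2 fun x hx => lt_of_lt_of_le hu hx
      rw [h]
      exact Ioi_ae_eq_Ici.symm
  rw [h1, ← ofReal_integral_eq_lintegral_ofReal (integrableOn_exp_neg_Ioi u)
    (Eventually.of_forall fun x => (Real.exp_pos _).le), integral_exp_neg_Ioi]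

lemma ae_pos_expLaw : ∀ᵐ e ∂expLaw, 0 < e :=
  (withDensity_absolutelyContinuous _ _).ae_le (ae_restrict_mem measurableSet_Ioi)

instance isProbabilityMeasure_expLaw : IsProbabilityMeasure expLaw := by
  constructor
  have h : expLaw Set.univ = expLaw (Set.Ici 0) := by
    refine measure_congr ?_
    filter_upwards [ae_pos_expLaw] with e he
    exact propext ⟨fun _ => he.le, fun _ => trivial⟩
  rw [h, expLaw_Ici le_rfl]
  simp

lemma integrable_expLaw_iff {f : ℝ → ℝ} :
    Integrable f expLaw ↔ IntegrableOn (fun e => Real.exp (-e) * f e) (Set.Ioi 0) := by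
  rw [expLaw, integrable_withDensity_iff_integrable_smul₀' (by fun_prop) (by simp)]
  refine integrable_congr (Eventually.of_forall fun e => ?_)
  simp [ENNReal.toReal_ofReal (Real.exp_pos _).le]

lemma integrable_rpow_expLaw {s : ℝ} (hs : -1 < s) : Integrable (fun e => e ^ s) expLaw := by
  rw [integrable_expLaw_iff]
  simpa using Real.GammaIntegral_convergent (s := s + 1) (by linarith)

lemma integrable_log_expLaw : Integrable Real.log expLaw := by
  refine Integrable.mono' (((integrable_rpow_expLaw (s := 1 / 2) (by norm_num)).add
    (integrable_rpow_expLaw (s := -(1 / 2)) (by norm_num))).const_mul 2)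
    Real.measurable_log.aestronglyMeasurable ?_
  filter_upwards [ae_pos_expLaw] with e he
  have h1 := Real.log_le_rpow_div he.le (show (0 : ℝ) < 1 / 2 by norm_num)
  have h2 := Real.log_le_rpow_div (inv_pos.2 he).le (show (0 : ℝ) < 1 / 2 by norm_num)
  rw [Real.log_inv, Real.inv_rpow he.le, ← Real.rpow_neg he.le] at h2
  have h3 : 0 < e ^ (1 / 2 : ℝ) := by positivity
  have h4 : 0 < e ^ (-(1 / 2) : ℝ) := by positivity
  rw [Real.norm_eq_abs, abs_le]
  simp only [Pi.add_apply]
  constructor <;> linarith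

/-- The law of `G_θ` as the image of the standard exponential law. -/
def gevMap (θ : ℝ × ℝ × ℝ) (e : ℝ) : ℝ := θ.2.1 + θ.2.2 * gevQuantile θ.1 (-Real.log e)

/-- The density of `G_θ`. -/
def gevDensity (θ : ℝ × ℝ × ℝ) (x : ℝ) : ENNReal :=
  if gevLogLik θ x = ⊥ then 0 else ENNReal.ofReal (Real.exp (gevLogLik θ x).toReal)

lemma measurable_gevMap (θ : ℝ × ℝ × ℝ) : Measurable (gevMap θ) :=
  ((((continuous_gevQuantile θ.1).measurable.comp Real.measurable_log.neg)).const_mul _).const_add _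

lemma gevMap_sub_div {θ : ℝ × ℝ × ℝ} (hσ : 0 < θ.2.2) (e : ℝ) :
    (gevMap θ e - θ.2.1) / θ.2.2 = gevQuantile θ.1 (-Real.log e) := by
  rw [gevMap]
  field_simp
  ring

lemma gevLogLik_gevMap {θ : ℝ × ℝ × ℝ} (hσ : 0 < θ.2.2) {e : ℝ} (he : 0 < e) :
    gevLogLik θ (gevMap θ e) =
      (((1 + θ.1) * Real.log e - e - Real.log θ.2.2 : ℝ) : EReal) := by
  have h1 := gevMap_sub_div hσ e
  rw [gevLogLik_of_pos (by rw [h1]; exact one_add_mul_gevQuantile_pos _ _), h1,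
    gumbelCoord_gevQuantile, gumbelLogLik, neg_neg, Real.exp_log he]
  congr 1
  ring

lemma injOn_gevMap {θ : ℝ × ℝ × ℝ} (hσ : 0 < θ.2.2) : Set.InjOn (gevMap θ) (Set.Ioi 0) := by
  intro e he e' he' h
  have h1 := gevMap_sub_div hσ e
  rw [h, gevMap_sub_div hσ e'] at h1
  have h2 := (strictMono_gevQuantile _).injective h1
  exact (Real.log_injOn_pos he' he (by linarith)).symm

lemma image_gevMap {θ : ℝ × ℝ × ℝ} (hσ : 0 < θ.2.2) :
    gevMap θ '' Set.Ioi 0 = {x | 0 < 1 + θ.1 * ((x - θ.2.1) / θ.2.2)} := by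
  ext x
  constructor
  · rintro ⟨e, -, rfl⟩
    simp only [Set.mem_ofPred_eq]
    rw [gevMap_sub_div hσ]
    exact one_add_mul_gevQuantile_pos _ _
  · intro hx
    refine ⟨Real.exp (-gumbelCoord θ.1 ((x - θ.2.1) / θ.2.2)), Real.exp_pos _, ?_⟩
    rw [gevMap, Real.log_exp, neg_neg, gevQuantile_gumbelCoord hx]
    field_simp
    ring

lemma hasDerivAt_gevMap (θ : ℝ × ℝ × ℝ) {e : ℝ} (he : 0 < e) :
    HasDerivAt (gevMap θ) (-(θ.2.2 * (Real.exp (-(1 + θ.1) * Real.log e)))) e := by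
  have h1 : HasDerivAt (fun e => -Real.log e) (-e⁻¹) e := (Real.hasDerivAt_log he.ne').neg
  have h2 := (((hasDerivAt_gevQuantile θ.1 (-Real.log e)).comp e h1).const_mul θ.2.2).const_add θ.2.1
  refine h2.congr_deriv ?_
  have h3 : -(1 + θ.1) * Real.log e = θ.1 * -Real.log e + -Real.log e := by ring
  rw [h3, Real.exp_add, Real.exp_neg (Real.log e), Real.exp_log he]
  ring

lemma lintegral_gevMap {θ : ℝ × ℝ × ℝ} (hσ : 0 < θ.2.2) {s : Set ℝ} (hs : MeasurableSet s)
    (g : ℝ → ENNReal) :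
    ∫⁻ x in s ∩ {x | 0 < 1 + θ.1 * ((x - θ.2.1) / θ.2.2)}, g x =
      ∫⁻ e in gevMap θ ⁻¹' s ∩ Set.Ioi 0,
        ENNReal.ofReal (θ.2.2 * Real.exp (-(1 + θ.1) * Real.log e)) * g (gevMap θ e) := by
  have himg : s ∩ {x | 0 < 1 + θ.1 * ((x - θ.2.1) / θ.2.2)}
      = gevMap θ '' (gevMap θ ⁻¹' s ∩ Set.Ioi 0) := by
    rw [Set.image_preimage_inter, image_gevMap hσ]
  have hm : MeasurableSet (gevMap θ ⁻¹' s ∩ Set.Ioi 0) :=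
    (measurable_gevMap θ hs).inter measurableSet_Ioi
  rw [himg, lintegral_image_eq_lintegral_abs_deriv_mul hm
    (fun e he => (hasDerivAt_gevMap θ he.2).hasDerivWithinAt)
    ((injOn_gevMap hσ).mono Set.inter_subset_right)]
  refine setLIntegral_congr_fun hm fun e _ => ?_
  rw [abs_neg, abs_of_pos (by positivity)]

lemma gevDensity_of_nonpos {θ : ℝ × ℝ × ℝ} {x : ℝ}
    (hx : 1 + θ.1 * ((x - θ.2.1) / θ.2.2) ≤ 0) : gevDensity θ x = 0 := by
  rw [gevDensity, gevLogLik_of_nonpos hx, if_pos rfl]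

lemma measurableSet_gevSupport (θ : ℝ × ℝ × ℝ) :
    MeasurableSet {x : ℝ | 0 < 1 + θ.1 * ((x - θ.2.1) / θ.2.2)} :=
  measurableSet_lt measurable_const (by fun_prop)

lemma map_gevMap_expLaw {θ : ℝ × ℝ × ℝ} (hσ : 0 < θ.2.2) {s : Set ℝ} (hs : MeasurableSet s) :
    expLaw.map (gevMap θ) s = ∫⁻ x in s, gevDensity θ x := by
  have h1 : ∫⁻ x in s, gevDensity θ x
      = ∫⁻ x in s ∩ {x | 0 < 1 + θ.1 * ((x - θ.2.1) / θ.2.2)}, gevDensity θ x := by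
    rw [← lintegral_indicator hs, ← lintegral_indicator (hs.inter (measurableSet_gevSupport θ))]
    congr 1
    ext x
    by_cases hx : 0 < 1 + θ.1 * ((x - θ.2.1) / θ.2.2)
    · by_cases hxs : x ∈ s <;> simp [Set.indicator, hx, hxs]
    · by_cases hxs : x ∈ s <;> simp [Set.indicator, hx, hxs, gevDensity_of_nonpos (not_lt.1 hx)]
  rw [h1, lintegral_gevMap hσ hs, Measure.map_apply (measurable_gevMap θ) hs,
    expLaw_apply (measurable_gevMap θ hs)]
  refine setLIntegral_congr_fun ((measurable_gevMap θ hs).inter measurableSet_Ioi) fun e he => ?_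
  have he0 : 0 < e := he.2
  rw [gevDensity, gevLogLik_gevMap hσ he0, if_neg (EReal.coe_ne_bot _), EReal.toReal_coe,
    ← ENNReal.ofReal_mul (by positivity)]
  congr 1
  have h2 : θ.2.2 = Real.exp (Real.log θ.2.2) := (Real.exp_log hσ).symm
  nth_rewrite 1 [h2]
  rw [← Real.exp_add, ← Real.exp_add]
  congr 1
  ring

instance isProbabilityMeasure_map_gevMap (θ : ℝ × ℝ × ℝ) :
    IsProbabilityMeasure (expLaw.map (gevMap θ)) :=
  Measure.isProbabilityMeasure_map (measurable_gevMap θ).aemeasurable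

lemma map_gevMap_Iic {θ : ℝ × ℝ × ℝ} (hσ : 0 < θ.2.2) (x : ℝ) :
    expLaw.map (gevMap θ) (Set.Iic x) = ENNReal.ofReal (gevCDF θ.1 ((x - θ.2.1) / θ.2.2)) := by
  rw [Measure.map_apply (measurable_gevMap θ) measurableSet_Iic]
  set y := (x - θ.2.1) / θ.2.2 with hy
  have hiff : ∀ e, gevMap θ e ≤ x ↔ gevQuantile θ.1 (-Real.log e) ≤ y := fun e => by
    rw [← gevMap_sub_div hσ, hy, div_le_div_iff_of_pos_right hσ, sub_le_sub_iff_right]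
  by_cases h : 0 < 1 + θ.1 * y
  · have h1 : expLaw (gevMap θ ⁻¹' Set.Iic x) = expLaw (Set.Ici (Real.exp (-gumbelCoord θ.1 y))) := by
      refine measure_congr ?_
      filter_upwards [ae_pos_expLaw] with e he
      refine propext ?_
      change gevMap θ e ≤ x ↔ Real.exp (-gumbelCoord θ.1 y) ≤ e
      rw [hiff, ← Real.le_log_iff_exp_le he, neg_le]
      nth_rewrite 1 [← gevQuantile_gumbelCoord h]
      exact (strictMono_gevQuantile _).le_iff_le
    rw [h1, expLaw_Ici (Real.exp_pos _).le, gevCDF_of_pos h]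
  · rw [gevCDF_of_nonpos (not_lt.1 h)]
    by_cases hγ : 0 < θ.1
    · have h1 : gevMap θ ⁻¹' Set.Iic x = ∅ := by
        ext e
        simp only [Set.mem_preimage, Set.mem_Iic, hiff, Set.mem_empty_iff_false, iff_false, not_le]
        have := one_add_mul_gevQuantile_pos θ.1 (-Real.log e)
        by_contra! h2
        nlinarith
      simp [h1, hγ]
    · have h1 : gevMap θ ⁻¹' Set.Iic x = Set.univ := by
        ext e
        simp only [Set.mem_preimage, Set.mem_Iic, hiff, Set.mem_univ, iff_true]
        have := one_add_mul_gevQuantile_pos θ.1 (-Real.log e)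
        by_contra! h2
        nlinarith [not_lt.1 hγ]
      simp [h1, hγ]

/-- Equal laws have equal quantiles. The median-like level `w = 0` gives `μ = 0`, the quotient of
the quantiles at `w = 2` and `w = 1` is `1 + e^γ` and gives `γ`, and the quantile at `w = 1` then
gives `σ`. -/
lemma eq_of_map_gevMap_eq {θ : ℝ × ℝ × ℝ} (hσ : 0 < θ.2.2) {γ₀ : ℝ}
    (h : expLaw.map (gevMap (γ₀, 0, 1)) = expLaw.map (gevMap θ)) : θ = (γ₀, 0, 1) := by
  have h1 : ∀ w, (gevQuantile γ₀ w - θ.2.1) / θ.2.2 = gevQuantile θ.1 w := by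
    intro w
    refine eq_gevQuantile_of_gevCDF_eq ?_
    have h2 := map_gevMap_Iic hσ (gevQuantile γ₀ w)
    rw [← h, map_gevMap_Iic (by norm_num)] at h2
    simp only [sub_zero, div_one] at h2
    rw [ENNReal.ofReal_eq_ofReal_iff (gevCDF_nonneg _ _) (gevCDF_nonneg _ _)] at h2
    rw [← h2, gevCDF_gevQuantile]
  have hμ : θ.2.1 = 0 := by
    have := h1 0
    rw [gevQuantile_zero, gevQuantile_zero, div_eq_zero_iff] at this
    rcases this with h | h <;> linarith
  rw [hμ] at h1
  have h2 : ∀ g : ℝ, gevQuantile g 2 = (1 + Real.exp g) * gevQuantile g 1 := by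
    intro g
    unfold gevQuantile
    split_ifs with hg
    · simp [hg]
      norm_num
    · have : Real.exp (g * 2) = Real.exp g * Real.exp g := by
        rw [← Real.exp_add]
        congr 1
        ring
      rw [this, mul_one]
      field_simp
      ring
  have h3 := h1 1
  have h4 := h1 2
  rw [h2, h2, ← h3, sub_zero, sub_zero] at h4
  have h5 : 0 < gevQuantile γ₀ 1 := by
    rw [← gevQuantile_zero γ₀]
    exact strictMono_gevQuantile γ₀ one_pos
  have h6 : Real.exp γ₀ = Real.exp θ.1 := by
    have h7 : 0 < gevQuantile γ₀ 1 / θ.2.2 := div_pos h5 hσ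
    rw [mul_div_assoc] at h4
    have := mul_right_cancel₀ h7.ne' h4
    linarith
  have hγ : γ₀ = θ.1 := Real.exp_injective h6
  have hs : θ.2.2 = 1 := by
    rw [sub_zero, ← hγ, div_eq_iff hσ.ne'] at h3
    have : gevQuantile γ₀ 1 * 1 = gevQuantile γ₀ 1 * θ.2.2 := by linarith
    exact (mul_left_cancel₀ h5.ne' this).symm
  exact Prod.ext hγ.symm (Prod.ext hμ hs)

/-- Gibbs' inequality with the case of equality: the true parameter is the only one whose
log-likelihood has at least the expectation of the true log-likelihood. -/
theorem eq_of_integral_le {θ : ℝ × ℝ × ℝ} (hσ : 0 < θ.2.2) {γ₀ : ℝ}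
    (hbot : ∀ᵐ e ∂expLaw, gevLogLik θ (gevMap (γ₀, 0, 1) e) ≠ ⊥)
    (hint : Integrable (fun e => (gevLogLik θ (gevMap (γ₀, 0, 1) e)).toReal) expLaw)
    (hle : ∫ e, ((1 + γ₀) * Real.log e - e) ∂expLaw ≤
      ∫ e, (gevLogLik θ (gevMap (γ₀, 0, 1) e)).toReal ∂expLaw) : θ = (γ₀, 0, 1) := by
  set T := gevMap (γ₀, 0, 1) with hT
  have hσ₀ : (0 : ℝ) < ((γ₀, 0, 1) : ℝ × ℝ × ℝ).2.2 := one_pos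
  have hi0 : Integrable (fun e => (1 + γ₀) * Real.log e - e) expLaw := by
    refine (integrable_log_expLaw.const_mul _).sub ?_
    simpa using integrable_rpow_expLaw (s := 1) (by norm_num)
  set D : ℝ → ℝ := fun e => (gevLogLik θ (T e)).toReal - ((1 + γ₀) * Real.log e - e) with hD
  have hDi : Integrable D expLaw := hint.sub hi0
  have hD0 : 0 ≤ ∫ e, D e ∂expLaw := by
    rw [hD, integral_sub hint hi0]
    linarith
  have hac : volume.restrict (Set.Ioi (0 : ℝ)) ≪ expLaw :=
    withDensity_absolutelyContinuous' (by fun_prop)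
      (Eventually.of_forall fun e => by simp [Real.exp_pos])
  have hbot' : ∀ᵐ e ∂volume.restrict (Set.Ioi (0 : ℝ)), gevLogLik θ (T e) ≠ ⊥ := by
    exact hac.ae_le hbot
  -- the density ratio in exponential coordinates
  have hratio : ∀ e, 0 < e → gevLogLik θ (T e) ≠ ⊥ →
      ENNReal.ofReal (Real.exp (-e)) * ENNReal.ofReal (Real.exp (D e)) =
      ENNReal.ofReal (1 * Real.exp (-(1 + γ₀) * Real.log e)) * gevDensity θ (T e) := by
    intro e he hb
    rw [gevDensity, if_neg hb, ← ENNReal.ofReal_mul (by positivity),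
      ← ENNReal.ofReal_mul (by positivity), one_mul, ← Real.exp_add, ← Real.exp_add]
    congr 2
    rw [hD]
    ring
  -- Only an inequality: `G_θ` may charge the complement of the support of the true law.
  have hlint : ∫⁻ e, ENNReal.ofReal (Real.exp (D e)) ∂expLaw ≤ 1 := by
    have h1 : ∫⁻ e, ENNReal.ofReal (Real.exp (D e)) ∂expLaw
        = ∫⁻ e in Set.Ioi 0, ENNReal.ofReal (1 * Real.exp (-(1 + γ₀) * Real.log e))
          * gevDensity θ (T e) := by
      rw [expLaw, lintegral_withDensity_eq_lintegral_mul₀ (by fun_prop)]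
      · refine lintegral_congr_ae ?_
        filter_upwards [hbot', ae_restrict_mem measurableSet_Ioi] with e hb he
        exact hratio e he hb
      · exact (hDi.1.aemeasurable.mono_ac hac).exp.ennreal_ofReal
    have h2 := lintegral_gevMap hσ₀ MeasurableSet.univ (gevDensity θ)
    simp only [Set.preimage_univ, Set.univ_inter] at h2
    rw [h1, ← h2]
    refine (lintegral_mono_set (Set.subset_univ _)).trans ?_
    rw [← map_gevMap_expLaw hσ MeasurableSet.univ]
    exact prob_le_one
  have hexp : Integrable (fun e => Real.exp (D e)) expLaw := by
    refine ⟨Real.continuous_exp.comp_aestronglyMeasurable hDi.1, ?_⟩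
    rw [hasFiniteIntegral_iff_ofReal (Eventually.of_forall fun e => (Real.exp_pos _).le)]
    exact hlint.trans_lt ENNReal.one_lt_top
  have hexp1 : ∫ e, Real.exp (D e) ∂expLaw ≤ 1 := by
    rw [integral_eq_lintegral_of_nonneg_ae (Eventually.of_forall fun e => (Real.exp_pos _).le)
      hexp.1]
    exact ENNReal.toReal_le_of_le_ofReal zero_le_one (by simpa using hlint)
  have hnn : ∀ e, 0 ≤ Real.exp (D e) - 1 - D e := fun e => by
    linarith [Real.add_one_le_exp (D e)]
  have hzero : ∫ e, (Real.exp (D e) - 1 - D e) ∂expLaw = 0 := by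
    refine le_antisymm ?_ (integral_nonneg hnn)
    have h1 : ∫ e, (Real.exp (D e) - 1 - D e) ∂expLaw
        = (∫ e, (Real.exp (D e) - 1) ∂expLaw) - ∫ e, D e ∂expLaw :=
      integral_sub (hexp.sub (integrable_const 1)) hDi
    rw [h1, integral_sub hexp (integrable_const 1)]
    simp only [integral_const, probReal_univ, smul_eq_mul, mul_one]
    linarith
  have hae := (integral_eq_zero_iff_of_nonneg hnn ((hexp.sub (integrable_const 1)).sub hDi)).1 hzero
  have hDzero : ∀ᵐ e ∂expLaw, D e = 0 := by
    filter_upwards [hae] with e he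
    by_contra hne
    have := Real.add_one_lt_exp hne
    simp only [Pi.zero_apply] at he
    linarith
  have hDzero' : ∀ᵐ e ∂volume.restrict (Set.Ioi (0 : ℝ)), D e = 0 := by
    exact hac.ae_le hDzero
  -- `D = 0` identifies the densities only on the true support. This gives domination of the true
  -- law by `G_θ`, and equal total mass excludes anything outside.
  refine eq_of_map_gevMap_eq hσ (Measure.eq_of_le_of_measure_univ_eq ?_ (by simp))
  refine Measure.le_iff.2 fun s hs => ?_
  have hm := (measurable_gevMap (γ₀, 0, 1)) hs
  rw [map_gevMap_expLaw hσ hs, Measure.map_apply (measurable_gevMap _) hs, expLaw_apply hm]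
  refine le_trans (le_of_eq ?_) (lintegral_mono_set Set.inter_subset_left :
    ∫⁻ x in s ∩ {x | 0 < 1 + γ₀ * ((x - 0) / 1)}, gevDensity θ x ≤ _)
  rw [lintegral_gevMap hσ₀ hs]
  refine lintegral_congr_ae ?_
  have hsub : volume.restrict (gevMap (γ₀, 0, 1) ⁻¹' s ∩ Set.Ioi 0) ≤
      volume.restrict (Set.Ioi (0 : ℝ)) := Measure.restrict_mono Set.inter_subset_right le_rfl
  filter_upwards [ae_mono hsub hbot', ae_mono hsub hDzero',
    ae_mono hsub (ae_restrict_mem measurableSet_Ioi)] with e hb hd he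
  rw [← hratio e he hb, hd]
  simp

/-! ### Strong law of large numbers for arrays with independent rows. -/

lemma integrable_pow_of_pow_four {Ω : Type*} [MeasurableSpace Ω] {P : Measure Ω}
    [IsProbabilityMeasure P] {f : Ω → ℝ} (hf : Measurable f)
    (h4 : Integrable (fun ω => f ω ^ 4) P) {k : ℕ} (hk : k ≤ 4) :
    Integrable (fun ω => f ω ^ k) P := by
  refine Integrable.mono' ((integrable_const (1 : ℝ)).add h4) (hf.pow_const k).aestronglyMeasurable
    (Eventually.of_forall fun ω => ?_)
  rw [norm_pow, Real.norm_eq_abs, Pi.add_apply]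
  have h5 : f ω ^ 4 = |f ω| ^ 4 := by rw [← abs_pow, abs_of_nonneg (by positivity)]
  rw [h5]
  rcases le_total |f ω| 1 with h | h
  · have := pow_le_one₀ (n := k) (abs_nonneg (f ω)) h
    have : 0 ≤ |f ω| ^ 4 := by positivity
    linarith
  · have := pow_le_pow_right₀ h hk
    linarith

/-- Fourth moments of sums of independent centered random variables. -/
lemma integral_sum_pow_four_le {Ω : Type*} [MeasurableSpace Ω] {P : Measure Ω}
    [IsProbabilityMeasure P] {Z : ℕ → Ω → ℝ} (hm : ∀ k, Measurable (Z k)) (hind : iIndepFun Z P)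
    (hi : ∀ k, Integrable (fun ω => Z k ω ^ 4) P) (h0 : ∀ k, ∫ ω, Z k ω ∂P = 0) {C : ℝ}
    (h2 : ∀ k, ∫ ω, Z k ω ^ 2 ∂P ≤ C) (h4 : ∀ k, ∫ ω, Z k ω ^ 4 ∂P ≤ C) (n : ℕ) :
    Integrable (fun ω => (∑ k ∈ Finset.range n, Z k ω) ^ 4) P ∧
    ∫ ω, ∑ k ∈ Finset.range n, Z k ω ∂P = 0 ∧
    ∫ ω, (∑ k ∈ Finset.range n, Z k ω) ^ 2 ∂P ≤ n * C ∧
    ∫ ω, (∑ k ∈ Finset.range n, Z k ω) ^ 4 ∂P ≤ n * C + 3 * n ^ 2 * C ^ 2 := by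
  have hC : 0 ≤ C := (integral_nonneg fun ω => by positivity).trans (h2 0)
  induction n with
  | zero => simp
  | succ n ih =>
    obtain ⟨hSi, hS0, hS2, hS4⟩ := ih
    set S : Ω → ℝ := fun ω => ∑ k ∈ Finset.range n, Z k ω with hS
    have hSm : Measurable S := Finset.measurable_fun_sum _ fun k _ => hm k
    have hindep : IndepFun S (Z n) P := by
      have := hind.indepFun_finsetSum_of_notMem hm (s := Finset.range n) (i := n) (by simp)
      convert this using 1
      ext ω
      simp [hS]
    have hpow : ∀ i j : ℕ, i ≤ 4 → j ≤ 4 → Integrable (fun ω => S ω ^ i * Z n ω ^ j) P ∧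
        ∫ ω, S ω ^ i * Z n ω ^ j ∂P = (∫ ω, S ω ^ i ∂P) * ∫ ω, Z n ω ^ j ∂P := by
      intro i j hi' hj
      have hc : IndepFun (fun ω => S ω ^ i) (fun ω => Z n ω ^ j) P :=
        hindep.comp (φ := fun x : ℝ => x ^ i) (ψ := fun x : ℝ => x ^ j)
          (measurable_id.pow_const i) (measurable_id.pow_const j)
      exact ⟨hc.integrable_mul (integrable_pow_of_pow_four hSm hSi hi')
        (integrable_pow_of_pow_four (hm n) (hi n) hj),
        hc.integral_fun_mul_eq_mul_integral (hSm.pow_const i).aestronglyMeasurable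
          ((hm n).pow_const j).aestronglyMeasurable⟩
    have hSint : Integrable S P := by
      simpa using integrable_pow_of_pow_four hSm hSi (k := 1) (by norm_num)
    have hZint : Integrable (Z n) P := by
      simpa using integrable_pow_of_pow_four (hm n) (hi n) (k := 1) (by norm_num)
    have hS2i := integrable_pow_of_pow_four hSm hSi (k := 2) (by norm_num)
    have hZ2i := integrable_pow_of_pow_four (hm n) (hi n) (k := 2) (by norm_num)
    obtain ⟨i31, e31⟩ := hpow 3 1 (by norm_num) (by norm_num)
    obtain ⟨i22, e22⟩ := hpow 2 2 (by norm_num) (by norm_num)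
    obtain ⟨i13, e13⟩ := hpow 1 3 (by norm_num) (by norm_num)
    obtain ⟨i11, e11⟩ := hpow 1 1 (by norm_num) (by norm_num)
    simp only [pow_one] at e31 e13 e11 i31 i13 i11
    rw [h0 n, mul_zero] at e31 e11
    rw [hS0, zero_mul] at e13
    have x2 : (fun ω => (S ω + Z n ω) ^ 2)
        = fun ω => S ω ^ 2 + 2 * (S ω * Z n ω) + Z n ω ^ 2 := by
      ext ω
      ring
    have x4 : (fun ω => (S ω + Z n ω) ^ 4)
        = fun ω => S ω ^ 4 + 4 * (S ω ^ 3 * Z n ω) + 6 * (S ω ^ 2 * Z n ω ^ 2)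
          + 4 * (S ω * Z n ω ^ 3) + Z n ω ^ 4 := by
      ext ω
      ring
    have a0 : Integrable (fun ω => S ω ^ 2 + 2 * (S ω * Z n ω)) P := hS2i.add (i11.const_mul 2)
    have a1 : Integrable (fun ω => S ω ^ 4 + 4 * (S ω ^ 3 * Z n ω)) P :=
      hSi.add (i31.const_mul 4)
    have a2 : Integrable (fun ω => S ω ^ 4 + 4 * (S ω ^ 3 * Z n ω)
        + 6 * (S ω ^ 2 * Z n ω ^ 2)) P := a1.add (i22.const_mul 6)
    have a3 : Integrable (fun ω => S ω ^ 4 + 4 * (S ω ^ 3 * Z n ω)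
        + 6 * (S ω ^ 2 * Z n ω ^ 2) + 4 * (S ω * Z n ω ^ 3)) P := a2.add (i13.const_mul 4)
    have hS4i : Integrable (fun ω => S ω ^ 4) P := hSi
    simp only [Finset.sum_range_succ]
    change Integrable (fun ω => (S ω + Z n ω) ^ 4) P ∧ ∫ ω, (S ω + Z n ω) ∂P = 0 ∧
      ∫ ω, (S ω + Z n ω) ^ 2 ∂P ≤ _ ∧ ∫ ω, (S ω + Z n ω) ^ 4 ∂P ≤ _
    refine ⟨?_, ?_, ?_, ?_⟩
    · rw [x4]
      exact a3.add (hi n)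
    · rw [integral_add hSint hZint, hS0, h0 n, add_zero]
    · rw [x2, integral_add a0 hZ2i, integral_add hS2i (i11.const_mul 2),
        integral_const_mul, e11]
      push_cast
      linarith [h2 n]
    · rw [x4, integral_add a3 (hi n), integral_add a2 (i13.const_mul 4),
        integral_add a1 (i22.const_mul 6), integral_add hS4i (i31.const_mul 4)]
      simp only [integral_const_mul]
      rw [e31, e13, e22]
      have h5 : (∫ ω, S ω ^ 2 ∂P) * ∫ ω, Z n ω ^ 2 ∂P ≤ n * C * C := by
        refine mul_le_mul hS2 (h2 n) (integral_nonneg fun ω => by positivity) (by positivity)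
      push_cast
      nlinarith [h4 n, sq_nonneg C]

/-- The Borel–Cantelli lemma for probabilities of order `n⁻²`. -/
lemma ae_eventually_notMem_of_le {Ω : Type*} [MeasurableSpace Ω] {P : Measure Ω}
    [IsProbabilityMeasure P] {s : ℕ → Set Ω} {c : ℝ}
    (h : ∀ᶠ n : ℕ in atTop, P.real (s n) ≤ c / (n : ℝ) ^ 2) :
    ∀ᵐ ω ∂P, ∀ᶠ n in atTop, ω ∉ s n := by
  obtain ⟨N, hN⟩ := eventually_atTop.1 h
  have hsum : Summable fun n : ℕ => c / ((n + N : ℕ) : ℝ) ^ 2 := by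
    have h1 : Summable fun n : ℕ => c / (n : ℝ) ^ 2 := by
      simpa [div_eq_mul_inv] using (Real.summable_nat_pow_inv.2 one_lt_two).mul_left c
    exact (summable_nat_add_iff N).2 h1
  have h2 : ∑' n, P (s (n + N)) ≠ ⊤ := by
    refine ne_top_of_le_ne_top hsum.tsum_ofReal_ne_top (ENNReal.tsum_le_tsum fun n => ?_)
    rw [← ofReal_measureReal]
    exact ENNReal.ofReal_le_ofReal (hN (n + N) (by omega))
  filter_upwards [ae_eventually_notMem h2] with ω hω
  obtain ⟨M, hM⟩ := eventually_atTop.1 hω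
  refine eventually_atTop.2 ⟨M + N, fun n hn => ?_⟩
  have := hM (n - N) (by omega)
  rwa [Nat.sub_add_cancel (by omega)] at this

/-- A strong law of large numbers for triangular arrays with rowwise independence and bounded
fourth moments. -/
theorem ae_tendsto_average_sub {Ω : Type*} [MeasurableSpace Ω] {P : Measure Ω}
    [IsProbabilityMeasure P] {Z : ℕ → ℕ → Ω → ℝ} (hm : ∀ n k, Measurable (Z n k))
    (hind : ∀ n, iIndepFun (Z n) P)
    {C : ℝ} (h4 : ∀ᶠ n in atTop, ∀ k, Integrable (fun ω => Z n k ω ^ 4) P ∧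
      ∫ ω, Z n k ω ^ 4 ∂P ≤ C) :
    ∀ᵐ ω ∂P, Tendsto (fun n : ℕ => (n : ℝ)⁻¹ * ∑ k ∈ Finset.range n, (Z n k ω - ∫ ω', Z n k ω' ∂P))
      atTop (𝓝 0) := by
  -- From `(z - e)⁴ ≤ 8 (z⁴ + e⁴)` with mean `|e| ≤ 1 + C`; the summand `1` lets `C'` also bound the
  -- second moments, by `y² ≤ 1 + y⁴`.
  set C' := 1 + 8 * (C + (1 + C) ^ 4) with hC'
  set Y : ℕ → ℕ → Ω → ℝ := fun n k ω => Z n k ω - ∫ ω', Z n k ω' ∂P with hY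
  have hYm : ∀ n k, Measurable (Y n k) := fun n k => (hm n k).sub_const _
  have hYind : ∀ n, iIndepFun (Y n) P := fun n =>
    (hind n).comp (fun k x => x - ∫ ω', Z n k ω' ∂P) fun k => measurable_id.sub_const _
  have key : ∀ᶠ n : ℕ in atTop, Integrable (fun ω => (∑ k ∈ Finset.range n, Y n k ω) ^ 4) P ∧
      ∫ ω, (∑ k ∈ Finset.range n, Y n k ω) ^ 4 ∂P ≤ n * C' + 3 * n ^ 2 * C' ^ 2 := by
    filter_upwards [h4] with n hn
    have hC0 : 0 ≤ C := (integral_nonneg fun ω => by positivity).trans (hn 0).2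
    have hZi : ∀ k, Integrable (Z n k) P := fun k => by
      simpa using integrable_pow_of_pow_four (hm n k) (hn k).1 (k := 1) (by norm_num)
    have hmean : ∀ k, |∫ ω, Z n k ω ∂P| ≤ 1 + C := by
      intro k
      refine (abs_integral_le_integral_abs).trans ?_
      have h1 : ∫ ω, |Z n k ω| ∂P ≤ ∫ ω, (1 + Z n k ω ^ 4) ∂P := by
        refine integral_mono (hZi k).abs ((integrable_const _).add (hn k).1) fun ω => ?_
        have h5 : Z n k ω ^ 4 = |Z n k ω| ^ 4 := by rw [← abs_pow, abs_of_nonneg (by positivity)]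
        simp only [h5]
        nlinarith [sq_nonneg (|Z n k ω| ^ 2 - 1), sq_nonneg (|Z n k ω| - 1)]
      rw [integral_add (integrable_const _) (hn k).1] at h1
      simp only [integral_const, probReal_univ, smul_eq_mul, mul_one] at h1
      linarith [(hn k).2]
    have hY4 : ∀ k ω, Y n k ω ^ 4 ≤ 8 * (Z n k ω ^ 4 + (1 + C) ^ 4) := by
      intro k ω
      set e := ∫ ω', Z n k ω' ∂P with he
      have h1 : e ^ 4 ≤ (1 + C) ^ 4 := by
        have h5 : e ^ 4 = |e| ^ 4 := by rw [← abs_pow, abs_of_nonneg (by positivity)]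
        rw [h5]
        exact pow_le_pow_left₀ (abs_nonneg _) (hmean k) 4
      have h2 : Y n k ω ^ 4 ≤ 8 * (Z n k ω ^ 4 + e ^ 4) := by
        simp only [hY]
        nlinarith [sq_nonneg (Z n k ω + e), sq_nonneg (Z n k ω ^ 2 - e ^ 2),
          sq_nonneg (Z n k ω * (Z n k ω + e)), sq_nonneg (e * (Z n k ω + e)),
          sq_nonneg ((Z n k ω + e) ^ 2), sq_nonneg ((Z n k ω - e) * (Z n k ω + e))]
      linarith
    have hdom : ∀ k, Integrable (fun ω => 8 * (Z n k ω ^ 4 + (1 + C) ^ 4)) P := fun k =>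
      ((hn k).1.add (integrable_const _)).const_mul 8
    have hYi : ∀ k, Integrable (fun ω => Y n k ω ^ 4) P := fun k =>
      (hdom k).mono' ((hYm n k).pow_const 4).aestronglyMeasurable (Eventually.of_forall fun ω => by
        rw [Real.norm_of_nonneg (by positivity)]
        exact hY4 k ω)
    have hY4' : ∀ k, ∫ ω, Y n k ω ^ 4 ∂P ≤ C' - 1 := by
      intro k
      refine (integral_mono (hYi k) (hdom k) (hY4 k)).trans ?_
      rw [integral_const_mul, integral_add (hn k).1 (integrable_const _)]
      simp only [integral_const, probReal_univ, smul_eq_mul, one_mul]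
      linarith [(hn k).2]
    have hY2' : ∀ k, ∫ ω, Y n k ω ^ 2 ∂P ≤ C' := by
      intro k
      have h1 : ∫ ω, Y n k ω ^ 2 ∂P ≤ ∫ ω, (1 + Y n k ω ^ 4) ∂P := by
        refine integral_mono (integrable_pow_of_pow_four (hYm n k) (hYi k) (by norm_num))
          ((integrable_const _).add (hYi k)) fun ω => ?_
        nlinarith [sq_nonneg (Y n k ω ^ 2 - 1)]
      rw [integral_add (integrable_const _) (hYi k)] at h1
      simp only [integral_const, probReal_univ, smul_eq_mul, mul_one] at h1
      linarith [hY4' k]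
    have hY0 : ∀ k, ∫ ω, Y n k ω ∂P = 0 := by
      intro k
      simp only [hY]
      rw [integral_sub (hZi k) (integrable_const _)]
      simp
    have := integral_sum_pow_four_le (hYm n) (hYind n) hYi hY0 hY2'
      (fun k => (hY4' k).trans (by linarith)) n
    exact ⟨this.1, this.2.2.2⟩
  -- Markov's inequality for fourth powers gives probabilities of order `n² / n⁴`, which are
  -- summable. Nothing relates different rows, so Borel–Cantelli is applied along all `n`, and the
  -- order `1 / n` given by second moments would not suffice.
  have hbc : ∀ j : ℕ, ∀ᵐ ω ∂P, ∀ᶠ n : ℕ in atTop,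
      ω ∉ {ω | ((n : ℝ) * (j + 1 : ℝ)⁻¹) ^ 4 ≤ (∑ k ∈ Finset.range n, Y n k ω) ^ 4} := by
    intro j
    refine ae_eventually_notMem_of_le (c := (|C'| + 3 * C' ^ 2) * (j + 1) ^ 4) ?_
    filter_upwards [key, eventually_ge_atTop 1] with n hn hn1
    have hn0 : (1 : ℝ) ≤ n := by exact_mod_cast hn1
    have h1 := mul_meas_ge_le_integral_of_nonneg (Eventually.of_forall fun ω => by positivity) hn.1
      (((n : ℝ) * (j + 1 : ℝ)⁻¹) ^ 4)
    have h2 : n * C' + 3 * n ^ 2 * C' ^ 2 ≤ (n : ℝ) ^ 2 * (|C'| + 3 * C' ^ 2) := by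
      have : n * C' ≤ n * |C'| := mul_le_mul_of_nonneg_left (le_abs_self _) (by positivity)
      nlinarith [abs_nonneg C', mul_nonneg (mul_nonneg (by linarith : (0 : ℝ) ≤ n)
        (abs_nonneg C')) (by linarith : (0 : ℝ) ≤ (n : ℝ) - 1)]
    rw [le_div_iff₀ (by positivity)]
    set p := P.real {ω | (n * (j + 1 : ℝ)⁻¹) ^ 4 ≤ (∑ k ∈ Finset.range n, Y n k ω) ^ 4} with hp
    have h3 := (h1.trans hn.2).trans h2
    rw [mul_pow, inv_pow] at h3
    have h4 : (n : ℝ) ^ 2 * (n ^ 2 * (((j : ℝ) + 1) ^ 4)⁻¹ * p)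
        ≤ (n : ℝ) ^ 2 * (|C'| + 3 * C' ^ 2) := by
      calc _ = (n : ℝ) ^ 4 * (((j : ℝ) + 1) ^ 4)⁻¹ * p := by ring
        _ ≤ _ := h3
    have h5 := le_of_mul_le_mul_left h4 (by positivity)
    have h6 : p * n ^ 2 = (n ^ 2 * (((j : ℝ) + 1) ^ 4)⁻¹ * p) * (j + 1) ^ 4 := by
      have : ((j : ℝ) + 1) ≠ 0 := by positivity
      field_simp
    rw [h6]
    exact mul_le_mul_of_nonneg_right h5 (by positivity)
  filter_upwards [ae_all_iff.2 hbc] with ω hω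
  rw [Metric.tendsto_atTop']
  intro ε hε
  obtain ⟨j, hj⟩ := exists_nat_one_div_lt hε
  obtain ⟨N, hN⟩ := eventually_atTop.1 (hω j)
  refine ⟨N, fun n hn => ?_⟩
  have h1 := hN n hn.le
  have hn0 : (0 : ℝ) < n := by
    have : 0 < n := by omega
    exact_mod_cast this
  simp only [not_le] at h1
  have h2 : |∑ k ∈ Finset.range n, Y n k ω| < (n : ℝ) * (j + 1 : ℝ)⁻¹ := by
    refine lt_of_pow_lt_pow_left₀ 4 (by positivity) ?_
    rwa [← abs_pow, abs_of_nonneg (by positivity)]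
  rw [dist_zero_right, Real.norm_eq_abs, abs_mul, abs_of_pos (inv_pos.2 hn0), inv_mul_lt_iff₀ hn0]
  refine h2.trans ?_
  rw [one_div] at hj
  exact mul_lt_mul_of_pos_left hj hn0

/-- Layer cake: at most `1` from levels below `1` and `∫₁^∞ t⁻² dt = 1` from the rest. -/
lemma integrable_of_tail_le {Ω : Type*} [MeasurableSpace Ω] {P : Measure Ω}
    [IsProbabilityMeasure P] {f : Ω → ℝ} (hf : Measurable f) (h0 : ∀ ω, 0 ≤ f ω)
    (ht : ∀ t : ℝ, 1 ≤ t → P.real {ω | t < f ω} ≤ (t ^ 2)⁻¹) :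
    Integrable f P ∧ ∫ ω, f ω ∂P ≤ 2 := by
  have hI : IntegrableOn (fun t : ℝ => t ^ (-2 : ℝ)) (Set.Ioi 1) :=
    integrableOn_Ioi_rpow_of_lt (by norm_num) one_pos
  have hle : ∫⁻ ω, ENNReal.ofReal (f ω) ∂P ≤ 2 := by
    rw [lintegral_eq_lintegral_meas_lt P (Eventually.of_forall h0) hf.aemeasurable,
      ← Set.Ioc_union_Ioi_eq_Ioi zero_le_one]
    refine (lintegral_union_le _ _ _).trans ?_
    have h1 : ∫⁻ t in Set.Ioc (0 : ℝ) 1, P {ω | t < f ω} ≤ 1 := by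
      refine (lintegral_mono fun t => prob_le_one).trans ?_
      simp
    have h2 : ∫⁻ t in Set.Ioi (1 : ℝ), P {ω | t < f ω} ≤ 1 := by
      have h3 : ∫⁻ t in Set.Ioi (1 : ℝ), P {ω | t < f ω}
          ≤ ∫⁻ t in Set.Ioi (1 : ℝ), ENNReal.ofReal (t ^ (-2 : ℝ)) := by
        refine setLIntegral_mono' measurableSet_Ioi fun t h => ?_
        rw [← ofReal_measureReal]
        refine ENNReal.ofReal_le_ofReal ((ht t (le_of_lt h)).trans (le_of_eq ?_))
        rw [Real.rpow_neg (zero_le_one.trans (le_of_lt h))]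
        norm_cast
      refine h3.trans ?_
      rw [← ofReal_integral_eq_lintegral_ofReal hI, integral_Ioi_rpow_of_lt (by norm_num) one_pos]
      · norm_num
      · filter_upwards [ae_restrict_mem measurableSet_Ioi] with t h
        exact Real.rpow_nonneg (zero_le_one.trans (le_of_lt h)) _
    calc _ ≤ (1 : ENNReal) + 1 := add_le_add h1 h2
      _ = 2 := by norm_num
  have hi : Integrable f P := by
    refine ⟨hf.aestronglyMeasurable, ?_⟩
    rw [hasFiniteIntegral_iff_ofReal (Eventually.of_forall h0)]
    exact hle.trans_lt (by simp)
  refine ⟨hi, ?_⟩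
  rw [integral_eq_lintegral_of_nonneg_ae (Eventually.of_forall h0) hi.1]
  exact ENNReal.toReal_le_of_le_ofReal zero_le_two (by simpa using hle)

/-- Averages of rowwise independent arrays with uniformly small tails are bounded. -/
theorem ae_exists_average_le {Ω : Type*} [MeasurableSpace Ω] {P : Measure Ω}
    [IsProbabilityMeasure P] {W : ℕ → ℕ → Ω → ℝ} (hm : ∀ n k, Measurable (W n k))
    (hind : ∀ n, iIndepFun (W n) P) (h0 : ∀ n k ω, 0 ≤ W n k ω)
    (ht : ∀ᶠ n in atTop, ∀ k, ∀ t : ℝ, 1 ≤ t → P.real {ω | t < W n k ω} ≤ (t ^ 8)⁻¹) :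
    ∀ᵐ ω ∂P, ∃ C : ℝ, ∀ᶠ n : ℕ in atTop, (n : ℝ)⁻¹ * ∑ k ∈ Finset.range n, W n k ω ≤ C := by
  have h4 : ∀ᶠ n in atTop, ∀ k, Integrable (fun ω => W n k ω ^ 4) P ∧
      ∫ ω, W n k ω ^ 4 ∂P ≤ 2 := by
    filter_upwards [ht] with n hn k
    refine integrable_of_tail_le ((hm n k).pow_const 4) (fun ω => pow_nonneg (h0 n k ω) 4) ?_
    intro t ht1
    have ht0 : 0 ≤ t := by linarith
    have h1 := hn k (t ^ (1 / 4 : ℝ)) (Real.one_le_rpow ht1 (by norm_num))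
    have h2 : (t ^ (1 / 4 : ℝ)) ^ 8 = t ^ 2 := by
      rw [← Real.rpow_mul_natCast ht0]
      norm_num
    rw [h2] at h1
    refine le_trans (le_of_eq ?_) h1
    congr 1
    ext ω
    have h3 : (t ^ (1 / 4 : ℝ)) ^ 4 = t := by
      rw [← Real.rpow_mul_natCast ht0]
      norm_num
    change t < W n k ω ^ 4 ↔ t ^ (1 / 4 : ℝ) < W n k ω
    nth_rewrite 1 [← h3]
    exact pow_lt_pow_iff_left₀ (Real.rpow_nonneg ht0 _) (h0 n k ω) (by norm_num)
  have hmean : ∀ᶠ n in atTop, ∀ k, ∫ ω, W n k ω ∂P ≤ 3 := by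
    filter_upwards [h4] with n hn k
    have hi := integrable_pow_of_pow_four (hm n k) (hn k).1 (k := 1) (by norm_num)
    simp only [pow_one] at hi
    have h1 : ∫ ω, W n k ω ∂P ≤ ∫ ω, (1 + W n k ω ^ 4) ∂P := by
      refine integral_mono hi ((integrable_const _).add (hn k).1) fun ω => ?_
      simp only
      nlinarith [sq_nonneg (W n k ω ^ 2 - 1), sq_nonneg (W n k ω - 1)]
    rw [integral_add (integrable_const _) (hn k).1] at h1
    simp only [integral_const, probReal_univ, smul_eq_mul, mul_one] at h1
    linarith [(hn k).2]
  filter_upwards [ae_tendsto_average_sub hm hind h4] with ω hω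
  -- Row means are at most `1 + 2`, and the deviation from them is eventually below `1`.
  refine ⟨4, ?_⟩
  filter_upwards [hω.eventually (gt_mem_nhds one_pos), hmean, eventually_ge_atTop 1]
    with n h1 h2 h3
  have hn0 : (0 : ℝ) < n := by exact_mod_cast h3
  rw [inv_mul_lt_iff₀ hn0, Finset.sum_sub_distrib] at h1
  have h5 : ∑ k ∈ Finset.range n, ∫ ω', W n k ω' ∂P ≤ n * 3 := by
    refine (Finset.sum_le_sum fun k _ => h2 k).trans (le_of_eq ?_)
    simp
  rw [inv_mul_le_iff₀ hn0]
  linarith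

/-! ### Block maxima: independence, tails, and the growth condition on the block length. -/

lemma measurable_blockMax {Ω : Type*} [MeasurableSpace Ω] {X : ℕ → Ω → ℝ}
    (hm : ∀ i, Measurable (X i)) (m k : ℕ) : Measurable (blockMax X m k) :=
  Measurable.iSup fun _ => hm _

/-- The pairs `(k, j)` with `j < m` index distinct observations; currying the product law of all of
them yields independence of the blocks as vectors, hence of their maxima. -/
lemma iIndepFun_blockMax {Ω : Type*} [MeasurableSpace Ω] {P : Measure Ω}
    [IsProbabilityMeasure P] {X : ℕ → Ω → ℝ} (hm : ∀ i, Measurable (X i))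
    (hind : iIndepFun X P) (m : ℕ) : iIndepFun (blockMax X m) P := by
  have he : Function.Injective fun p : ℕ × Fin m => p.1 * m + (p.2 : ℕ) := by
    rintro ⟨k, j⟩ ⟨k', j'⟩ h
    simp only at h
    have hm0 : 0 < m := j.pos
    have h1 : k = k' := by
      have := congrArg (· / m) h
      simpa [Nat.div_eq_of_lt j.2, Nat.div_eq_of_lt j'.2, mul_comm _ m, Nat.mul_add_div hm0] using this
    subst h1
    have h2 : j = j' := Fin.ext (by omega)
    rw [h2]
  have : ∀ i, IsProbabilityMeasure (P.map (X i)) :=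
    fun i => Measure.isProbabilityMeasure_map (hm i).aemeasurable
  have h1 := hind.precomp he
  have h2 := (iIndepFun_iff_map_fun_eq_infinitePi_map (fun p => hm _)).1 h1
  have hrow : ∀ k, P.map (fun ω (j : Fin m) => X (k * m + j) ω)
      = Measure.infinitePi fun j : Fin m => P.map (X (k * m + j)) := by
    intro k
    have he' : Function.Injective fun j : Fin m => k * m + (j : ℕ) := fun j j' h =>
      Fin.ext (by simpa using h)
    exact (iIndepFun_iff_map_fun_eq_infinitePi_map (fun p => hm _)).1 (hind.precomp he')
  have h3 : iIndepFun (fun k ω (j : Fin m) => X (k * m + j) ω) P := by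
    rw [iIndepFun_iff_map_fun_eq_infinitePi_map
      (fun k => measurable_pi_iff.2 fun j => hm _)]
    simp only [hrow]
    rw [← Measure.infinitePi_map_curry (fun k (j : Fin m) => P.map (X (k * m + j))), ← h2,
      Measure.map_map (by fun_prop) (measurable_pi_iff.2 fun p => hm _)]
    rfl
  exact h3.comp (fun _ f => ⨆ j, f j) fun _ => Measurable.iSup fun j => measurable_pi_apply j

lemma blockMax_le_iff {Ω : Type*} {X : ℕ → Ω → ℝ} {m : ℕ} (hm : 1 ≤ m) (k : ℕ) (ω : Ω) (x : ℝ) :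
    blockMax X m k ω ≤ x ↔ ∀ j : Fin m, X (k * m + j) ω ≤ x := by
  have : Nonempty (Fin m) := ⟨⟨0, hm⟩⟩
  exact ciSup_le_iff (Set.finite_range _).bddAbove

lemma exists_eq_blockMax {Ω : Type*} {X : ℕ → Ω → ℝ} {m : ℕ} (hm : 1 ≤ m) (k : ℕ) (ω : Ω) :
    ∃ j : Fin m, X (k * m + j) ω = blockMax X m k ω := by
  have : Nonempty (Fin m) := ⟨⟨0, hm⟩⟩
  exact exists_eq_ciSup_of_finite

lemma measureReal_forall_block {Ω : Type*} [MeasurableSpace Ω] {P : Measure Ω}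
    [IsProbabilityMeasure P] {X : ℕ → Ω → ℝ} (hind : iIndepFun X P) {D : Set ℝ}
    (hD : MeasurableSet D) {p : ℝ} (hp : ∀ i, P.real (X i ⁻¹' D) = p) (m k : ℕ) :
    P.real {ω | ∀ j : Fin m, X (k * m + j) ω ∈ D} = p ^ m := by
  have h1 : {ω | ∀ j : Fin m, X (k * m + j) ω ∈ D}
      = ⋂ j ∈ (Finset.univ : Finset (Fin m)), X (k * m + j) ⁻¹' D := by
    ext ω
    simp
  have he' : Function.Injective fun j : Fin m => k * m + (j : ℕ) := fun j j' h =>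
    Fin.ext (by simpa using h)
  have h2 := (hind.precomp he').measure_inter_preimage_eq_mul Finset.univ
    (sets := fun _ => D) (fun _ _ => hD)
  rw [h1, Measure.real, h2, ENNReal.toReal_prod]
  have h3 : ∀ j : Fin m, (P (X (k * m + j) ⁻¹' D)).toReal = p := fun j => hp _
  simp [h3]

/-- `P(F(X) < p) ≤ p` for an arbitrary law. By inner regularity a compact subset suffices; it
contains its supremum, so it lies in a half-line of mass below `p`. No case distinction on atoms
arises. -/
lemma measure_setOf_Iic_lt_le (μ : Measure ℝ) [IsProbabilityMeasure μ] {p : ℝ} (hp : 0 ≤ p) :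
    μ.real {x | μ.real (Set.Iic x) < p} ≤ p := by
  have hmono : Monotone fun x => μ.real (Set.Iic x) := fun x y hxy =>
    measureReal_mono (Set.Iic_subset_Iic.2 hxy)
  have hmeas : MeasurableSet {x | μ.real (Set.Iic x) < p} :=
    measurableSet_lt hmono.measurable measurable_const
  refine ENNReal.toReal_le_of_le_ofReal hp ?_
  rw [hmeas.measure_eq_iSup_isCompact]
  refine iSup_le fun K => iSup_le fun hK => iSup_le fun hKc => ?_
  rcases K.eq_empty_or_nonempty with rfl | hne
  · simp
  have h1 : μ.real (Set.Iic (sSup K)) < p := hK (hKc.sSup_mem hne)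
  have hsub : K ⊆ Set.Iic (sSup K) := fun x hx => le_csSup hKc.bddAbove hx
  refine (measure_mono hsub).trans ?_
  rw [← ofReal_measureReal]
  exact ENNReal.ofReal_le_ofReal h1.le

lemma measure_setOf_Ici_lt_le (μ : Measure ℝ) [IsProbabilityMeasure μ] {p : ℝ} (hp : 0 ≤ p) :
    μ.real {x | μ.real (Set.Ici x) < p} ≤ p := by
  have hmono : Antitone fun x => μ.real (Set.Ici x) := fun x y hxy =>
    measureReal_mono (Set.Ici_subset_Ici.2 hxy)
  have hmeas : MeasurableSet {x | μ.real (Set.Ici x) < p} :=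
    measurableSet_lt hmono.measurable measurable_const
  refine ENNReal.toReal_le_of_le_ofReal hp ?_
  rw [hmeas.measure_eq_iSup_isCompact]
  refine iSup_le fun K => iSup_le fun hK => iSup_le fun hKc => ?_
  rcases K.eq_empty_or_nonempty with rfl | hne
  · simp
  have h1 : μ.real (Set.Ici (sInf K)) < p := hK (hKc.sInf_mem hne)
  have hsub : K ⊆ Set.Ici (sInf K) := fun x hx => csInf_le hKc.bddBelow hx
  refine (measure_mono hsub).trans ?_
  rw [← ofReal_measureReal]
  exact ENNReal.ofReal_le_ofReal h1.le

lemma isDistributionFunction_of_cdf {Ω : Type*} [MeasurableSpace Ω] {P : Measure Ω}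
    [IsProbabilityMeasure P] {X : Ω → ℝ} (hm : Measurable X) {F : ℝ → ℝ}
    (hcdf : ∀ x, P.real {ω | X ω ≤ x} = F x) : IsDistributionFunction F := by
  have := Measure.isProbabilityMeasure_map (μ := P) hm.aemeasurable
  have h : F = cdf (P.map X) := by
    ext x
    rw [cdf_eq_real, map_measureReal_apply hm measurableSet_Iic, ← hcdf x]
    rfl
  rw [h]
  exact ⟨monotone_cdf _, tendsto_cdf_atBot _, tendsto_cdf_atTop _⟩

lemma map_eq_map_zero {Ω : Type*} [MeasurableSpace Ω] {P : Measure Ω}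
    [IsProbabilityMeasure P] {X : ℕ → Ω → ℝ} (hm : ∀ i, Measurable (X i)) {F : ℝ → ℝ}
    (hcdf : ∀ i x, P.real {ω | X i ω ≤ x} = F x) (i : ℕ) : P.map (X i) = P.map (X 0) := by
  have := Measure.isProbabilityMeasure_map (μ := P) (hm i).aemeasurable
  refine Measure.ext_of_Iic _ _ fun x => ?_
  rw [Measure.map_apply (hm i) measurableSet_Iic, Measure.map_apply (hm 0) measurableSet_Iic,
    ← ofReal_measureReal, ← ofReal_measureReal]
  congr 1
  exact (hcdf i x).trans (hcdf 0 x).symm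

lemma measureReal_preimage_eq {Ω : Type*} [MeasurableSpace Ω] {P : Measure Ω}
    [IsProbabilityMeasure P] {X : ℕ → Ω → ℝ} (hm : ∀ i, Measurable (X i)) {F : ℝ → ℝ}
    (hcdf : ∀ i x, P.real {ω | X i ω ≤ x} = F x) {D : Set ℝ} (hD : MeasurableSet D) (i : ℕ) :
    P.real (X i ⁻¹' D) = (P.map (X 0)).real D := by
  rw [← map_eq_map_zero hm hcdf i, map_measureReal_apply (hm i) hD]

lemma map_real_Iic {Ω : Type*} [MeasurableSpace Ω] {P : Measure Ω}
    [IsProbabilityMeasure P] {X : ℕ → Ω → ℝ} (hm : ∀ i, Measurable (X i)) {F : ℝ → ℝ}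
    (hcdf : ∀ i x, P.real {ω | X i ω ≤ x} = F x) (x : ℝ) :
    (P.map (X 0)).real (Set.Iic x) = F x := by
  rw [map_measureReal_apply (hm 0) measurableSet_Iic, ← hcdf 0 x]
  rfl

lemma measureReal_blockMax_le {Ω : Type*} [MeasurableSpace Ω] {P : Measure Ω}
    [IsProbabilityMeasure P] {X : ℕ → Ω → ℝ} (hind : iIndepFun X P) {F : ℝ → ℝ}
    (hcdf : ∀ i x, P.real {ω | X i ω ≤ x} = F x) {m : ℕ} (h1 : 1 ≤ m) (k : ℕ) (x : ℝ) :
    P.real {ω | blockMax X m k ω ≤ x} = F x ^ m := by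
  rw [← measureReal_forall_block hind measurableSet_Iic (fun i => hcdf i x) m k]
  congr 1
  ext ω
  exact blockMax_le_iff h1 k ω x

lemma measureReal_cdf_blockMax_lt_le {Ω : Type*} [MeasurableSpace Ω] {P : Measure Ω}
    [IsProbabilityMeasure P] {X : ℕ → Ω → ℝ} (hm : ∀ i, Measurable (X i)) (hind : iIndepFun X P)
    {F : ℝ → ℝ} (hcdf : ∀ i x, P.real {ω | X i ω ≤ x} = F x) {m : ℕ} (h1 : 1 ≤ m) (k : ℕ)
    (p : ℝ) :
    P.real {ω | F (blockMax X m k ω) < p} ≤ (max p 0) ^ m := by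
  have hF := isDistributionFunction_of_cdf (hm 0) (hcdf 0)
  have := Measure.isProbabilityMeasure_map (μ := P) (hm 0).aemeasurable
  set D : Set ℝ := {x | (P.map (X 0)).real (Set.Iic x) < max p 0} with hD
  have hDm : MeasurableSet D := by
    simp only [hD, map_real_Iic hm hcdf]
    exact measurableSet_lt hF.mono.measurable measurable_const
  have hsub : {ω | F (blockMax X m k ω) < p} ⊆ {ω | ∀ j : Fin m, X (k * m + j) ω ∈ D} := by
    intro ω hω j
    have hω' : F (blockMax X m k ω) < p := hω
    change (P.map (X 0)).real (Set.Iic (X (k * m + j) ω)) < max p 0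
    rw [map_real_Iic hm hcdf]
    refine (hF.mono ((blockMax_le_iff h1 k ω _).1 le_rfl j)).trans_lt (lt_max_of_lt_left hω')
  refine (measureReal_mono hsub).trans ?_
  rw [measureReal_forall_block hind hDm (fun i => measureReal_preimage_eq hm hcdf hDm i) m k]
  exact pow_le_pow_left₀ measureReal_nonneg (measure_setOf_Iic_lt_le _ (le_max_right _ _)) m

/-- `m (1 - F(M))` has tails at most `e^(-s)`, as `(1 - s/m)^m ≤ e^(-s)`. The divisor `8` produces
the tail `t⁻⁸` required by `ae_exists_average_le`. -/
lemma measureReal_lt_exp_blockMax_le {Ω : Type*} [MeasurableSpace Ω] {P : Measure Ω}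
    [IsProbabilityMeasure P] {X : ℕ → Ω → ℝ} (hm : ∀ i, Measurable (X i)) (hind : iIndepFun X P)
    {F : ℝ → ℝ} (hcdf : ∀ i x, P.real {ω | X i ω ≤ x} = F x) {m : ℕ} (h1 : 1 ≤ m) (k : ℕ)
    {t : ℝ} (ht : 1 ≤ t) :
    P.real {ω | t < Real.exp (m * (1 - F (blockMax X m k ω)) / 8)} ≤ (t ^ 8)⁻¹ := by
  have hm0 : (0 : ℝ) < m := by exact_mod_cast h1
  have ht0 : 0 < t := by linarith
  have hset : {ω | t < Real.exp (m * (1 - F (blockMax X m k ω)) / 8)}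
      = {ω | F (blockMax X m k ω) < 1 - 8 * Real.log t / m} := by
    ext ω
    change t < Real.exp (m * (1 - F (blockMax X m k ω)) / 8) ↔
      F (blockMax X m k ω) < 1 - 8 * Real.log t / m
    rw [← Real.log_lt_iff_lt_exp ht0, lt_sub_comm, div_lt_iff₀ hm0]
    constructor <;> intro h <;> linarith
  rw [hset]
  refine (measureReal_cdf_blockMax_lt_le hm hind hcdf h1 k _).trans ?_
  have h2 : max (1 - 8 * Real.log t / m) 0 ≤ Real.exp (-(8 * Real.log t / m)) := by
    refine max_le ?_ (Real.exp_pos _).le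
    linarith [Real.add_one_le_exp (-(8 * Real.log t / m))]
  refine (pow_le_pow_left₀ (le_max_right _ _) h2 m).trans (le_of_eq ?_)
  rw [← Real.exp_nat_mul, mul_neg, mul_div_cancel₀ _ hm0.ne', Real.exp_neg]
  congr 1
  have h3 : 8 * Real.log t = Real.log (t ^ 8) := by
    rw [Real.log_pow]
    norm_num
  rw [h3, Real.exp_log (by positivity)]

lemma measureReal_tail_lt_le {Ω : Type*} [MeasurableSpace Ω] {P : Measure Ω}
    [IsProbabilityMeasure P] {X : ℕ → Ω → ℝ} (hm : ∀ i, Measurable (X i))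
    {F : ℝ → ℝ} (hcdf : ∀ i x, P.real {ω | X i ω ≤ x} = F x) {p : ℝ} (hp : 0 ≤ p) (i : ℕ) :
    P.real {ω | (P.map (X 0)).real (Set.Ici (X i ω)) < p} ≤ p := by
  have := Measure.isProbabilityMeasure_map (μ := P) (hm 0).aemeasurable
  have hmono : Antitone fun x => (P.map (X 0)).real (Set.Ici x) := fun x y hxy =>
    measureReal_mono (Set.Ici_subset_Ici.2 hxy)
  have hmeas : MeasurableSet {x | (P.map (X 0)).real (Set.Ici x) < p} :=
    measurableSet_lt hmono.measurable measurable_const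
  exact (measureReal_preimage_eq hm hcdf hmeas i).le.trans (measure_setOf_Ici_lt_le _ hp)

/-- A union bound over the block: some observation must have tail probability below `t⁻⁸ / m`. The
closed tail `P(X ≥ x)` is used because `1 - F(M)` can vanish with positive probability when the
right endpoint is an atom. -/
lemma measureReal_lt_rpow_blockMax_le {Ω : Type*} [MeasurableSpace Ω] {P : Measure Ω}
    [IsProbabilityMeasure P] {X : ℕ → Ω → ℝ} (hm : ∀ i, Measurable (X i))
    {F : ℝ → ℝ} (hcdf : ∀ i x, P.real {ω | X i ω ≤ x} = F x) {m : ℕ} (h1 : 1 ≤ m) (k : ℕ)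
    {t : ℝ} (ht : 1 ≤ t) :
    P.real {ω | t < (m * (P.map (X 0)).real (Set.Ici (blockMax X m k ω))) ^ (-(1 / 8) : ℝ)}
      ≤ (t ^ 8)⁻¹ := by
  have hm0 : (0 : ℝ) < m := by exact_mod_cast h1
  have ht0 : 0 < t := by linarith
  set p := (t ^ 8)⁻¹ / m with hp
  have hp0 : 0 ≤ p := by positivity
  have hsub : {ω | t < (m * (P.map (X 0)).real (Set.Ici (blockMax X m k ω))) ^ (-(1 / 8) : ℝ)}
      ⊆ ⋃ j : Fin m, {ω | (P.map (X 0)).real (Set.Ici (X (k * m + j) ω)) < p} := by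
    intro ω hω
    obtain ⟨j, hj⟩ := exists_eq_blockMax (X := X) h1 k ω
    refine Set.mem_iUnion.2 ⟨j, ?_⟩
    change (P.map (X 0)).real (Set.Ici (X (k * m + j) ω)) < p
    have hω' : t < (m * (P.map (X 0)).real (Set.Ici (blockMax X m k ω))) ^ (-(1 / 8) : ℝ) := hω
    rw [hj]
    set v := (m : ℝ) * (P.map (X 0)).real (Set.Ici (blockMax X m k ω)) with hv
    have hv0 : 0 ≤ v := mul_nonneg hm0.le measureReal_nonneg
    -- If the tail vanishes, the negative power has the default value `0` and does not exceed `t`.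
    -- That this case is null is the content of `ae_tail_pos`.
    rcases hv0.eq_or_lt with h0 | h0
    · rw [← h0, Real.zero_rpow (by norm_num)] at hω'
      linarith
    · rw [hp, lt_div_iff₀ hm0, mul_comm, ← hv]
      rw [Real.rpow_neg hv0] at hω'
      have h2 : v ^ (1 / 8 : ℝ) < t⁻¹ := by
        rwa [lt_inv_comm₀ (by positivity) ht0]
      have h3 := pow_lt_pow_left₀ h2 (by positivity) (n := 8) (by norm_num)
      rw [← Real.rpow_mul_natCast hv0, inv_pow] at h3
      norm_num at h3
      simpa using h3
  refine (measureReal_mono hsub).trans ((measureReal_iUnion_fintype_le _).trans ?_)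
  refine (Finset.sum_le_sum fun j _ => measureReal_tail_lt_le hm hcdf hp0 _).trans (le_of_eq ?_)
  rw [Finset.sum_const, Finset.card_univ, Fintype.card_fin, nsmul_eq_mul, hp]
  field_simp

lemma ae_tail_pos {Ω : Type*} [MeasurableSpace Ω] {P : Measure Ω}
    [IsProbabilityMeasure P] {X : ℕ → Ω → ℝ} (hm : ∀ i, Measurable (X i))
    {F : ℝ → ℝ} (hcdf : ∀ i x, P.real {ω | X i ω ≤ x} = F x) :
    ∀ᵐ ω ∂P, ∀ i, 0 < (P.map (X 0)).real (Set.Ici (X i ω)) := by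
  refine ae_all_iff.2 fun i => ?_
  have h1 : ∀ p : ℝ, 0 < p →
      P.real {ω | ¬ 0 < (P.map (X 0)).real (Set.Ici (X i ω))} ≤ p := fun p hp => by
    refine le_trans (measureReal_mono fun ω hω => ?_) (measureReal_tail_lt_le hm hcdf hp.le i)
    have : ¬ 0 < (P.map (X 0)).real (Set.Ici (X i ω)) := hω
    change (P.map (X 0)).real (Set.Ici (X i ω)) < p
    linarith
  have h2 : P.real {ω | ¬ 0 < (P.map (X 0)).real (Set.Ici (X i ω))} = 0 :=
    le_antisymm (le_of_forall_pos_le_add fun ε hε => by simpa using h1 ε hε) measureReal_nonneg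
  rw [ae_iff]
  exact (measureReal_eq_zero_iff).1 h2

lemma tendsto_of_tendsto_div_log {m : ℕ → ℕ}
    (hm : Tendsto (fun n : ℕ => (m n : ℝ) / Real.log n) atTop atTop) : Tendsto m atTop atTop := by
  refine tendsto_natCast_atTop_iff (R := ℝ).1 (tendsto_atTop_mono' _ ?_ hm)
  have hlog := (Real.tendsto_log_atTop.comp tendsto_natCast_atTop_atTop).eventually_ge_atTop 1
  filter_upwards [hlog] with n hn
  exact div_le_self (Nat.cast_nonneg _) hn

/-- Almost surely, the first `n` block maxima eventually exceed any level below the right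
endpoint. -/
lemma ae_eventually_blockMax_ge {Ω : Type*} [MeasurableSpace Ω] {P : Measure Ω}
    [IsProbabilityMeasure P] {X : ℕ → Ω → ℝ} (hm : ∀ i, Measurable (X i)) (hind : iIndepFun X P)
    {F : ℝ → ℝ} (hcdf : ∀ i x, P.real {ω | X i ω ≤ x} = F x) {m : ℕ → ℕ}
    (hmn : Tendsto (fun n : ℕ => (m n : ℝ) / Real.log n) atTop atTop) {t : ℝ} (ht : 1 < t) :
    ∀ᵐ ω ∂P, ∀ᶠ n in atTop, ∀ k < n, t * (1 - F (blockMax X (m n) k ω)) ≤ 1 := by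
  have hlog := (Real.tendsto_log_atTop.comp tendsto_natCast_atTop_atTop).eventually_gt_atTop 0
  have ht0 : 0 < t := by linarith
  have hp0 : 0 ≤ 1 - t⁻¹ := by
    have := inv_lt_one_of_one_lt₀ ht
    linarith
  -- Union bound over `n` blocks, each failing with probability at most `(1 - 1/t)^m ≤ e^(-m/t) ≤
  -- n⁻³` once `m ≥ 3 t log n`. Elsewhere only `m → ∞` is used.
  have key : ∀ᶠ n : ℕ in atTop,
      P.real (⋃ k : Fin n, {ω | F (blockMax X (m n) k ω) < 1 - t⁻¹}) ≤ 1 / (n : ℝ) ^ 2 := by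
    filter_upwards [hlog, hmn.eventually_ge_atTop (3 * t),
      (tendsto_of_tendsto_div_log hmn).eventually_ge_atTop 1, eventually_ge_atTop 1]
      with n h1 h2 h3 h4
    have hn0 : (0 : ℝ) < n := by exact_mod_cast h4
    simp only [Function.comp] at h1
    rw [le_div_iff₀ h1] at h2
    have h5 : (max (1 - t⁻¹) 0) ^ m n ≤ ((n : ℝ) ^ 3)⁻¹ := by
      rw [max_eq_left hp0]
      have h6 : 1 - t⁻¹ ≤ Real.exp (-t⁻¹) := by linarith [Real.add_one_le_exp (-t⁻¹)]
      refine (pow_le_pow_left₀ hp0 h6 _).trans ?_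
      rw [← Real.exp_nat_mul, ← Real.exp_log (show 0 < ((n : ℝ) ^ 3)⁻¹ by positivity),
        Real.log_inv, Real.log_pow]
      refine Real.exp_le_exp.2 ?_
      rw [mul_neg, neg_le_neg_iff, ← div_eq_mul_inv, le_div_iff₀ ht0]
      push_cast
      linarith
    refine (measureReal_iUnion_fintype_le _).trans ?_
    refine (Finset.sum_le_sum fun (k : Fin n) _ =>
      (measureReal_cdf_blockMax_lt_le hm hind hcdf h3 (k : ℕ) (1 - t⁻¹)).trans h5).trans
      (le_of_eq ?_)
    rw [Finset.sum_const, Finset.card_univ, Fintype.card_fin, nsmul_eq_mul]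
    field_simp
  filter_upwards [ae_eventually_notMem_of_le key] with ω hω
  filter_upwards [hω] with n hn k hk
  by_contra! h
  refine hn (Set.mem_iUnion.2 ⟨⟨k, hk⟩, ?_⟩)
  change F (blockMax X (m n) k ω) < 1 - t⁻¹
  have : t⁻¹ < 1 - F (blockMax X (m n) k ω) := by
    rwa [inv_lt_iff_one_lt_mul₀' ht0]
  linarith

/-! ### Weak convergence of the empirical laws. -/

/-- The empirical law of `y 0, …, y (n - 1)` (with an arbitrary value if `n = 0`). -/
def empiricalLaw (y : ℕ → ℝ) (n : ℕ) : Measure ℝ :=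
  if n = 0 then Measure.dirac 0
  else (n : ENNReal)⁻¹ • ∑ k ∈ Finset.range n, Measure.dirac (y k)

instance isProbabilityMeasure_empiricalLaw (y : ℕ → ℝ) (n : ℕ) :
    IsProbabilityMeasure (empiricalLaw y n) := by
  unfold empiricalLaw
  split_ifs with h
  · infer_instance
  · constructor
    simp only [Measure.smul_apply, Measure.finsetSum_apply, smul_eq_mul, measure_univ,
      Finset.sum_const, Finset.card_range, nsmul_eq_mul, mul_one]
    exact ENNReal.inv_mul_cancel (by simpa using h) (by simp)

/-- The empirical law as a bundled probability measure. -/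
def empiricalProba (y : ℕ → ℝ) (n : ℕ) : ProbabilityMeasure ℝ :=
  ⟨empiricalLaw y n, isProbabilityMeasure_empiricalLaw y n⟩

lemma integral_empiricalLaw (y : ℕ → ℝ) {n : ℕ} (hn : n ≠ 0) (f : ℝ → ℝ) :
    ∫ x, f x ∂(empiricalLaw y n) = (n : ℝ)⁻¹ * ∑ k ∈ Finset.range n, f (y k) := by
  rw [empiricalLaw, if_neg hn, integral_smul_measure,
    integral_finsetSum_measure fun k _ => integrable_dirac (by simp)]
  simp

lemma empiricalLaw_real_Iic (y : ℕ → ℝ) {n : ℕ} (hn : n ≠ 0) (x : ℝ) :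
    (empiricalLaw y n).real (Set.Iic x)
      = (n : ℝ)⁻¹ * ∑ k ∈ Finset.range n, (Set.Iic x).indicator 1 (y k) := by
  rw [← integral_empiricalLaw y hn, integral_indicator_one measurableSet_Iic]

/-- Convergence of distribution functions at rational points implies weak convergence. -/
lemma tendsto_probabilityMeasure_of_cdf {ι : Type*} {l : Filter ι} [l.IsCountablyGenerated]
    {μ : ι → ProbabilityMeasure ℝ} {ν : ProbabilityMeasure ℝ}
    (h : ∀ q : ℚ, Tendsto (fun i => (μ i : Measure ℝ).real (Set.Iic (q : ℝ))) l
      (𝓝 ((ν : Measure ℝ).real (Set.Iic (q : ℝ))))) : Tendsto μ l (𝓝 ν) := by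
  have hS : IsPiSystem {s : Set ℝ | ∃ p q : ℚ, s = Set.Ioc (p : ℝ) q} := by
    rintro _ ⟨p, q, rfl⟩ _ ⟨p', q', rfl⟩ -
    exact ⟨max p p', min q q', by rw [Set.Ioc_inter_Ioc]; push_cast; rfl⟩
  refine hS.tendsto_probabilityMeasure_of_tendsto_of_mem ?_ ?_ ?_
  · rintro _ ⟨p, q, rfl⟩
    exact measurableSet_Ioc
  · intro u hu x hx
    obtain ⟨a, b, hab, hsub⟩ := mem_nhds_iff_exists_Ioo_subset.1 (hu.mem_nhds hx)
    obtain ⟨p, hp1, hp2⟩ := exists_rat_btwn hab.1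
    obtain ⟨q, hq1, hq2⟩ := exists_rat_btwn hab.2
    exact ⟨Set.Ioc p q, ⟨p, q, rfl⟩, Ioc_mem_nhds hp2 hq1,
      fun z hz => hsub ⟨hp1.trans hz.1, hz.2.trans_lt hq2⟩⟩
  · rintro _ ⟨p, q, rfl⟩
    rw [← NNReal.tendsto_coe]
    change Tendsto (fun i => (μ i : Measure ℝ).real (Set.Ioc (p : ℝ) q)) l
      (𝓝 ((ν : Measure ℝ).real (Set.Ioc (p : ℝ) q)))
    rcases le_total q p with hqp | hpq
    · have : Set.Ioc (p : ℝ) q = ∅ := Set.Ioc_eq_empty (by simpa using hqp)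
      simpa [this] using tendsto_const_nhds
    · have hpq' : (p : ℝ) ≤ q := by exact_mod_cast hpq
      have hd : ∀ ρ : ProbabilityMeasure ℝ, (ρ : Measure ℝ).real (Set.Ioc (p : ℝ) q)
          = (ρ : Measure ℝ).real (Set.Iic (q : ℝ)) - (ρ : Measure ℝ).real (Set.Iic (p : ℝ)) := by
        intro ρ
        rw [← Set.Iic_sdiff_Iic, measureReal_sdiff (Set.Iic_subset_Iic.2 hpq') measurableSet_Iic]
      simp only [hd]
      exact (h q).sub (h p)

/-- Weak convergence along a convergent parameter. -/
lemma tendsto_integral_of_tendsto_param {E : Type*} [TopologicalSpace E]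
    [TopologicalSpace.PseudoMetrizableSpace E] [SecondCountableTopology E] [MeasurableSpace E]
    [BorelSpace E] {ι : Type*} {l : Filter ι}
    {μ : ι → ProbabilityMeasure ℝ} {ν : ProbabilityMeasure ℝ} (hμ : Tendsto μ l (𝓝 ν))
    {θ : ι → E} {θ' : E} (hθ : Tendsto θ l (𝓝 θ')) {g : E × ℝ → ℝ} (hg : Continuous g)
    {B : ℝ} (hB : ∀ p, |g p| ≤ B) :
    Tendsto (fun i => ∫ x, g (θ i, x) ∂(μ i : Measure ℝ)) l
      (𝓝 (∫ x, g (θ', x) ∂(ν : Measure ℝ))) := by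
  -- The parameter is carried as a Dirac mass: the product laws converge weakly on `E × ℝ`, so joint
  -- continuity of `g` replaces any uniformity in `θ`.
  have hprod : Tendsto (fun i => (diracProba (θ i)).prod (μ i)) l (𝓝 ((diracProba θ').prod ν)) := by
    have h1 : Tendsto (fun i => (diracProba (θ i), μ i)) l (𝓝 (diracProba θ', ν)) :=
      ((continuous_diracProba.tendsto θ').comp hθ).prodMk_nhds hμ
    exact (ProbabilityMeasure.continuous_prod.tendsto (diracProba θ', ν)).comp h1
  have h2 := (ProbabilityMeasure.tendsto_iff_forall_integral_tendsto.1 hprod)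
    (BoundedContinuousFunction.ofNormedAddCommGroup g hg B hB)
  have h3 : ∀ (e : E) (ρ : ProbabilityMeasure ℝ),
      ∫ p, g p ∂(((diracProba e).prod ρ : ProbabilityMeasure (E × ℝ)) : Measure (E × ℝ))
        = ∫ x, g (e, x) ∂(ρ : Measure ℝ) := by
    intro e ρ
    rw [ProbabilityMeasure.toMeasure_prod]
    change ∫ p, g p ∂((Measure.dirac e).prod (ρ : Measure ℝ)) = _
    rw [Measure.dirac_prod, integral_map (by fun_prop) hg.measurable.aestronglyMeasurable]
  have h4 : ∀ (e : E) (ρ : ProbabilityMeasure ℝ),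
      ∫ p, BoundedContinuousFunction.ofNormedAddCommGroup g hg B hB p
        ∂(((diracProba e).prod ρ : ProbabilityMeasure (E × ℝ)) : Measure (E × ℝ))
        = ∫ x, g (e, x) ∂(ρ : Measure ℝ) := h3
  simpa only [h4] using h2

/-- The limit law of the normalized block maxima. -/
def gevLaw (γ : ℝ) : ProbabilityMeasure ℝ :=
  ⟨expLaw.map (gevMap (γ, 0, 1)), isProbabilityMeasure_map_gevMap _⟩

lemma gevLaw_real_Iic (γ x : ℝ) : (gevLaw γ : Measure ℝ).real (Set.Iic x) = gevCDF γ x := by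
  change (expLaw.map (gevMap (γ, 0, 1))).real (Set.Iic x) = _
  rw [Measure.real, map_gevMap_Iic (by norm_num), ENNReal.toReal_ofReal (gevCDF_nonneg _ _)]
  simp

/-- Almost surely, the empirical laws of the normalized block maxima converge weakly to the
extreme value law. -/
theorem ae_tendsto_empiricalLaw {Ω : Type*} [MeasurableSpace Ω] {P : Measure Ω}
    [IsProbabilityMeasure P] {X : ℕ → Ω → ℝ} (hm : ∀ i, Measurable (X i)) (hind : iIndepFun X P)
    {F : ℝ → ℝ} (hcdf : ∀ i x, P.real {ω | X i ω ≤ x} = F x) {γ : ℝ} {a b : ℕ → ℝ}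
    (hab : IsNorming F γ a b) {m : ℕ → ℕ} (hmn : Tendsto m atTop atTop) :
    ∀ᵐ ω ∂P, Tendsto (fun n => empiricalProba (fun k => normBlockMax X a b (m n) k ω) n) atTop
      (𝓝 (gevLaw γ)) := by
  have hmb : ∀ n k, Measurable (normBlockMax X a b (m n) k) := fun n k =>
    ((measurable_blockMax hm _ _).sub_const _).div_const _
  -- The strong law is applied to the indicators of `(-∞, q]`, whose means `F^m(a_m q + b_m)`
  -- converge by the norming condition. Countably many `q` leave one null set.
  have key : ∀ q : ℚ, ∀ᵐ ω ∂P, Tendsto (fun n : ℕ => (n : ℝ)⁻¹ * ∑ k ∈ Finset.range n,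
      (Set.Iic (q : ℝ)).indicator 1 (normBlockMax X a b (m n) k ω)) atTop
      (𝓝 (gevCDF γ q)) := by
    intro q
    have hme : Measurable ((Set.Iic (q : ℝ)).indicator (1 : ℝ → ℝ)) :=
      measurable_one.indicator measurableSet_Iic
    set Z : ℕ → ℕ → Ω → ℝ := fun n k ω =>
      (Set.Iic (q : ℝ)).indicator (1 : ℝ → ℝ) (normBlockMax X a b (m n) k ω) with hZ
    have hZm : ∀ n k, Measurable (Z n k) := fun n k => hme.comp (hmb n k)
    have hZi : ∀ n, iIndepFun (Z n) P := fun n =>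
      (iIndepFun_blockMax hm hind (m n)).comp
        (fun _ x => (Set.Iic (q : ℝ)).indicator (1 : ℝ → ℝ) ((x - b (m n)) / a (m n)))
        fun _ => hme.comp ((measurable_id.sub_const _).div_const _)
    have hbd : ∀ n k ω, Z n k ω ^ 4 ≤ 1 := by
      intro n k ω
      simp only [hZ, Set.indicator]
      split_ifs <;> norm_num
    have h4 : ∀ᶠ n in atTop, ∀ k, Integrable (fun ω => Z n k ω ^ 4) P ∧
        ∫ ω, Z n k ω ^ 4 ∂P ≤ 1 := by
      refine Eventually.of_forall fun n k => ?_
      have hi : Integrable (fun ω => Z n k ω ^ 4) P :=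
        (integrable_const (1 : ℝ)).mono' ((hZm n k).pow_const 4).aestronglyMeasurable
          (Eventually.of_forall fun ω => by
            rw [Real.norm_of_nonneg (by positivity)]
            exact hbd n k ω)
      refine ⟨hi, (integral_mono hi (integrable_const 1) (hbd n k)).trans (by simp)⟩
    have hmean : ∀ᶠ n in atTop, ∀ k, ∫ ω, Z n k ω ∂P = F (a (m n) * q + b (m n)) ^ m n := by
      filter_upwards [hmn.eventually hab.1, hmn.eventually_ge_atTop 1] with n h1 h2 k
      rw [← measureReal_blockMax_le hind hcdf h2 k]
      have h3 : (fun ω => Z n k ω)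
          = {ω | blockMax X (m n) k ω ≤ a (m n) * q + b (m n)}.indicator 1 := by
        ext ω
        simp only [hZ, Set.indicator, Set.mem_Iic, normBlockMax]
        have h4 : (blockMax X (m n) k ω - b (m n)) / a (m n) ≤ q ↔
            blockMax X (m n) k ω ≤ a (m n) * q + b (m n) := by
          rw [div_le_iff₀ h1]
          constructor <;> intro h <;> linarith
        simp only [h4]
        rfl
      rw [h3, integral_indicator_one (measurableSet_le (measurable_blockMax hm _ _)
        measurable_const)]
    filter_upwards [ae_tendsto_average_sub hZm hZi h4] with ω hω
    have h5 := hω.add ((hab.2 q).comp hmn)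
    rw [zero_add] at h5
    refine h5.congr' ?_
    filter_upwards [hmean, eventually_ge_atTop 1] with n h6 h7
    have hn0 : (n : ℝ) ≠ 0 := by
      have : n ≠ 0 := by omega
      exact_mod_cast this
    simp only [h6, Function.comp]
    rw [Finset.sum_sub_distrib, mul_sub, Finset.sum_const, Finset.card_range, nsmul_eq_mul,
      inv_mul_cancel_left₀ hn0, sub_add_cancel]
  filter_upwards [ae_all_iff.2 key] with ω hω
  refine tendsto_probabilityMeasure_of_cdf fun q => ?_
  rw [gevLaw_real_Iic]
  refine (hω q).congr' ?_
  filter_upwards [eventually_ge_atTop 1] with n hn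
  exact (empiricalLaw_real_Iic _ (by omega) _).symm

/-! ### The clipped log-likelihood. -/

/-- The log-likelihood truncated from below at `-M`. -/
def gevClip (M : ℝ) (θ : ℝ × ℝ × ℝ) (x : ℝ) : ℝ := (max (gevLogLik θ x) ((-M : ℝ) : EReal)).toReal

lemma coe_gevClip (M : ℝ) (θ : ℝ × ℝ × ℝ) (x : ℝ) :
    ((gevClip M θ x : ℝ) : EReal) = max (gevLogLik θ x) ((-M : ℝ) : EReal) := by
  refine EReal.coe_toReal ?_ ?_
  · exact (max_lt (lt_top_iff_ne_top.2 (gevLogLik_ne_top θ x)) (EReal.coe_lt_top _)).ne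
  · exact ((EReal.bot_lt_coe _).trans_le (le_max_right _ _)).ne'

lemma gevLogLik_le_gevClip (M : ℝ) (θ : ℝ × ℝ × ℝ) (x : ℝ) :
    gevLogLik θ x ≤ ((gevClip M θ x : ℝ) : EReal) := by
  rw [coe_gevClip]
  exact le_max_left _ _

lemma neg_le_gevClip (M : ℝ) (θ : ℝ × ℝ × ℝ) (x : ℝ) : -M ≤ gevClip M θ x := by
  rw [← EReal.coe_le_coe_iff, coe_gevClip]
  exact le_max_right _ _

lemma gevClip_of_bot {M : ℝ} {θ : ℝ × ℝ × ℝ} {x : ℝ} (h : gevLogLik θ x = ⊥) :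
    gevClip M θ x = -M := by
  rw [gevClip, h, max_eq_right bot_le, EReal.toReal_coe]

lemma gevClip_of_coe {M : ℝ} {θ : ℝ × ℝ × ℝ} {x r : ℝ} (h : gevLogLik θ x = (r : EReal)) :
    gevClip M θ x = max r (-M) := by
  rw [← EReal.coe_eq_coe_iff, coe_gevClip, h, EReal.coe_strictMono.monotone.map_max]

lemma gevClip_le {M B : ℝ} (hB : 0 ≤ B) (hM : 0 ≤ M) {θ : ℝ × ℝ × ℝ} {x : ℝ}
    (h : gevLogLik θ x ≤ (B : EReal)) : gevClip M θ x ≤ B := by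
  rw [← EReal.coe_le_coe_iff, coe_gevClip]
  exact max_le h (EReal.coe_le_coe_iff.2 (by linarith))

lemma continuousAt_gevClip (M : ℝ) {θ : ℝ × ℝ × ℝ} (hθ : θ ∈ gevParamSpace) (x : ℝ) :
    ContinuousAt (fun p : (ℝ × ℝ × ℝ) × ℝ => gevClip M p.1 p.2) (θ, x) := by
  have h1 : ContinuousAt (fun p : (ℝ × ℝ × ℝ) × ℝ =>
      max (gevLogLik p.1 p.2) ((-M : ℝ) : EReal)) (θ, x) :=
    (continuousAt_gevLogLik hθ x).max continuousAt_const
  refine ContinuousAt.comp (g := EReal.toReal)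
    (f := fun p : (ℝ × ℝ × ℝ) × ℝ => max (gevLogLik p.1 p.2) ((-M : ℝ) : EReal)) ?_ h1
  refine EReal.tendsto_toReal ?_ ?_
  · exact (max_lt (lt_top_iff_ne_top.2 (gevLogLik_ne_top θ x)) (EReal.coe_lt_top _)).ne
  · exact ((EReal.bot_lt_coe _).trans_le (le_max_right _ _)).ne'

/-- Averages of the truncated log-likelihood converge along convergent parameters. -/
lemma tendsto_average_gevClip {K : Set (ℝ × ℝ × ℝ)} (hKΘ : K ⊆ gevParamSpace) (hK : IsCompact K)
    {M : ℝ} (hM : 0 ≤ M) {γ : ℝ} {y : ℕ → ℕ → ℝ}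
    (hy : Tendsto (fun n => empiricalProba (y n) n) atTop (𝓝 (gevLaw γ)))
    {N : ℕ → ℕ} (hN : Tendsto N atTop atTop) {θ : ℕ → ℝ × ℝ × ℝ} {θ' : ℝ × ℝ × ℝ}
    (hθK : ∀ i, θ i ∈ K) (hθ'K : θ' ∈ K) (hθ : Tendsto θ atTop (𝓝 θ')) :
    Tendsto (fun i => (N i : ℝ)⁻¹ * ∑ k ∈ Finset.range (N i), gevClip M (θ i) (y (N i) k)) atTop
      (𝓝 (∫ e, gevClip M θ' (gevMap (γ, 0, 1) e) ∂expLaw)) := by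
  obtain ⟨B, hB0, hB⟩ := exists_gevLogLik_le hKΘ hK
  -- The parameter lives in the subtype `K`, where the clipped log-likelihood is continuous and
  -- bounded everywhere.
  have hcont : Continuous fun p : K × ℝ => gevClip M (p.1 : ℝ × ℝ × ℝ) p.2 := by
    refine continuous_iff_continuousAt.2 fun p => ?_
    exact ContinuousAt.comp (g := fun p : (ℝ × ℝ × ℝ) × ℝ => gevClip M p.1 p.2)
      (f := fun p : K × ℝ => ((p.1 : ℝ × ℝ × ℝ), p.2))
      (continuousAt_gevClip M (hKΘ p.1.2) p.2) (by fun_prop)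
  have hbd : ∀ p : K × ℝ, |gevClip M (p.1 : ℝ × ℝ × ℝ) p.2| ≤ max B M := fun p => by
    have h1 := gevClip_le hB0 hM (hB p.1 p.1.2 p.2)
    have h2 := neg_le_gevClip M (p.1 : ℝ × ℝ × ℝ) p.2
    rw [abs_le]
    exact ⟨by linarith [le_max_right B M], h1.trans (le_max_left _ _)⟩
  have hθ2 : Tendsto (fun i => (⟨θ i, hθK i⟩ : K)) atTop (𝓝 ⟨θ', hθ'K⟩) :=
    tendsto_subtype_rng.2 hθ
  have h := tendsto_integral_of_tendsto_param (hy.comp hN) hθ2 hcont hbd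
  have hlim : ∫ x, gevClip M θ' x ∂(gevLaw γ : Measure ℝ)
      = ∫ e, gevClip M θ' (gevMap (γ, 0, 1) e) ∂expLaw := by
    change ∫ x, gevClip M θ' x ∂(expLaw.map (gevMap (γ, 0, 1))) = _
    refine integral_map (measurable_gevMap _).aemeasurable ?_
    have : Continuous fun x : ℝ => gevClip M θ' x :=
      hcont.comp (f := fun x : ℝ => ((⟨θ', hθ'K⟩ : K), x)) (by fun_prop)
    exact this.measurable.aestronglyMeasurable
  simp only at h
  rw [hlim] at h
  refine h.congr' ?_
  filter_upwards [hN.eventually_ge_atTop 1] with i hi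
  exact integral_empiricalLaw _ (by omega) _

/-! ### Control of the log-likelihood at a slightly shifted parameter. -/

lemma tendsto_tailQuantile_nat {F : ℝ → ℝ} (hF : IsDistributionFunction F) {γ : ℝ} {a b : ℕ → ℝ}
    (hab : IsNorming F γ a b) :
    Tendsto (fun m : ℕ => (tailQuantile F m - b m) / a m) atTop (𝓝 0) := by
  have h := (tendsto_tailQuantile hF hab 0).comp tendsto_natCast_atTop_atTop
  rw [gevQuantile_zero] at h
  refine h.congr fun m => ?_
  simp

/-- For `x` below `U(m)` the left Potter bound is applied with `s = 1 / (1 - F(x))`: then `U(s) ≤ x`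
and `m / s = m (1 - F(x))`. The restriction on `x` says `s ≥ t₀`. -/
lemma eventually_neg_norm_le {F : ℝ → ℝ} (hF : IsDistributionFunction F) {γ : ℝ} {a b : ℕ → ℝ}
    (hab : IsNorming F γ a b) {C ρ t₀ : ℝ} (hC : 0 ≤ C) (ht₀ : 2 < t₀)
    (h : ∀ s ≥ t₀, ∀ t ≥ s, tailQuantile F t - tailQuantile F s ≤ C * (t / s) ^ ρ * a ⌊t⌋₊)
    {ε : ℝ} (hε : 0 < ε) :
    ∀ᶠ m : ℕ in atTop, ∀ x, t₀ * (1 - F x) ≤ 1 →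
      -((x - b m) / a m) ≤ C * (max 1 (m * (1 - F x))) ^ ρ + ε := by
  have hlim := (tendsto_tailQuantile_nat hF hab).eventually (Ioo_mem_nhds (neg_lt_zero.2 hε) hε)
  filter_upwards [hlim, hab.1, eventually_ge_atTop 2] with m hm ham hm2 x hx
  have hm2' : (2 : ℝ) ≤ m := by exact_mod_cast hm2
  have hU : tailQuantile F m - x ≤ C * (max 1 (m * (1 - F x))) ^ ρ * a m := by
    by_cases hxU : tailQuantile F m ≤ x
    · have : 0 ≤ C * (max 1 (m * (1 - F x))) ^ ρ * a m := by positivity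
      linarith
    · have hV : 1 < m * (1 - F x) := by
        by_contra! hV
        exact hxU (tailQuantile_le hF (by linarith) hV)
      have hF0 : 0 < 1 - F x := by
        by_contra! h0
        nlinarith
      have h1 : t₀ ≤ 1 / (1 - F x) := by rwa [le_div_iff₀ hF0]
      have h2 : 1 / (1 - F x) ≤ m := by rw [div_le_iff₀ hF0]; exact hV.le
      have h3 := h _ h1 _ h2
      have h4 : tailQuantile F (1 / (1 - F x)) ≤ x :=
        tailQuantile_le hF (by linarith) (by rw [one_div, inv_mul_cancel₀ hF0.ne'])
      rw [Nat.floor_natCast] at h3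
      have h5 : (m : ℝ) / (1 / (1 - F x)) = m * (1 - F x) := by rw [div_div_eq_mul_div, div_one]
      rw [h5] at h3
      rw [max_eq_right hV.le]
      linarith
  have h6 : -((x - b m) / a m) = (tailQuantile F m - x) / a m - (tailQuantile F m - b m) / a m := by
    ring
  have h7 : (tailQuantile F m - x) / a m ≤ C * (max 1 (m * (1 - F x))) ^ ρ := by
    rwa [div_le_iff₀ ham]
  rw [h6]
  linarith [hm.1]

/-- For `x` above `U(m)` the right Potter bound is applied with `s = 2 / q`; the factor `2` makes `s
(1 - F(z)) > 1` for every `z < x`, whence `x ≤ U(s)`. Here `q` plays the part of `P(X ≥ x)`. -/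
lemma eventually_norm_le {F : ℝ → ℝ} (hF : IsDistributionFunction F) {γ : ℝ} {a b : ℕ → ℝ}
    (hab : IsNorming F γ a b) {C ρ t₀ : ℝ} (hC : 0 ≤ C)
    (h : ∀ t ≥ t₀, ∀ s ≥ t, tailQuantile F s - tailQuantile F t ≤ C * (s / t) ^ ρ * a ⌊t⌋₊)
    {ε : ℝ} (hε : 0 < ε) :
    ∀ᶠ m : ℕ in atTop, ∀ x q, 0 < q → (∀ y < x, q ≤ 1 - F y) →
      (x - b m) / a m ≤ C * (max 1 (2 / (m * q))) ^ ρ + ε := by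
  have hlim := (tendsto_tailQuantile_nat hF hab).eventually (Ioo_mem_nhds (neg_lt_zero.2 hε) hε)
  filter_upwards [hlim, hab.1, eventually_ge_atTop 2,
    tendsto_natCast_atTop_atTop.eventually_ge_atTop t₀] with m hm ham hm2 hmt x q hq hx
  have hm2' : (2 : ℝ) ≤ m := by exact_mod_cast hm2
  have hU : x - tailQuantile F m ≤ C * (max 1 (2 / (m * q))) ^ ρ * a m := by
    by_cases hxU : x ≤ tailQuantile F m
    · have : 0 ≤ C * (max 1 (2 / (m * q))) ^ ρ * a m := by positivity
      linarith
    · obtain ⟨y, hy, hmy⟩ := exists_lt_of_tailQuantile_lt hF (not_le.1 hxU)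
      have h1 : m * q ≤ 1 := (mul_le_mul_of_nonneg_left (hx y hy) (by linarith)).trans hmy
      have h2 : (m : ℝ) ≤ 2 / q := by
        rw [le_div_iff₀ hq]
        linarith
      have h3 : x ≤ tailQuantile F (2 / q) := by
        by_contra! h4
        obtain ⟨z, hz, hsz⟩ := exists_lt_of_tailQuantile_lt hF h4
        have h5 := mul_le_mul_of_nonneg_left (hx z hz) (by positivity : 0 ≤ 2 / q)
        rw [div_mul_cancel₀ _ hq.ne'] at h5
        linarith
      have h6 := h _ hmt _ h2
      rw [Nat.floor_natCast, div_div, mul_comm q] at h6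
      have h7 : 1 ≤ 2 / (m * q) := by
        rw [le_div_iff₀ (by positivity)]
        linarith
      rw [max_eq_right h7]
      linarith
  have h6 : (x - b m) / a m = (x - tailQuantile F m) / a m + (tailQuantile F m - b m) / a m := by
    ring
  have h7 : (x - tailQuantile F m) / a m ≤ C * (max 1 (2 / (m * q))) ^ ρ := by
    rwa [div_le_iff₀ ham]
  rw [h6]
  linarith [hm.2]

lemma exists_rpow_le_exp (ρ : ℝ) : ∃ C > 0, ∀ A ≥ (1 : ℝ), A ^ ρ ≤ C * Real.exp (A / 16) := by
  have hs : 0 < 16 * (|ρ| + 1) := by positivity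
  refine ⟨Real.exp (|ρ| * Real.log (16 * (|ρ| + 1))), Real.exp_pos _, fun A hA => ?_⟩
  have hA0 : 0 < A := by linarith
  rw [Real.rpow_def_of_pos hA0, ← Real.exp_add, Real.exp_le_exp]
  have h1 : Real.log A * ρ ≤ Real.log A * |ρ| :=
    mul_le_mul_of_nonneg_left (le_abs_self ρ) (Real.log_nonneg hA)
  have h2 := Real.log_le_sub_one_of_pos (x := A / (16 * (|ρ| + 1))) (by positivity)
  rw [Real.log_div hA0.ne' hs.ne'] at h2
  have h3 : |ρ| * (A / (16 * (|ρ| + 1))) ≤ A / 16 := by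
    rw [← mul_div_assoc, div_le_div_iff₀ hs (by norm_num)]
    nlinarith [abs_nonneg ρ]
  have h4 := mul_le_mul_of_nonneg_left h2 (abs_nonneg ρ)
  nlinarith [abs_nonneg ρ]

/-- The parameter `(γ, 0, 1)` shifted by `δ` towards a larger support. -/
def shiftedParam (γ δ : ℝ) : ℝ × ℝ × ℝ := (γ, -(Real.sign γ * δ), 1)

lemma one_add_mul_shiftedParam (γ δ x : ℝ) :
    1 + (shiftedParam γ δ).1 * ((x - (shiftedParam γ δ).2.1) / (shiftedParam γ δ).2.2)
      = 1 + γ * x + |γ| * δ := by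
  have : γ * Real.sign γ = |γ| := by
    rcases lt_trichotomy γ 0 with h | h | h
    · rw [Real.sign_of_neg h, abs_of_neg h]; ring
    · simp [h]
    · rw [Real.sign_of_pos h, abs_of_pos h]; ring
  simp only [shiftedParam]
  linear_combination δ * this

lemma gevLogLik_shiftedParam {γ δ x : ℝ} (hx : 0 < 1 + γ * x + |γ| * δ) :
    gevLogLik (shiftedParam γ δ) x
      = ((gumbelLogLik γ (gumbelCoord γ (x + Real.sign γ * δ)) : ℝ) : EReal) := by
  rw [gevLogLik_of_pos (by rwa [one_add_mul_shiftedParam])]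
  simp [shiftedParam]

lemma continuous_shiftedParam (γ : ℝ) : Continuous (shiftedParam γ) := by
  unfold shiftedParam
  fun_prop

lemma shiftedParam_zero (γ : ℝ) : shiftedParam γ 0 = (γ, 0, 1) := by simp [shiftedParam]

lemma one_add_mul_gevMap (γ e : ℝ) : 1 + γ * gevMap (γ, 0, 1) e = Real.exp (-(γ * Real.log e)) := by
  simp only [gevMap, zero_add, one_mul]
  rw [one_add_mul_gevQuantile]
  congr 1
  ring

/-- The shift adds `|γ| δ` to `1 + γ x`. Of the two terms of the log-likelihood one only improves,
and the other loses at most `δ` times a power of `e` plus a constant: by Bernoulli's inequality for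
`γ < 0`, by `log (1 + x) ≤ x` for `γ > 0`. For `γ = 0` the support is all of `ℝ` and there is no
shift. -/
theorem exists_le_gevLogLik_shiftedParam {γ : ℝ} (hγ : -1 < γ) :
    ∃ R : ℝ → ℝ, Integrable R expLaw ∧ ∀ δ, 0 < δ → δ ≤ 1 → ∀ e, 0 < e →
      (((1 + γ) * Real.log e - e - δ * R e : ℝ) : EReal)
        ≤ gevLogLik (shiftedParam γ δ) (gevMap (γ, 0, 1) e) := by
  rcases lt_trichotomy γ 0 with h | h | h
  · obtain ⟨β, rfl⟩ : ∃ β, γ = -β := ⟨-γ, by ring⟩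
    have hβ : 0 < β := by linarith
    have hβ1 : β < 1 := by linarith
    have hp : 1 < 1 / β := by rw [lt_div_iff₀ hβ]; linarith
    refine ⟨fun e => 2 ^ (1 / β - 1) * (e ^ (1 - β) + β ^ (1 / β - 1)), ?_, ?_⟩
    · exact ((integrable_rpow_expLaw (by linarith)).add (integrable_const _)).const_mul _
    · intro δ hδ hδ1 e he
      have hz : 1 + -β * gevMap (-β, 0, 1) e + |-β| * δ = e ^ β + β * δ := by
        rw [one_add_mul_gevMap, Real.rpow_def_of_pos he, abs_neg, abs_of_pos hβ]
        congr 2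
        ring
      have hu : 0 < e ^ β := by positivity
      have hh : 0 < β * δ := by positivity
      rw [gevLogLik_shiftedParam (by rw [hz]; positivity), EReal.coe_le_coe_iff, gumbelCoord,
        if_neg h.ne]
      have hz' : 1 + -β * (gevMap (-β, 0, 1) e + Real.sign (-β) * δ) = e ^ β + β * δ := by
        rw [← hz, Real.sign_of_neg h, abs_neg, abs_of_pos hβ]
        ring
      rw [hz', gumbelLogLik]
      set v := e ^ β + β * δ with hv
      have hv0 : 0 < v := by positivity
      have h1 : Real.exp (-(Real.log v / -β)) = v ^ (1 / β) := by
        rw [Real.rpow_def_of_pos hv0]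
        congr 1
        rw [div_neg, neg_neg, mul_one_div]
      have h2 : β * Real.log e ≤ Real.log v := by
        rw [← Real.log_rpow he]
        exact Real.log_le_log hu (by linarith)
      have h3 : (1 - β) * Real.log e ≤ -((1 + -β) * (Real.log v / -β)) := by
        have : -((1 + -β) * (Real.log v / -β)) = (1 - β) * (Real.log v / β) := by
          field_simp
          ring
        rw [this]
        refine mul_le_mul_of_nonneg_left ?_ (by linarith)
        rw [le_div_iff₀ hβ]
        linarith
      -- Bernoulli with exponent `1 / β > 1`, applied to `e^β / v = 1 - β δ / v`.
      have h4 : v ^ (1 / β) - δ * v ^ (1 / β - 1) ≤ e := by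
        have h5 := one_add_mul_self_le_rpow_one_add (s := e ^ β / v - 1)
          (by have : 0 ≤ e ^ β / v := by positivity
              linarith) hp.le
        have h6 : 1 + (e ^ β / v - 1) = e ^ β / v := by ring
        rw [h6, Real.div_rpow hu.le hv0.le, ← Real.rpow_mul he.le, mul_one_div_cancel hβ.ne',
          Real.rpow_one, le_div_iff₀ (by positivity)] at h5
        refine le_trans (le_of_eq ?_) h5
        rw [Real.rpow_sub hv0, Real.rpow_one]
        have h7 : e ^ β = v - β * δ := by rw [hv]; ring
        rw [h7]
        field_simp
        ring
      have h8 : v ^ (1 / β - 1) ≤ 2 ^ (1 / β - 1) * (e ^ (1 - β) + β ^ (1 / β - 1)) := by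
        have h9 : v ≤ 2 * max (e ^ β) β := by
          have := le_max_left (e ^ β) β
          have := le_max_right (e ^ β) β
          nlinarith
        calc v ^ (1 / β - 1) ≤ (2 * max (e ^ β) β) ^ (1 / β - 1) := by
              apply Real.rpow_le_rpow hv0.le h9; linarith
          _ = 2 ^ (1 / β - 1) * (max (e ^ β) β) ^ (1 / β - 1) := by
              rw [Real.mul_rpow (by norm_num) (by positivity)]
          _ ≤ _ := by
              refine mul_le_mul_of_nonneg_left ?_ (by positivity)
              have h10 : (e ^ β) ^ (1 / β - 1) = e ^ (1 - β) := by
                rw [← Real.rpow_mul he.le]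
                congr 1
                field_simp
              have h11 : 0 ≤ e ^ (1 - β) := by positivity
              have h12 : 0 ≤ β ^ (1 / β - 1) := by positivity
              rcases max_cases (e ^ β) β with h | h
              · rw [h.1, h10]; linarith
              · rw [h.1]; linarith
      have h9 := mul_le_mul_of_nonneg_left h8 hδ.le
      rw [h1]
      linarith
  · subst h
    refine ⟨fun _ => 0, integrable_zero _ _ _, fun δ hδ hδ1 e he => ?_⟩
    have h0 : shiftedParam 0 δ = (0, 0, 1) := by simp [shiftedParam]
    rw [h0, gevLogLik_gevMap one_pos he]
    simp
  · refine ⟨fun e => (1 + γ) * e ^ γ, (integrable_rpow_expLaw hγ).const_mul _, ?_⟩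
    intro δ hδ hδ1 e he
    have hz : 1 + γ * gevMap (γ, 0, 1) e + |γ| * δ = e ^ (-γ) + γ * δ := by
      rw [one_add_mul_gevMap, Real.rpow_def_of_pos he, abs_of_pos h]
      congr 2
      ring
    have hu : 0 < e ^ (-γ) := by positivity
    have hh : 0 < γ * δ := by positivity
    rw [gevLogLik_shiftedParam (by rw [hz]; positivity), EReal.coe_le_coe_iff, gumbelCoord,
      if_neg h.ne']
    have hz' : 1 + γ * (gevMap (γ, 0, 1) e + Real.sign γ * δ) = e ^ (-γ) + γ * δ := by
      rw [← hz, Real.sign_of_pos h, abs_of_pos h]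
      ring
    rw [hz', gumbelLogLik]
    set v := e ^ (-γ) + γ * δ with hv
    have hv0 : 0 < v := by positivity
    have h2 : -(γ * Real.log e) ≤ Real.log v := by
      rw [← neg_mul, ← Real.log_rpow he]
      exact Real.log_le_log hu (by linarith)
    have h1 : Real.exp (-(Real.log v / γ)) ≤ e := by
      refine (Real.exp_le_exp.2 (?_ : _ ≤ Real.log e)).trans_eq (Real.exp_log he)
      rw [neg_le, le_div_iff₀ h]
      linarith
    have h3 : Real.log v ≤ -(γ * Real.log e) + γ * δ * e ^ γ := by
      have h4 : v = e ^ (-γ) * (1 + γ * δ * e ^ γ) := by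
        have : e ^ (-γ) * e ^ γ = 1 := by rw [← Real.rpow_add he]; simp
        rw [hv]
        linear_combination -(γ * δ) * this
      rw [h4, Real.log_mul hu.ne' (by positivity), Real.log_rpow he]
      have := Real.log_le_sub_one_of_pos (x := 1 + γ * δ * e ^ γ) (by positivity)
      linarith
    have h5 : Real.log v / γ ≤ -Real.log e + δ * e ^ γ := by
      rw [div_le_iff₀ h]
      linarith
    have h6 := mul_le_mul_of_nonneg_left h5 (by linarith : 0 ≤ 1 + γ)
    linarith

/-- At the finite end of the support the sharp constant `1 / |γ| + δ/4` and the error `δ/4` leave `1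
+ γ y + |γ| δ ≥ |γ| δ / 2`, so the shift keeps the maxima off the singularity. At the other end
Potter powers suffice, and are dominated by the exponential or by the power `1/16`, chosen so that
squares still have enough moments. -/
lemma eventually_gumbelCoord_bounds {F : ℝ → ℝ} (hF : IsDistributionFunction F) {γ : ℝ}
    {a b : ℕ → ℝ} (hab : IsNorming F γ a b) {δ : ℝ} (hδ : 0 < δ) :
    ∃ C₁ ≥ 0, ∃ C₂ ≥ 0, ∃ t₀ > 1, ∀ᶠ m : ℕ in atTop, ∀ x q, t₀ * (1 - F x) ≤ 1 → 0 < q →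
      (∀ y < x, q ≤ 1 - F y) → 0 < 1 + γ * ((x - b m) / a m) + |γ| * δ ∧
      gumbelCoord γ ((x - b m) / a m + Real.sign γ * δ)
        ≤ C₁ * (max 1 (2 / (m * q))) ^ (1 / 16 : ℝ) ∧
      Real.exp (-gumbelCoord γ ((x - b m) / a m + Real.sign γ * δ))
        ≤ C₂ * Real.exp (max 1 (m * (1 - F x)) / 16) := by
  have hδ4 : 0 < δ / 4 := by linarith
  rcases lt_trichotomy γ 0 with h | h | h
  · obtain ⟨β, rfl⟩ : ∃ β, γ = -β := ⟨-γ, by ring⟩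
    have hβ : 0 < β := by linarith
    obtain ⟨C, hC, t₀, ht₀, hl⟩ := exists_potter_left hF hab (ρ := β + 1) (by linarith) (by linarith)
    obtain ⟨t₁, ht₁, hr⟩ := tailQuantile_sub_le_of_neg hF hab h (C := 1 / β + δ / 4)
      (by rw [neg_neg]; linarith)
    obtain ⟨E, hE, hAE⟩ := exists_rpow_le_exp ((β + 1) * (1 / β))
    have e1 := eventually_neg_norm_le hF hab hC.le ht₀ hl one_pos
    have e2 := eventually_norm_le (C := 1 / β + δ / 4) (ρ := 0) hF hab (by positivity) (by simpa using hr) hδ4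
    refine ⟨max 0 (-Real.log (β * δ / 2) / β), le_max_left _ _,
      (1 + β * (C + 1) + β * δ) ^ (1 / β) * E, by positivity, t₀, by linarith, ?_⟩
    filter_upwards [e1, e2] with m h1 h2 x q hx hq hxq
    have h3 := h1 x hx
    have h4 := h2 x q hq hxq
    simp only [Real.rpow_zero, mul_one] at h4
    set y := (x - b m) / a m
    set A := max 1 (m * (1 - F x))
    set D := max 1 (2 / (m * q))
    have hA : 1 ≤ A := le_max_left _ _
    have hD : 1 ≤ D := le_max_left _ _
    have hAρ : 1 ≤ A ^ (β + 1) := Real.one_le_rpow hA (by linarith)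
    have hz : β * δ / 2 ≤ 1 + -β * y + |-β| * δ := by
      rw [abs_neg, abs_of_pos hβ]
      have : β * y ≤ β * (1 / β + δ / 4 + δ / 4) := mul_le_mul_of_nonneg_left h4 hβ.le
      have h5 : β * (1 / β + δ / 4 + δ / 4) = 1 + β * δ / 2 := by field_simp; ring
      linarith
    have hz' : 1 + -β * (y + Real.sign (-β) * δ) = 1 + -β * y + |-β| * δ := by
      rw [Real.sign_of_neg h, abs_neg, abs_of_pos hβ]
      ring
    have hz0 : 0 < 1 + -β * y + |-β| * δ := lt_of_lt_of_le (by positivity) hz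
    rw [gumbelCoord, if_neg h.ne, hz']
    have hzle : 1 + -β * y + |-β| * δ ≤ (1 + β * (C + 1) + β * δ) * A ^ (β + 1) := by
      rw [abs_neg, abs_of_pos hβ]
      have h5 : β * -y ≤ β * (C * A ^ (β + 1) + 1) := mul_le_mul_of_nonneg_left h3 hβ.le
      have : 0 < β * δ := by positivity
      nlinarith
    set z := 1 + -β * y + |-β| * δ
    refine ⟨hz0, ?_, ?_⟩
    · have h5 := Real.log_le_log (by positivity) hz
      have h6 : Real.log z / -β ≤ -Real.log (β * δ / 2) / β := by
        rw [div_neg, neg_div, neg_le_neg_iff]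
        gcongr
      have h7 : 1 ≤ D ^ (1 / 16 : ℝ) := Real.one_le_rpow hD (by norm_num)
      exact (h6.trans (le_max_right _ _)).trans (le_mul_of_one_le_right (le_max_left _ _) h7)
    · have h5 : Real.exp (-(Real.log z / -β)) = z ^ (1 / β) := by
        rw [Real.rpow_def_of_pos hz0]
        congr 1
        rw [div_neg, neg_neg, mul_one_div]
      rw [h5]
      calc z ^ (1 / β) ≤ ((1 + β * (C + 1) + β * δ) * A ^ (β + 1)) ^ (1 / β) :=
            Real.rpow_le_rpow hz0.le hzle (by positivity)
        _ = (1 + β * (C + 1) + β * δ) ^ (1 / β) * A ^ ((β + 1) * (1 / β)) := by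
            rw [Real.mul_rpow (by positivity) (by positivity), ← Real.rpow_mul (by linarith)]
        _ ≤ _ := by
            rw [mul_assoc]
            exact mul_le_mul_of_nonneg_left (hAE A hA) (by positivity)
  · subst h
    obtain ⟨C, hC, t₀, ht₀, hl⟩ := exists_potter_left hF hab (ρ := 1 / 2) (by norm_num) (by norm_num)
    obtain ⟨C', hC', t₁, ht₁, hr⟩ := exists_potter_right hF hab (ρ := 1 / 16) (by norm_num)
      (by norm_num)
    have e1 := eventually_neg_norm_le hF hab hC.le ht₀ hl one_pos
    have e2 := eventually_norm_le hF hab hC'.le hr one_pos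
    -- From `C √A ≤ 4 C² + A / 16`, with `1` added for the error term in `e1`.
    refine ⟨C' + 1, by linarith, Real.exp (4 * C ^ 2 + 1), (Real.exp_pos _).le, t₀, by linarith, ?_⟩
    filter_upwards [e1, e2] with m h1 h2 x q hx hq hxq
    have h3 := h1 x hx
    have h4 := h2 x q hq hxq
    set A := max 1 (m * (1 - F x))
    set D := max 1 (2 / (m * q))
    have hA : 1 ≤ A := le_max_left _ _
    have hD : 1 ≤ D := le_max_left _ _
    have h7 : 1 ≤ D ^ (1 / 16 : ℝ) := Real.one_le_rpow hD (by norm_num)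
    simp only [gumbelCoord, if_true, Real.sign_zero, zero_mul, add_zero, abs_zero]
    refine ⟨one_pos, by linarith, ?_⟩
    rw [← Real.exp_add, Real.exp_le_exp]
    have h8 : A ^ (1 / 2 : ℝ) * A ^ (1 / 2 : ℝ) = A := by
      rw [← Real.rpow_add (by linarith)]
      norm_num
    nlinarith [sq_nonneg (A ^ (1 / 2 : ℝ) / 4 - 2 * C)]
  · obtain ⟨C, hC, t₀, ht₀, hr⟩ := exists_potter_right hF hab (ρ := γ + 1) (by linarith)
      (by linarith)
    obtain ⟨t₁, ht₁, hl⟩ := tailQuantile_sub_le_of_pos hF hab h (C := 1 / γ + δ / 4) (by linarith)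
    have e1 := eventually_neg_norm_le (C := 1 / γ + δ / 4) (ρ := 0) hF hab (by positivity) ht₁ (by simpa using hl) hδ4
    have e2 := eventually_norm_le hF hab hC.le hr one_pos
    have hC1 : 1 ≤ 1 + γ * (C + 1) + γ * δ := by
      have : 0 ≤ γ * (C + 1) + γ * δ := by positivity
      linarith
    have hlogC := Real.log_nonneg hC1
    refine ⟨(Real.log (1 + γ * (C + 1) + γ * δ) + (γ + 1) * 16) / γ, by positivity,
      Real.exp (-(Real.log (γ * δ / 2) / γ)), (Real.exp_pos _).le, t₁, by linarith, ?_⟩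
    filter_upwards [e1, e2] with m h1 h2 x q hx hq hxq
    have h3 := h1 x hx
    have h4 := h2 x q hq hxq
    simp only [Real.rpow_zero, mul_one] at h3
    set y := (x - b m) / a m
    set A := max 1 (m * (1 - F x))
    set D := max 1 (2 / (m * q))
    have hA : 1 ≤ A := le_max_left _ _
    have hD : 1 ≤ D := le_max_left _ _
    have hDρ : 1 ≤ D ^ (γ + 1) := Real.one_le_rpow hD (by linarith)
    have hz : γ * δ / 2 ≤ 1 + γ * y + |γ| * δ := by
      rw [abs_of_pos h]
      have : γ * -y ≤ γ * (1 / γ + δ / 4 + δ / 4) := mul_le_mul_of_nonneg_left h3 h.le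
      have h5 : γ * (1 / γ + δ / 4 + δ / 4) = 1 + γ * δ / 2 := by field_simp; ring
      linarith
    have hz' : 1 + γ * (y + Real.sign γ * δ) = 1 + γ * y + |γ| * δ := by
      rw [Real.sign_of_pos h, abs_of_pos h]
      ring
    have hz0 : 0 < 1 + γ * y + |γ| * δ := lt_of_lt_of_le (by positivity) hz
    rw [gumbelCoord, if_neg h.ne', hz']
    have hzle : 1 + γ * y + |γ| * δ ≤ (1 + γ * (C + 1) + γ * δ) * D ^ (γ + 1) := by
      rw [abs_of_pos h]
      have h5 : γ * y ≤ γ * (C * D ^ (γ + 1) + 1) := mul_le_mul_of_nonneg_left h4 h.le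
      have : 0 < γ * δ := by positivity
      nlinarith
    set z := 1 + γ * y + |γ| * δ
    refine ⟨hz0, ?_, ?_⟩
    · have h5 := Real.log_le_log hz0 hzle
      rw [Real.log_mul (by positivity) (by positivity), Real.log_rpow (by linarith)] at h5
      have h6 := Real.log_le_rpow_div (x := D) (by linarith) (show (0 : ℝ) < 1 / 16 by norm_num)
      have h7 : 1 ≤ D ^ (1 / 16 : ℝ) := Real.one_le_rpow hD (by norm_num)
      rw [div_mul_eq_mul_div]
      gcongr
      have h8 : D ^ (1 / 16 : ℝ) / (1 / 16) = 16 * D ^ (1 / 16 : ℝ) := by ring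
      rw [h8] at h6
      nlinarith
    · have h5 := Real.log_le_log (by positivity) hz
      refine le_trans ?_ (le_mul_of_one_le_right (Real.exp_pos _).le
        (Real.one_le_exp (by positivity)))
      refine Real.exp_le_exp.2 (neg_le_neg ?_)
      gcongr

/-- If `-r ≤ A`, clipping `r` at `-L` raises it by at most `max (A - L) 0 ≤ A² / L`. Here `A = B (1
+ S + T)`, and squaring turns the exponents `1/16` into `1/8`. -/
theorem eventually_gevLogLik_shiftedParam_bound {F : ℝ → ℝ} (hF : IsDistributionFunction F) {γ : ℝ}
    (hγ : -1 < γ) {a b : ℕ → ℝ} (hab : IsNorming F γ a b) {δ : ℝ} (hδ : 0 < δ) :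
    ∃ C ≥ 0, ∃ t₀ > 1, ∀ᶠ m : ℕ in atTop, ∀ x q, t₀ * (1 - F x) ≤ 1 → 0 < q →
      (∀ y < x, q ≤ 1 - F y) → ∃ r : ℝ,
      gevLogLik (shiftedParam γ δ) ((x - b m) / a m) = (r : EReal) ∧ ∀ L > 0,
        max r (-L) - C * (1 + Real.exp (m * (1 - F x) / 8) + (m * q) ^ (-(1 / 8) : ℝ)) / L ≤ r := by
  obtain ⟨C₁, hC₁, C₂, hC₂, t₀, ht₀, h⟩ := eventually_gumbelCoord_bounds hF hab hδ
  set B := (1 + γ) * C₁ * 2 + C₂ * 2 with hB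
  have hB0 : 0 ≤ B := by
    have : 0 ≤ 1 + γ := by linarith
    positivity
  refine ⟨3 * B ^ 2, by positivity, t₀, ht₀, ?_⟩
  filter_upwards [h, eventually_ge_atTop 1] with m hm hm1 x q hx hq hxq
  have hm0 : (0 : ℝ) < m := by exact_mod_cast hm1
  obtain ⟨h1, h2, h3⟩ := hm x q hx hq hxq
  refine ⟨_, gevLogLik_shiftedParam h1, ?_⟩
  set w := gumbelCoord γ ((x - b m) / a m + Real.sign γ * δ)
  set V := m * (1 - F x)
  have hq' : 0 < m * q := by positivity
  set S := Real.exp (V / 16)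
  set T := (m * q) ^ (-(1 / 16) : ℝ) with hT
  have hS0 : 0 < S := Real.exp_pos _
  have hT0 : 0 < T := by positivity
  have hS : Real.exp (V / 8) = S ^ 2 := by
    rw [← Real.exp_nat_mul]
    congr 1
    push_cast
    ring
  have hT2 : (m * q) ^ (-(1 / 8) : ℝ) = T ^ 2 := by
    rw [hT, ← Real.rpow_mul_natCast hq'.le]
    congr 1
    norm_num
  have h4 : (max 1 (2 / (m * q))) ^ (1 / 16 : ℝ) ≤ 2 * (1 + T) := by
    rcases max_cases 1 (2 / (m * q)) with h | h
    · rw [h.1, Real.one_rpow]; linarith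
    · rw [h.1, Real.div_rpow (by norm_num) hq'.le, div_eq_mul_inv, ← Real.rpow_neg hq'.le]
      have : (2 : ℝ) ^ (1 / 16 : ℝ) ≤ 2 ^ (1 : ℝ) :=
        Real.rpow_le_rpow_of_exponent_le (by norm_num) (by norm_num)
      rw [Real.rpow_one] at this
      nlinarith
  have h5 : Real.exp (max 1 V / 16) ≤ 2 * (1 + S) := by
    rcases max_cases 1 V with h | h
    · have h6 := Real.exp_bound_div_one_sub_of_interval (x := 1 / 16) (by norm_num) (by norm_num)
      norm_num at h6
      rw [h.1]
      norm_num
      linarith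
    · rw [h.1]; change S ≤ _; linarith
  have h6 : -gumbelLogLik γ w ≤ B * (1 + S + T) := by
    have h7 : (1 + γ) * w ≤ (1 + γ) * (C₁ * (2 * (1 + T))) :=
      mul_le_mul_of_nonneg_left (h2.trans (mul_le_mul_of_nonneg_left h4 hC₁)) (by linarith)
    have h8 := h3.trans (mul_le_mul_of_nonneg_left h5 hC₂)
    have h9 : 0 ≤ (1 + γ) * C₁ := mul_nonneg (by linarith) hC₁
    rw [gumbelLogLik, hB]
    nlinarith [mul_nonneg h9 hS0.le, mul_nonneg hC₂ hT0.le]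
  intro L hL
  rw [hS, hT2]
  set r := gumbelLogLik γ w
  set A := B * (1 + S + T) with hA
  have hA0 : 0 ≤ A := by positivity
  have hA2 : A ^ 2 / L ≤ 3 * B ^ 2 * (1 + S ^ 2 + T ^ 2) / L := by
    gcongr
    have : (1 + S + T) ^ 2 ≤ 3 * (1 + S ^ 2 + T ^ 2) := by
      linarith [sq_nonneg (1 - S), sq_nonneg (1 - T), sq_nonneg (S - T)]
    rw [hA, mul_pow, mul_comm 3, mul_assoc]
    exact mul_le_mul_of_nonneg_left this (sq_nonneg B)
  rcases max_cases r (-L) with h | h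
  · rw [h.1]
    have : 0 ≤ A ^ 2 / L := by positivity
    linarith
  · rw [h.1]
    have : A - L ≤ A ^ 2 / L := by
      rw [le_div_iff₀ hL]
      linarith [sq_nonneg (A - L), mul_nonneg hA0 hL.le]
    linarith

/-! ### The mean log-likelihood at the shifted parameter, uniformly in the clipping level. -/

lemma EReal.coe_finset_sum_real {ι : Type*} (s : Finset ι) (f : ι → ℝ) :
    ((∑ i ∈ s, f i : ℝ) : EReal) = ∑ i ∈ s, (f i : EReal) := by
  classical
  induction s using Finset.induction_on with
  | empty => simp
  | insert i s hi ih => rw [Finset.sum_insert hi, Finset.sum_insert hi, EReal.coe_add, ih]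

/-- The mean of `ℓ_θ` over `y 0, …, y (n - 1)`. -/
def meanLogLik (y : ℕ → ℝ) (n : ℕ) (θ : ℝ × ℝ × ℝ) : EReal :=
  (((n : ℝ)⁻¹ : ℝ) : EReal) * ∑ k ∈ Finset.range n, gevLogLik θ (y k)

lemma meanLogLik_le (M : ℝ) (y : ℕ → ℝ) (n : ℕ) (θ : ℝ × ℝ × ℝ) :
    meanLogLik y n θ ≤ (((n : ℝ)⁻¹ * ∑ k ∈ Finset.range n, gevClip M θ (y k) : ℝ) : EReal) := by
  rw [meanLogLik, EReal.coe_mul, EReal.coe_finset_sum_real]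
  refine mul_le_mul_of_nonneg_left (Finset.sum_le_sum fun k _ => gevLogLik_le_gevClip M θ (y k)) ?_
  exact EReal.coe_nonneg.2 (by positivity)

/-- The clipping errors are averaged: both random terms have almost surely bounded means. `C` is
chosen before `L`, which lets `L → ∞` after `n → ∞`. -/
theorem ae_le_meanLogLik_shiftedParam {Ω : Type*} [MeasurableSpace Ω] {P : Measure Ω}
    [IsProbabilityMeasure P] {X : ℕ → Ω → ℝ} (hm : ∀ i, Measurable (X i)) (hind : iIndepFun X P)
    {F : ℝ → ℝ} (hcdf : ∀ i x, P.real {ω | X i ω ≤ x} = F x) {γ : ℝ} (hγ : -1 < γ) {a b : ℕ → ℝ}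
    (hab : IsNorming F γ a b) {m : ℕ → ℕ}
    (hmn : Tendsto (fun n : ℕ => (m n : ℝ) / Real.log n) atTop atTop) {δ : ℝ} (hδ : 0 < δ) :
    ∀ᵐ ω ∂P, ∃ C : ℝ, ∀ᶠ n : ℕ in atTop, ∀ L > 0,
      (((n : ℝ)⁻¹ * ∑ k ∈ Finset.range n,
          gevClip L (shiftedParam γ δ) (normBlockMax X a b (m n) k ω) - C / L : ℝ) : EReal)
        ≤ meanLogLik (fun k => normBlockMax X a b (m n) k ω) n (shiftedParam γ δ) := by
  have hF := isDistributionFunction_of_cdf (hm 0) (hcdf 0)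
  have hpr := Measure.isProbabilityMeasure_map (μ := P) (hm 0).aemeasurable
  obtain ⟨C, hC, t₀, ht₀, hbd⟩ := eventually_gevLogLik_shiftedParam_bound hF hγ hab hδ
  have hminf := tendsto_of_tendsto_div_log hmn
  have hanti : Antitone fun x : ℝ => (P.map (X 0)).real (Set.Ici x) := fun x y hxy =>
    measureReal_mono (Set.Ici_subset_Ici.2 hxy)
  have hg1 : ∀ n, Measurable fun x : ℝ => Real.exp (m n * (1 - F x) / 8) := fun n =>
    Real.measurable_exp.comp (((measurable_const.sub hF.mono.measurable).const_mul _).div_const _)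
  have hg2 : ∀ n, Measurable fun x : ℝ =>
      (m n * (P.map (X 0)).real (Set.Ici x)) ^ (-(1 / 8) : ℝ) := fun n =>
    (hanti.measurable.const_mul _).pow_const _
  have h1 := ae_exists_average_le (P := P)
    (W := fun n k ω => Real.exp (m n * (1 - F (blockMax X (m n) k ω)) / 8))
    (fun n k => (hg1 n).comp (measurable_blockMax hm _ _))
    (fun n => (iIndepFun_blockMax hm hind (m n)).comp _ (fun _ => hg1 n))
    (fun n k ω => (Real.exp_pos _).le)
    (by filter_upwards [hminf.eventually_ge_atTop 1] with n hn k t ht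
        exact measureReal_lt_exp_blockMax_le hm hind hcdf hn k ht)
  have h2 := ae_exists_average_le (P := P)
    (W := fun n k ω => (m n * (P.map (X 0)).real (Set.Ici (blockMax X (m n) k ω))) ^ (-(1 / 8) : ℝ))
    (fun n k => (hg2 n).comp (measurable_blockMax hm _ _))
    (fun n => (iIndepFun_blockMax hm hind (m n)).comp _ (fun _ => hg2 n))
    (fun n k ω => by positivity)
    (by filter_upwards [hminf.eventually_ge_atTop 1] with n hn k t ht
        exact measureReal_lt_rpow_blockMax_le hm hcdf hn k ht)
  filter_upwards [h1, h2, ae_tail_pos hm hcdf, ae_eventually_blockMax_ge hm hind hcdf hmn ht₀]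
    with ω ⟨C₁, hC₁⟩ ⟨C₂, hC₂⟩ hpos hge
  refine ⟨C * (1 + C₁ + C₂), ?_⟩
  filter_upwards [hC₁, hC₂, hge, hminf.eventually hbd, hminf.eventually_ge_atTop 1,
    eventually_ge_atTop 1] with n h3 h4 h5 h6 hmn1 hn1 L hL
  have hn0 : (0 : ℝ) < n := by exact_mod_cast hn1
  have h7 : ∀ k ∈ Finset.range n, ∃ r : ℝ,
      gevLogLik (shiftedParam γ δ) (normBlockMax X a b (m n) k ω) = (r : EReal) ∧
      gevClip L (shiftedParam γ δ) (normBlockMax X a b (m n) k ω)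
        - C * (1 + Real.exp (m n * (1 - F (blockMax X (m n) k ω)) / 8)
          + (m n * (P.map (X 0)).real (Set.Ici (blockMax X (m n) k ω))) ^ (-(1 / 8) : ℝ)) / L
        ≤ r := by
    intro k hk
    have hq : 0 < (P.map (X 0)).real (Set.Ici (blockMax X (m n) k ω)) := by
      obtain ⟨j, hj⟩ := exists_eq_blockMax (X := X) hmn1 k ω
      rw [← hj]
      exact hpos _
    have hle : ∀ y < blockMax X (m n) k ω,
        (P.map (X 0)).real (Set.Ici (blockMax X (m n) k ω)) ≤ 1 - F y := by
      intro y hy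
      rw [← map_real_Iic hm hcdf y, ← probReal_compl_eq_one_sub measurableSet_Iic]
      refine measureReal_mono fun z hz => ?_
      have h8 : blockMax X (m n) k ω ≤ z := hz
      exact fun h9 => absurd (hy.trans_le h8) (not_lt.2 h9)
    obtain ⟨r, hr, hrL⟩ := h6 _ _ (h5 k (Finset.mem_range.1 hk)) hq hle
    refine ⟨r, hr, ?_⟩
    change gevLogLik (shiftedParam γ δ) (normBlockMax X a b (m n) k ω) = (r : EReal) at hr
    rw [gevClip_of_coe hr]
    exact hrL L hL
  choose! r hr hrL using h7
  have h8 : meanLogLik (fun k => normBlockMax X a b (m n) k ω) n (shiftedParam γ δ)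
      = (((n : ℝ)⁻¹ * ∑ k ∈ Finset.range n, r k : ℝ) : EReal) := by
    rw [meanLogLik, EReal.coe_mul, EReal.coe_finset_sum_real, Finset.sum_congr rfl hr]
  rw [h8, EReal.coe_le_coe_iff]
  have h9 := mul_le_mul_of_nonneg_left (Finset.sum_le_sum hrL) (inv_nonneg.2 hn0.le)
  refine le_trans ?_ h9
  rw [Finset.sum_sub_distrib, ← Finset.sum_div, ← Finset.mul_sum, Finset.sum_add_distrib,
    Finset.sum_add_distrib, Finset.sum_const, Finset.card_range, nsmul_eq_mul, mul_one, mul_sub,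
    sub_le_sub_iff_left, ← mul_div_assoc]
  refine div_le_div_of_nonneg_right ?_ hL.le
  rw [mul_left_comm]
  refine mul_le_mul_of_nonneg_left ?_ hC
  rw [mul_add, mul_add, inv_mul_cancel₀ hn0.ne']
  linarith

/-! ### Identification of the limit points and conclusion. -/

lemma continuous_gevClip (M : ℝ) {θ : ℝ × ℝ × ℝ} (hθ : θ ∈ gevParamSpace) :
    Continuous (gevClip M θ) :=
  continuous_iff_continuousAt.2 fun x =>
    ContinuousAt.comp (g := fun p : (ℝ × ℝ × ℝ) × ℝ => gevClip M p.1 p.2)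
      (f := fun x : ℝ => (θ, x)) (continuousAt_gevClip M hθ x) (by fun_prop)

lemma continuous_gevLogLik {θ : ℝ × ℝ × ℝ} (hθ : θ ∈ gevParamSpace) : Continuous (gevLogLik θ) :=
  continuous_iff_continuousAt.2 fun x =>
    ContinuousAt.comp (g := fun p : (ℝ × ℝ × ℝ) × ℝ => gevLogLik p.1 p.2)
      (f := fun x : ℝ => (θ, x)) (continuousAt_gevLogLik hθ x) (by fun_prop)

lemma integrable_gevClip_gevMap {M B : ℝ} (hB : 0 ≤ B) (hM : 0 ≤ M) {θ : ℝ × ℝ × ℝ}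
    (hθ : θ ∈ gevParamSpace) (hle : ∀ x, gevLogLik θ x ≤ (B : EReal)) (θ' : ℝ × ℝ × ℝ) :
    Integrable (fun e => gevClip M θ (gevMap θ' e)) expLaw := by
  refine Integrable.of_bound
    ((continuous_gevClip M hθ).measurable.comp (measurable_gevMap θ')).aestronglyMeasurable
    (max B M) (ae_of_all _ fun e => ?_)
  have h1 := gevClip_le hB hM (hle (gevMap θ' e))
  have h2 := neg_le_gevClip M θ (gevMap θ' e)
  rw [Real.norm_eq_abs, abs_le]
  exact ⟨by linarith [le_max_right B M], h1.trans (le_max_left _ _)⟩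

lemma integrable_gumbel_expLaw (γ : ℝ) :
    Integrable (fun e => (1 + γ) * Real.log e - e) expLaw := by
  refine (integrable_log_expLaw.const_mul _).sub ?_
  simpa using integrable_rpow_expLaw (s := 1) (by norm_num)

/-- If the clipped log-likelihoods at `θ` have means under `G_γ` at least that of the true
log-likelihood, then `θ` is the true parameter. -/
lemma eq_of_forall_integral_gevClip {θ : ℝ × ℝ × ℝ} (hθ : θ ∈ gevParamSpace) {γ B : ℝ} (hB : 0 ≤ B)
    (hle : ∀ x, gevLogLik θ x ≤ (B : EReal))
    (h : ∀ M : ℝ, 0 ≤ M → ∫ e, ((1 + γ) * Real.log e - e) ∂expLaw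
      ≤ ∫ e, gevClip M θ (gevMap (γ, 0, 1) e) ∂expLaw) : θ = (γ, 0, 1) := by
  set T := gevMap (γ, 0, 1) with hT
  set E := ∫ e, ((1 + γ) * Real.log e - e) ∂expLaw with hE
  have hTm : Measurable T := measurable_gevMap _
  -- `B` minus the clipped log-likelihood is nonnegative and increases with `M`. Monotone
  -- convergence bounds the integral of the supremum, which shows at once that `⊥` has probability
  -- zero and that the log-likelihood is integrable.
  set f : ℕ → ℝ → ENNReal := fun M e => ENNReal.ofReal (B - gevClip M θ (T e)) with hf
  have hfm : ∀ M, Measurable (f M) := fun M =>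
    (measurable_const.sub ((continuous_gevClip M hθ).measurable.comp hTm)).ennreal_ofReal
  have hmono : Monotone f := by
    intro M N hMN e
    refine ENNReal.ofReal_le_ofReal (sub_le_sub_left ?_ _)
    rw [← EReal.coe_le_coe_iff, coe_gevClip, coe_gevClip]
    refine max_le_max le_rfl (EReal.coe_le_coe_iff.2 (neg_le_neg ?_))
    exact_mod_cast hMN
  have hnn : ∀ (M : ℕ) e, 0 ≤ B - gevClip M θ (T e) := fun M e =>
    sub_nonneg.2 (gevClip_le hB M.cast_nonneg (hle _))
  have hfint : ∀ M, ∫⁻ e, f M e ∂expLaw ≤ ENNReal.ofReal (B - E) := by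
    intro M
    have hi := integrable_gevClip_gevMap hB M.cast_nonneg hθ hle (γ, 0, 1)
    have hi2 : Integrable (fun e => B - gevClip M θ (T e)) expLaw := (integrable_const B).sub hi
    rw [hf, ← ofReal_integral_eq_lintegral_ofReal hi2 (ae_of_all _ (hnn M)),
      integral_sub (integrable_const B) hi]
    refine ENNReal.ofReal_le_ofReal ?_
    have := h M M.cast_nonneg
    simp only [integral_const, probReal_univ, one_smul]
    linarith
  have hsup : ∫⁻ e, ⨆ M, f M e ∂expLaw ≤ ENNReal.ofReal (B - E) := by
    rw [lintegral_iSup hfm hmono]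
    exact iSup_le hfint
  have hfin : ∀ᵐ e ∂expLaw, ⨆ M, f M e < ⊤ :=
    ae_lt_top (Measurable.iSup hfm) (hsup.trans_lt ENNReal.ofReal_lt_top).ne
  have hbot : ∀ᵐ e ∂expLaw, gevLogLik θ (T e) ≠ ⊥ := by
    filter_upwards [hfin] with e he hb
    obtain ⟨N, hN⟩ := ENNReal.exists_nat_gt he.ne
    have h1 : f N e ≤ ⨆ M, f M e := le_iSup (fun M => f M e) N
    have h2 : (N : ENNReal) ≤ f N e := by
      simp only [hf]
      rw [gevClip_of_bot hb, ← ENNReal.ofReal_natCast]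
      exact ENNReal.ofReal_le_ofReal (by linarith)
    exact absurd hN (not_lt.2 (h2.trans h1))
  have hlm : Measurable fun e => (gevLogLik θ (T e)).toReal :=
    ((continuous_gevLogLik hθ).measurable.comp hTm).ereal_toReal
  have hcoe : ∀ᵐ e ∂expLaw, gevLogLik θ (T e) = (((gevLogLik θ (T e)).toReal : ℝ) : EReal) := by
    filter_upwards [hbot] with e he
    exact (EReal.coe_toReal (gevLogLik_ne_top _ _) he).symm
  have hlint : ∫⁻ e, ENNReal.ofReal (B - (gevLogLik θ (T e)).toReal) ∂expLaw
      ≤ ENNReal.ofReal (B - E) := by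
    refine le_trans (lintegral_mono_ae ?_) hsup
    filter_upwards [hcoe] with e he
    obtain ⟨N, hN⟩ := exists_nat_gt (-(gevLogLik θ (T e)).toReal)
    refine le_trans (le_of_eq ?_) (le_iSup (fun M => f M e) N)
    simp only [hf]
    rw [gevClip_of_coe he, max_eq_left (by linarith)]
  have hnn2 : 0 ≤ᵐ[expLaw] fun e => B - (gevLogLik θ (T e)).toReal := by
    filter_upwards [hcoe] with e he
    have h1 := hle (T e)
    rw [he, EReal.coe_le_coe_iff] at h1
    exact sub_nonneg.2 h1
  have hi1 : Integrable (fun e => B - (gevLogLik θ (T e)).toReal) expLaw := by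
    refine ⟨(measurable_const.sub hlm).aestronglyMeasurable, ?_⟩
    rw [hasFiniteIntegral_iff_ofReal hnn2]
    exact hlint.trans_lt ENNReal.ofReal_lt_top
  have hi2 : Integrable (fun e => (gevLogLik θ (T e)).toReal) expLaw := by
    refine ((integrable_const B).sub hi1).congr (ae_of_all _ fun e => ?_)
    simp
  refine eq_of_integral_le hθ.2 hbot hi2 ?_
  have hBE : 0 ≤ B - E := by
    have h1 := h 0 le_rfl
    have h2 : ∫ e, gevClip 0 θ (T e) ∂expLaw ≤ ∫ _, B ∂expLaw :=
      integral_mono (integrable_gevClip_gevMap hB le_rfl hθ hle (γ, 0, 1)) (integrable_const B)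
        fun e => gevClip_le hB le_rfl (hle _)
    simp only [integral_const, probReal_univ, one_smul] at h2
    linarith
  rw [← ofReal_integral_eq_lintegral_ofReal hi1 hnn2, ENNReal.ofReal_le_ofReal_iff hBE,
    integral_sub (integrable_const B) hi2] at hlint
  simp only [integral_const, probReal_univ, one_smul] at hlint
  linarith

/-- Limit points of maximizers are the true parameter. -/
lemma eq_of_tendsto_maximizers {K : Set (ℝ × ℝ × ℝ)} (hKΘ : K ⊆ gevParamSpace) (hK : IsCompact K)
    {γ : ℝ} (hγ : -1 < γ) (hK₀ : K ∈ 𝓝 ((γ, 0, 1) : ℝ × ℝ × ℝ)) {y : ℕ → ℕ → ℝ}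
    (hy : Tendsto (fun n => empiricalProba (y n) n) atTop (𝓝 (gevLaw γ)))
    (hlow : ∀ j : ℕ, ∃ C : ℝ, ∀ᶠ n : ℕ in atTop, ∀ L > 0,
      (((n : ℝ)⁻¹ * ∑ k ∈ Finset.range n,
        gevClip L (shiftedParam γ (1 / ((j : ℝ) + 1))) (y n k) - C / L : ℝ) : EReal)
        ≤ meanLogLik (y n) n (shiftedParam γ (1 / ((j : ℝ) + 1))))
    {N : ℕ → ℕ} (hN : Tendsto N atTop atTop) {θ : ℕ → ℝ × ℝ × ℝ} {θ' : ℝ × ℝ × ℝ}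
    (hθK : ∀ i, θ i ∈ K) (hmax : ∀ i, IsMaxOn (meanLogLik (y (N i)) (N i)) K (θ i))
    (hθ'K : θ' ∈ K) (hθ : Tendsto θ atTop (𝓝 θ')) : θ' = (γ, 0, 1) := by
  obtain ⟨B, hB0, hB⟩ := exists_gevLogLik_le hKΘ hK
  obtain ⟨R, hR, hRle⟩ := exists_le_gevLogLik_shiftedParam hγ
  refine eq_of_forall_integral_gevClip (hKΘ hθ'K) hB0 (hB θ' hθ'K) fun M hM => ?_
  have hj0 := tendsto_one_div_add_atTop_nhds_zero_nat (𝕜 := ℝ)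
  have hjK : ∀ᶠ j : ℕ in atTop, shiftedParam γ (1 / ((j : ℝ) + 1)) ∈ K := by
    have h1 := ((continuous_shiftedParam γ).tendsto 0).comp hj0
    rw [shiftedParam_zero] at h1
    exact h1.eventually hK₀
  have hlim : Tendsto (fun j : ℕ => ∫ e, ((1 + γ) * Real.log e - e) ∂expLaw
      - 1 / ((j : ℝ) + 1) * ∫ e, R e ∂expLaw) atTop
      (𝓝 (∫ e, ((1 + γ) * Real.log e - e) ∂expLaw - 0 * ∫ e, R e ∂expLaw)) :=
    tendsto_const_nhds.sub (hj0.mul_const _)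
  rw [zero_mul, sub_zero] at hlim
  -- `M` is fixed; the limit `δ = 1 / (j + 1) → 0` is the last to be taken, so `δ` and then `L` are
  -- fixed below.
  refine le_of_tendsto hlim ?_
  filter_upwards [hjK] with j hj
  set δ := 1 / ((j : ℝ) + 1) with hδ
  have hδ0 : 0 < δ := by positivity
  have hδ1 : δ ≤ 1 := by
    rw [hδ, div_le_one (by positivity)]
    linarith [j.cast_nonneg (α := ℝ)]
  obtain ⟨C, hC⟩ := hlow j
  have hupp := tendsto_average_gevClip hKΘ hK hM hy hN hθK hθ'K hθ
  have hL : ∀ L : ℝ, 0 < L → ∫ e, ((1 + γ) * Real.log e - e) ∂expLaw - δ * ∫ e, R e ∂expLaw - C / L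
      ≤ ∫ e, gevClip M θ' (gevMap (γ, 0, 1) e) ∂expLaw := by
    intro L hL
    -- For fixed `L` the chain is: clipped mean at the shifted parameter minus `C / L`, true mean
    -- there, true mean at the maximizer, clipped mean at the maximizer. The two outer terms
    -- converge.
    have hlo := (tendsto_average_gevClip hKΘ hK hL.le hy hN (fun _ => hj) hj
      tendsto_const_nhds).sub_const (C / L)
    have h1 := le_of_tendsto_of_tendsto hlo hupp (by
      filter_upwards [hN.eventually hC] with i hi
      have h2 := (hi L hL).trans ((hmax i hj).trans (meanLogLik_le M (y (N i)) (N i) (θ i)))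
      exact EReal.coe_le_coe_iff.1 h2)
    have hi0 : Integrable (fun e => (1 + γ) * Real.log e - e) expLaw := integrable_gumbel_expLaw γ
    have hi1 : Integrable (fun e => δ * R e) expLaw := hR.const_mul δ
    have h2 : ∫ e, ((1 + γ) * Real.log e - e - δ * R e) ∂expLaw
        ≤ ∫ e, gevClip L (shiftedParam γ δ) (gevMap (γ, 0, 1) e) ∂expLaw := by
      refine integral_mono_ae (hi0.sub hi1)
        (integrable_gevClip_gevMap hB0 hL.le (hKΘ hj) (hB _ hj) _) ?_
      filter_upwards [ae_pos_expLaw] with e he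
      exact EReal.coe_le_coe_iff.1 ((hRle δ hδ0 hδ1 e he).trans (gevLogLik_le_gevClip L _ _))
    rw [integral_sub hi0 hi1, integral_const_mul] at h2
    linarith
  have hlimL : Tendsto (fun L : ℝ => ∫ e, ((1 + γ) * Real.log e - e) ∂expLaw
      - δ * ∫ e, R e ∂expLaw - C / L) atTop
      (𝓝 (∫ e, ((1 + γ) * Real.log e - e) ∂expLaw - δ * ∫ e, R e ∂expLaw - 0)) :=
    tendsto_const_nhds.sub (tendsto_const_nhds.div_atTop tendsto_id)
  rw [sub_zero] at hlimL
  exact le_of_tendsto hlimL ((eventually_gt_atTop 0).mono hL)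

end

theorem mainTheorem3 {Ω : Type*} [MeasurableSpace Ω] (P : Measure Ω) [IsProbabilityMeasure P]
    (X : ℕ → Ω → ℝ) (hmeas : ∀ i, Measurable (X i)) (hindep : iIndepFun X P)
    (F : ℝ → ℝ) (hcdf : ∀ i x, P.real {ω | X i ω ≤ x} = F x)
    (γ₀ : ℝ) (hγ₀ : -1 < γ₀) (hF : InDomainOfAttraction F γ₀)
    (a b : ℕ → ℝ) (hab : IsStandardNorming F γ₀ a b ∨ IsNorming F γ₀ a b)
    (m : ℕ → ℕ) (hm : Tendsto (fun n : ℕ => (m n : ℝ) / Real.log n) atTop atTop)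
    (K : Set (ℝ × ℝ × ℝ)) (hKΘ : K ⊆ gevParamSpace) (hK : IsCompact K)
    (hK₀ : K ∈ 𝓝 ((γ₀, 0, 1) : ℝ × ℝ × ℝ)) :
    (∀ n ω, ∃ θ ∈ K, IsMaxOn (normLogLik X a b (m n) n ω) K θ) ∧
      ∀ θK : ℕ → Ω → ℝ × ℝ × ℝ,
        (∀ n, 1 ≤ n → ∀ ω, θK n ω ∈ K ∧ IsMaxOn (normLogLik X a b (m n) n ω) K (θK n ω)) →
        ∀ᵐ ω ∂P, Tendsto (fun n => θK n ω) atTop (𝓝 (γ₀, 0, 1)) := by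
  refine ⟨fun n ω => exists_isMaxOn_normLogLik X a b hKΘ hK ⟨_, mem_of_mem_nhds hK₀⟩ (m n) n ω,
    fun θK hθK => ?_⟩
  have hdf := isDistributionFunction_of_cdf (hmeas 0) (hcdf 0)
  have hab' : IsNorming F γ₀ a b := hab.elim (fun h => h.isNorming hdf hF) id
  -- Only the shifts `1 / (j + 1)` are used, so a single null set serves them all and the rest is
  -- deterministic.
  have hlow := ae_all_iff.2 fun j : ℕ => ae_le_meanLogLik_shiftedParam hmeas hindep hcdf hγ₀ hab' hm
    (δ := 1 / ((j : ℝ) + 1)) (by positivity)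
  filter_upwards [ae_tendsto_empiricalLaw hmeas hindep hcdf hab' (tendsto_of_tendsto_div_log hm),
    hlow] with ω hω hωlow
  -- Every subsequence has, by compactness of `K`, a further one that converges, and its limit must
  -- be the true parameter. No measurability of the maximizers is involved.
  refine tendsto_of_subseq_tendsto fun ns hns => ?_
  -- The maximizer at `n = 0` is arbitrary, so the subsequence is started late enough to avoid it.
  obtain ⟨i₀, hi₀⟩ := eventually_atTop.1 (hns.eventually_ge_atTop 1)
  have h1 : ∀ i, 1 ≤ ns (i + i₀) := fun i => hi₀ _ (by omega)
  obtain ⟨θ', hθ', φ, hφ, hlim⟩ := hK.tendsto_subseq fun i => (hθK _ (h1 i) ω).1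
  refine ⟨fun i => φ i + i₀, ?_⟩
  have hN : Tendsto (fun i => ns (φ i + i₀)) atTop atTop :=
    hns.comp (tendsto_atTop_mono (fun i => Nat.le_add_right _ _) hφ.tendsto_atTop)
  have h2 := eq_of_tendsto_maximizers hKΘ hK hγ₀ hK₀ hω hωlow hN (fun i => (hθK _ (h1 (φ i)) ω).1)
    (fun i => (hθK _ (h1 (φ i)) ω).2) hθ' hlim
  rwa [h2] at hlim
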